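/- Fix an integer $n\ge 1$ and $\beta>0$. Let $\mathcal J$ be a random $n\times n$ Jacobi matrix from the Gaussian $\beta$-ensemble, i.e. the real symmetric tridiagonal matrix with diagonal entries $b_1,\dots,b_n\in\mathbb R$ and off-diagonal entries $a_1,\dots,a_{n-1}>0$ whose joint distribution has density proportional to $$\prod_{j=1}^{n-1}a_j^{\beta(n-j)-1}\exp\Big(-\sum_{j=1}^{n-1}a_j^2-\tfrac12\sum_{j=1}^n b_j^2\Big).$$ Let $l>0$ be a random variable independent of $\mathcal J$ with absolutely continuous distribution $d\nu=F(x)\,dx$. For $z\in\mathbb C$ let $\operatorname{Arg}_{[0,\pi)}z$ be $\operatorname{Arg}z$ if $\operatorname{Im}z>0$, $0$ if $z\in\mathbb R$, and $\pi+\operatorname{Arg}z$ if $\operatorname{Im}z<0$, where $\operatorname{Arg}z\in(-\pi,\pi]$ is the principal argument. Let $$D=\Big\{(z_j)_{j=1}^n\in(\mathbb C\setminus\mathbb R)^n:\ \sum_{j=1}^n\operatorname{Arg}_{[0,\pi)}z_j<\tfrac{\pi}{2},\ \ \tan\Big(\sum_{j=1}^n\operatorname{Arg}_{[0,\pi)}z_j\Big)\in\operatorname{supp}\nu\Big\}.$$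 Let $z_1,\dots,z_n$ be the eigenvalues, counted with algebraic multiplicity, of $\mathcal J_{l,\times}=(I_n+i\,l\,e_1e_1^*)\mathcal J$. Then almost surely $(z_1,\dots,z_n)\in D$ and $l=\tan\big(\sum_j\operatorname{Arg}_{[0,\pi)}z_j\big)$. Moreover the unordered $n$-tuple $\{z_1,\dots,z_n\}$ is distributed as the unordered version of a random vector in $\mathbb C^n$ which has, with respect to Lebesgue measure $d^2z_1\cdots d^2z_n$, the (permutation-invariant) probability density equal to $0$ outside $D$ and, on $D$, equal to $$\frac1{C_{\beta,n}}\,e^{-\frac12\left((\sum_{j}\operatorname{Re}z_j)^2-\sum_{j\ne k}\operatorname{Re}(z_jz_k)\right)}\,\frac1{|\operatorname{Re}(\prod_{j}z_j)|^{\beta/2}}\prod_{j,k=1}^n|z_j-\bar z_k|^{\beta/2-1}\prod_{1\le j<k\le n}|z_j-z_k|^2\;\,t^{\,1-\beta n/2}F(t),$$ where $t=\tan\big(\sum_{j=1}^n\operatorname{Arg}_{[0,\pi)}z_j\big)$ and $$C_{\beta,n}=2^{n(\beta/2-1)}\,(2\pi)^{n/2}\prod_{j=1}^n\frac{\Gamma(1+\beta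 j/2)}{\Gamma(1+\beta/2)}\cdot\frac{\Gamma(\beta/2)^n}{\Gamma(\beta n/2)}.$$ -/

import Mathlib

open MeasureTheory ProbabilityTheory
open scoped BigOperators ENNReal

noncomputable section

namespace MultPert

/-- The `n × n` real tridiagonal (Jacobi) matrix with diagonal entries `b 0, …, b (n-1)` and
off-diagonal entries `a 0, …, a (n-2)`. -/
def jacobiMatrix {n : ℕ} (a : Fin (n - 1) → ℝ) (b : Fin n → ℝ) : Matrix (Fin n) (Fin n) ℝ :=
  Matrix.of fun i j =>
    if i = j then b i
    else if h : i.1 + 1 = j.1 then a ⟨i.1, by omega⟩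
    else if h : j.1 + 1 = i.1 then a ⟨j.1, by omega⟩
    else 0

/-- Matrices carry the product (entrywise) Borel σ-algebra. -/
instance matrixMeasurableSpace (n : ℕ) : MeasurableSpace (Matrix (Fin n) (Fin n) ℝ) :=
  inferInstanceAs (MeasurableSpace (Fin n → Fin n → ℝ))

/-- The unnormalized weight
`∏_{j=1}^{n-1} a_j^{β(n-j)-1} exp(-∑ a_j² - ½ ∑ b_j²)` on Jacobi coefficients
(the index `j` below runs from `0`, so that it stands for the `(j+1)`-st coefficient). -/
def coefficientWeight (β : ℝ) (n : ℕ) (x : (Fin (n - 1) → ℝ) × (Fin n → ℝ)) : ℝ :=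
  (∏ j : Fin (n - 1), x.1 j ^ (β * ((n : ℝ) - ((j.1 : ℝ) + 1)) - 1)) *
    Real.exp (-(∑ j, x.1 j ^ 2) - (1 / 2) * ∑ j, x.2 j ^ 2)

/-- The measure with density `coefficientWeight` on `{a_j > 0, b_j ∈ ℝ}`. -/
def coefficientMeasure (β : ℝ) (n : ℕ) : Measure ((Fin (n - 1) → ℝ) × (Fin n → ℝ)) :=
  (volume.restrict {x | ∀ j, 0 < x.1 j}).withDensity
    fun x => ENNReal.ofReal (coefficientWeight β n x)

/-- The Gaussian `β`-ensemble: the law of the random Jacobi matrix whose coefficients have joint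
distribution proportional to `coefficientWeight` (normalized to total mass one). -/
def gaussianBetaEnsemble (β : ℝ) (n : ℕ) : Measure (Matrix (Fin n) (Fin n) ℝ) :=
  ((coefficientMeasure β n Set.univ)⁻¹ • coefficientMeasure β n).map
    fun x => jacobiMatrix x.1 x.2

/-- The multiplicative perturbation `(I + i l e₁ e₁^*) J`. -/
def multPerturbation {n : ℕ} [NeZero n] (J : Matrix (Fin n) (Fin n) ℝ) (l : ℝ) :
    Matrix (Fin n) (Fin n) ℂ :=
  (1 + (Complex.I * (l : ℂ)) • Matrix.single (0 : Fin n) (0 : Fin n) (1 : ℂ)) *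
    J.map (fun x : ℝ => (x : ℂ))

/-- The unordered `n`-tuple underlying an ordered one. -/
def toConfig {n : ℕ} (z : Fin n → ℂ) : Sym ℂ n :=
  ⟨Finset.univ.val.map z, by simp⟩

/-- Unordered `n`-tuples carry the quotient σ-algebra: a set of configurations is measurable iff
the (permutation invariant) set of its enumerations is a Borel set of `ℂⁿ`. -/
instance configMeasurableSpace (n : ℕ) : MeasurableSpace (Sym ℂ n) :=
  MeasurableSpace.map (toConfig (n := n)) inferInstance

/-- The eigenvalues of a complex matrix, with algebraic multiplicity, as an unordered tuple. -/
def eigenvalues {n : ℕ} (A : Matrix (Fin n) (Fin n) ℂ) : Sym ℂ n :=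
  ⟨A.charpoly.roots, by
    rw [IsAlgClosed.card_roots_eq_natDegree, Matrix.charpoly_natDegree_eq_dim, Fintype.card_fin]⟩

/-- The argument modulo `π`, with values in `[0, π)`. -/
def argModPi (z : ℂ) : ℝ :=
  if 0 < z.im then Complex.arg z
  else if z.im = 0 then 0
  else Real.pi + Complex.arg z

/-- `∑_j Arg_{[0,π)} z_j`. -/
def argSum {n : ℕ} (z : Fin n → ℂ) : ℝ := ∑ j, argModPi (z j)

/-- The possible eigenvalue configurations: `z ∈ (ℂ ∖ ℝ)ⁿ` with `∑ Arg_{[0,π)} z_j < π / 2` and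
`tan (∑ Arg_{[0,π)} z_j) ∈ supp ν`. -/
def configurations (n : ℕ) (ν : Measure ℝ) : Set (Fin n → ℂ) :=
  {z | (∀ j, (z j).im ≠ 0) ∧ argSum z < Real.pi / 2 ∧ Real.tan (argSum z) ∈ ν.support}

/-- `g_{β,n}`. -/
def gConst (β : ℝ) (n : ℕ) : ℝ :=
  (2 * Real.pi) ^ ((n : ℝ) / 2) *
    ∏ j ∈ Finset.Icc 1 n, Real.Gamma (1 + β * (j : ℝ) / 2) / Real.Gamma (1 + β / 2)

/-- `c_{β,n}`. -/
def cConst (β : ℝ) (n : ℕ) : ℝ :=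
  Real.Gamma (β / 2) ^ n / Real.Gamma (β * (n : ℝ) / 2)

/-- `C_{β,n} = g_{β,n} c_{β,n} 2^{n(β/2-1)}`. -/
def normConst (β : ℝ) (n : ℕ) : ℝ :=
  gConst β n * cConst β n * (2 : ℝ) ^ ((n : ℝ) * (β / 2 - 1))

/-- The joint density of the eigenvalues, with respect to Lebesgue measure `d²z_1 ⋯ d²z_n`. -/
def jointDensity (β : ℝ) (n : ℕ) (F : ℝ → ℝ) (z : Fin n → ℂ) : ℝ :=
  (normConst β n)⁻¹ *
    Real.exp (-(1 / 2) * ((∑ j, (z j).re) ^ 2 -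
      ∑ j, ∑ k ∈ Finset.univ.filter (fun k => k ≠ j), (z j * z k).re)) *
    (1 / |(∏ j, z j).re| ^ (β / 2)) *
    (∏ j, ∏ k, ‖z j - (starRingEnd ℂ) (z k)‖ ^ (β / 2 - 1)) *
    (∏ j, ∏ k ∈ Finset.univ.filter (fun k => j < k), ‖z j - z k‖ ^ 2) *
    (Real.tan (argSum z) ^ (1 - β * (n : ℝ) / 2) * F (Real.tan (argSum z)))

end MultPert

end

open MeasureTheory ProbabilityTheory
open scoped BigOperators ENNReal

noncomputable section

namespace MultPert

/-! Write n = m + 1, and let p and c be the characteristic polynomials of J and of J without its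
first row and column. The perturbation rescales only the first row, so linearity of the determinant
in that row gives the perturbed characteristic polynomial χ = p + i h with p and h = l (p - X c)
real (`charpoly_multPerturbation`). The law of (a, b, l) is carried through three maps: (a, b) ↦ (p,
c), (p, c, l) ↦ (p, h), and coefficients ↦ roots.

The first map is inverted by the Euclidean algorithm: p = (X - b₁) c - a₁² d, and the same for (c,
d). The pairs reached are the interlacing ones, those for which c / p has simple real poles with
positive residues. For fixed c, a division step is a translation in b₁ and in the remainder, whose
splitting into leading coefficient s = a₁² and monic part has Jacobian a power of s. Hence
`lintegral_jacobiCoeffs`, and the Gaussian weight becomes |Res(p, c)|^(β/2 - 1) exp(-tr J² / 2)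
(`coefficientWeight_eq`). The second map has Jacobian |p(0)| l^m (`lintegral_perturbCoeffs`). The
third has real Jacobian the squared Vandermonde modulus, and forgetting the order costs n!
(`map_rootConfig_withDensity`).

In terms of the roots, tr J² is read off the second and third highest coefficients of p, and ∏ |z_j
- conj z_k| = (2 l)^n |p(0)| |Res(p, c)| (`prod_norm_sub_conj`), because the conjugate polynomial of
χ is a multiple of X c at the roots of χ.

The possible root configurations are found by following φ(x) = ∑ Arg(z_j - x) mod π along the real
line. Up to a real factor χ(x) is exp(i φ(x)), so the roots of p are the points where φ is an odd
multiple of π/2, and tan φ(0) = h(0) / p(0) = l. Interlacing makes φ rise through these levels when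
moving away from 0 in either direction. With N of the z_j in the upper half-plane, φ tends to N π at
+∞ and to (n - N) π at -∞. If φ(0) lies between k π and k π + π/2, there are at most N - k crossings
on the right and n - N - k on the left (truncated at 0); p has n real roots, so k = 0
(`configuration_of_interlaces`). Conversely, φ(0) < π/2 forces n crossings by the intermediate value
theorem, hence exactly one per level and side, in the right direction
(`exists_interlaces_of_configuration`). -/

open Polynomial

/-! ### Interlacing pairs of real polynomials -/

/-- A real polynomial all of whose complex roots are real and simple splits into distinct real
linear factors. -/
theorem exists_finset_roots {q : ℝ[X]} (hq : q.Monic)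
    (hc : ∀ x : ℂ, x.im ≠ 0 → aeval x q ≠ 0)
    (hs : ∀ x : ℝ, q.eval x = 0 → (derivative q).eval x ≠ 0) :
    ∃ s : Finset ℝ, s.card = q.natDegree ∧ ∀ x ∈ s, q.eval x = 0 := by
  classical
  set Q : ℂ[X] := q.map (algebraMap ℝ ℂ) with hQ
  have hQ0 : Q ≠ 0 := (hq.map _).ne_zero
  have hroot : ∀ x ∈ Q.roots, (x.re : ℂ) = x ∧ q.eval x.re = 0 := by
    intro x hx
    have h1 : aeval x q = 0 := by
      rw [mem_roots hQ0, IsRoot, hQ, eval_map_algebraMap] at hx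
      exact hx
    have h2 : x.im = 0 := by
      by_contra h
      exact hc x h h1
    have h3 : (x.re : ℂ) = x := Complex.ext (by simp) (by simp [h2])
    refine ⟨h3, ?_⟩
    rw [← h3] at h1
    have : aeval ((algebraMap ℝ ℂ) x.re) q = algebraMap ℝ ℂ (q.eval x.re) := by
      rw [aeval_algebraMap_apply]; simp
    rw [Complex.coe_algebraMap] at this
    rw [this] at h1
    exact_mod_cast h1
  have hnd : Q.roots.Nodup := by
    rw [Multiset.nodup_iff_count_le_one]
    intro x
    by_contra h
    push Not at h
    rw [count_roots, one_lt_rootMultiplicity_iff_isRoot hQ0] at h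
    have hx := hroot x ((mem_roots hQ0).2 h.1)
    apply hs x.re hx.2
    have h4 := h.2
    rw [IsRoot, hQ, derivative_map, eval_map_algebraMap, ← hx.1] at h4
    have : aeval ((algebraMap ℝ ℂ) x.re) (derivative q) =
        algebraMap ℝ ℂ ((derivative q).eval x.re) := by
      rw [aeval_algebraMap_apply]; simp
    rw [Complex.coe_algebraMap] at this
    rw [this] at h4
    exact_mod_cast h4
  refine ⟨Q.roots.toFinset.image Complex.re, ?_, ?_⟩
  · rw [Finset.card_image_of_injOn, Multiset.toFinset_card_of_nodup hnd,
      IsAlgClosed.card_roots_eq_natDegree, hQ, natDegree_map]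
    intro x hx y hy hxy
    have hx' := hroot x (by simpa using hx)
    have hy' := hroot y (by simpa using hy)
    rw [← hx'.1, ← hy'.1, hxy]
  · intro x hx
    obtain ⟨y, hy, rfl⟩ := Finset.mem_image.1 hx
    exact (hroot y (by simpa using hy)).2

/-- `p` is monic of degree `m + 1` with distinct real roots, `c` is monic of degree `m`, and the
residues of `c / p` are positive. -/
structure Interlaces (m : ℕ) (p c : ℝ[X]) : Prop where
  monic_left : p.Monic
  natDegree_left : p.natDegree = m + 1
  monic_right : c.Monic
  natDegree_right : c.natDegree = m
  exists_roots : ∃ s : Finset ℝ, s.card = m + 1 ∧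
    ∀ x ∈ s, p.eval x = 0 ∧ 0 < c.eval x * (derivative p).eval x

theorem eq_nodal_of_roots {q : ℝ[X]} (hq : q.Monic) {s : Finset ℝ} (hs : s.card = q.natDegree)
    (h : ∀ x ∈ s, q.eval x = 0) : q = Lagrange.nodal s id := by
  have hdvd : Lagrange.nodal s id ∣ q := by
    rw [Lagrange.nodal_eq]
    refine Finset.prod_dvd_of_coprime (fun x _ y _ hxy => ?_) fun x hx => ?_
    · exact pairwise_coprime_X_sub_C Function.injective_id hxy
    · exact dvd_iff_isRoot.2 (h x hx)
  exact eq_of_monic_of_dvd_of_natDegree_le Lagrange.nodal_monic hq hdvd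
    (by rw [Lagrange.natDegree_nodal, hs])

/-- Lagrange interpolation of c at the roots of p, which is c / p = ∑ w x / (X - x) cleared of
denominators, with w x = c(x) / p'(x). The two positivity facts below are read off from it. -/
theorem Interlaces.partial_fractions {m : ℕ} {p c : ℝ[X]} (h : Interlaces m p c) :
    ∃ (s : Finset ℝ) (w : ℝ → ℝ), s.Nonempty ∧ (∀ x ∈ s, 0 < w x) ∧ p = Lagrange.nodal s id ∧
      c = ∑ x ∈ s, C (w x) * Lagrange.nodal (s.erase x) id := by
  obtain ⟨s, hs, hr⟩ := h.exists_roots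
  have hp := eq_nodal_of_roots h.monic_left (s := s) (by rw [hs, h.natDegree_left])
    fun x hx => (hr x hx).1
  have hne : s.Nonempty := by
    rw [← Finset.card_pos, hs]; omega
  have hd : ∀ x ∈ s, (derivative p).eval x = (Lagrange.nodal (s.erase x) id).eval x := by
    intro x hx
    have := Lagrange.eval_nodal_derivative_eval_node_eq (v := (id : ℝ → ℝ)) hx
    rw [hp]; simpa using this
  have hw : ∀ x ∈ s, 0 < c.eval x / (derivative p).eval x := by
    intro x hx
    have := (hr x hx).2
    rcases mul_pos_iff.1 this with h | h
    · exact div_pos h.1 h.2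
    · exact div_pos_of_neg_of_neg h.1 h.2
  refine ⟨s, fun x => c.eval x / (derivative p).eval x, hne, hw, hp, ?_⟩
  · have hdeg : c.degree < s.card := by
      rw [degree_eq_natDegree h.monic_right.ne_zero, h.natDegree_right, hs]
      exact_mod_cast Nat.lt_succ_self m
    refine Polynomial.eq_of_degrees_lt_of_eval_finset_eq s hdeg ?_ ?_
    · refine lt_of_le_of_lt (degree_sum_le _ _) ?_
      rw [Finset.sup_lt_iff (by simp)]
      intro x hx
      rw [degree_C_mul (hw x hx).ne', Lagrange.degree_nodal, Finset.card_erase_of_mem hx, hs]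
      exact_mod_cast Nat.lt_succ_self m
    · intro x hx
      rw [eval_finsetSum, Finset.sum_eq_single_of_mem x hx]
      · rw [eval_mul, eval_C, ← hd x hx]
        have := (hr x hx).2
        have h0 : (derivative p).eval x ≠ 0 := by
          intro h; simp [h] at this
        field_simp
      · intro y hy hyx
        rw [eval_mul]
        have := Lagrange.eval_nodal_at_node (v := (id : ℝ → ℝ))
          (Finset.mem_erase.2 ⟨hyx.symm, hx⟩)
        simp only [id] at this
        rw [this, mul_zero]

/-- With N_y = p / (X - y), the Wronskian is ∑ w_y N_y², and at no real point do all the N_y vanish.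
-/
theorem Interlaces.wronskian_pos {m : ℕ} {p c : ℝ[X]} (h : Interlaces m p c) (x : ℝ) :
    0 < (derivative p).eval x * c.eval x - p.eval x * (derivative c).eval x := by
  obtain ⟨s, w, hne, hw, hp, hc⟩ := h.partial_fractions
  have key : (derivative p).eval x * c.eval x - p.eval x * (derivative c).eval x =
      ∑ y ∈ s, w y * ((Lagrange.nodal (s.erase y) id).eval x) ^ 2 := by
    rw [hc, derivative_sum, eval_finsetSum, eval_finsetSum, Finset.mul_sum, Finset.mul_sum,
      ← Finset.sum_sub_distrib]
    refine Finset.sum_congr rfl fun y hy => ?_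
    have : p = (X - C y) * Lagrange.nodal (s.erase y) id := by
      rw [hp]; exact Lagrange.nodal_eq_mul_nodal_erase (v := id) hy
    rw [this]
    simp [derivative_mul]
    ring
  rw [key]
  have hnn : ∀ y ∈ s, 0 ≤ w y * ((Lagrange.nodal (s.erase y) id).eval x) ^ 2 :=
    fun y hy => mul_nonneg (hw y hy).le (sq_nonneg _)
  have hpos : ∃ y ∈ s, (Lagrange.nodal (s.erase y) id).eval x ≠ 0 := by
    by_cases hx : x ∈ s
    · refine ⟨x, hx, ?_⟩
      rw [Lagrange.eval_nodal, Finset.prod_ne_zero_iff]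
      intro y hy
      exact sub_ne_zero.2 (Finset.ne_of_mem_erase hy).symm
    · obtain ⟨y, hy⟩ := hne
      refine ⟨y, hy, ?_⟩
      rw [Lagrange.eval_nodal, Finset.prod_ne_zero_iff]
      intro z hz
      refine sub_ne_zero.2 ?_
      rintro rfl
      exact hx (Finset.mem_of_mem_erase hz)
  obtain ⟨y, hy, h0⟩ := hpos
  exact Finset.sum_pos' hnn ⟨y, hy, mul_pos (hw y hy) (by positivity)⟩

/-- Termwise p · conj c = ∑ (x - y) w_y |N_y(x)|² with y real, so every imaginary part has the sign
of Im x: p / c preserves the half-planes. In particular neither p nor c has a nonreal root. -/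
theorem Interlaces.im_mul_conj_pos {m : ℕ} {p c : ℝ[X]} (h : Interlaces m p c) {x : ℂ}
    (hx : x.im ≠ 0) : 0 < (aeval x p * (starRingEnd ℂ) (aeval x c)).im * x.im := by
  obtain ⟨s, w, hne, hw, hp, hc⟩ := h.partial_fractions
  have key : aeval x p * (starRingEnd ℂ) (aeval x c) =
      ∑ y ∈ s, (x - y) * ((w y * Complex.normSq (aeval x (Lagrange.nodal (s.erase y) id)) : ℝ) : ℂ)
      := by
    rw [hc, map_sum, map_sum, Finset.mul_sum]
    refine Finset.sum_congr rfl fun y hy => ?_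
    have : p = (X - C y) * Lagrange.nodal (s.erase y) id := by
      rw [hp]; exact Lagrange.nodal_eq_mul_nodal_erase (v := id) hy
    rw [this, Complex.ofReal_mul, ← Complex.mul_conj]
    simp
    ring
  rw [key, Complex.im_sum, Finset.sum_mul]
  refine Finset.sum_pos (fun y hy => ?_) hne
  rw [Complex.im_mul_ofReal, Complex.sub_im, Complex.ofReal_im, sub_zero, mul_right_comm]
  refine mul_pos (mul_self_pos.2 hx) (mul_pos (hw y hy) (Complex.normSq_pos.2 ?_))
  rw [Lagrange.nodal_eq, map_prod, Finset.prod_ne_zero_iff]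
  intro z _ h0
  apply hx
  have := congrArg Complex.im h0
  simpa using this

theorem interlaces_zero_iff {p c : ℝ[X]} :
    Interlaces 0 p c ↔ p.Monic ∧ p.natDegree = 1 ∧ c = 1 := by
  constructor
  · intro h
    exact ⟨h.monic_left, h.natDegree_left, h.monic_right.natDegree_eq_zero.1 h.natDegree_right⟩
  · rintro ⟨h1, h2, rfl⟩
    refine ⟨h1, h2, monic_one, natDegree_one, ?_⟩
    obtain ⟨b, rfl⟩ : ∃ b, p = X + C b := ⟨p.coeff 0, by
      conv_lhs => rw [h1.as_sum, h2]
      simp⟩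
    exact ⟨{-b}, by simp, by simp⟩

/-- Inverse Euclidean step. Adding (Im x)² |c|² to s times the half-plane inequality for (c, d)
excludes nonreal roots of the new polynomial p. At a real root, c p' = c² + s (c' d - c d') is
positive by the Wronskian inequality, so the roots are simple and the residues positive. -/
theorem Interlaces.mul_sub {m : ℕ} {c d : ℝ[X]} (h : Interlaces m c d) (b : ℝ) {s : ℝ}
    (hs : 0 < s) : Interlaces (m + 1) ((X - C b) * c - C s * d) c := by
  have hlt : (C s * d).degree < ((X - C b) * c).degree := by
    rw [degree_C_mul hs.ne', degree_mul, degree_X_sub_C, degree_eq_natDegree h.monic_left.ne_zero,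
      degree_eq_natDegree h.monic_right.ne_zero, h.natDegree_left, h.natDegree_right]
    norm_cast; omega
  have hmon : ((X - C b) * c - C s * d).Monic :=
    ((monic_X_sub_C b).mul h.monic_left).sub_of_left hlt
  have hnd : ((X - C b) * c - C s * d).natDegree = m + 1 + 1 := by
    rw [natDegree_sub_eq_left_of_natDegree_lt (by
        rw [natDegree_C_mul hs.ne', (monic_X_sub_C b).natDegree_mul h.monic_left,
          natDegree_X_sub_C, h.natDegree_left, h.natDegree_right]; omega),
      (monic_X_sub_C b).natDegree_mul h.monic_left, natDegree_X_sub_C, h.natDegree_left]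
    omega
  have hsimple : ∀ x : ℝ, ((X - C b) * c - C s * d).eval x = 0 →
      0 < c.eval x * (derivative ((X - C b) * c - C s * d)).eval x := by
    intro x hx
    have h1 := h.wronskian_pos x
    have h2 : c.eval x * (derivative ((X - C b) * c - C s * d)).eval x =
        (c.eval x) ^ 2 + s * ((derivative c).eval x * d.eval x -
          c.eval x * (derivative d).eval x) +
        ((X - C b) * c - C s * d).eval x * (derivative c).eval x := by
      simp [derivative_mul]
      ring
    rw [h2, hx]
    nlinarith [mul_pos hs h1, sq_nonneg (c.eval x)]
  obtain ⟨t, ht, htr⟩ := exists_finset_roots hmon (by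
    intro x hx h0
    have h1 := h.im_mul_conj_pos hx
    have h2 : ((aeval x ((X - C b) * c - C s * d)) * (starRingEnd ℂ) (aeval x c)).im * x.im =
        x.im * x.im * Complex.normSq (aeval x c) +
          s * ((aeval x c * (starRingEnd ℂ) (aeval x d)).im * x.im) := by
      simp [Complex.normSq_apply]
      ring
    rw [h0] at h2
    have h3 : 0 ≤ x.im * x.im * Complex.normSq (aeval x c) :=
      mul_nonneg (mul_self_nonneg _) (Complex.normSq_nonneg _)
    have := mul_pos hs h1
    simp only [zero_mul, Complex.zero_im] at h2
    linarith) (by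
    intro x hx h0
    have := hsimple x hx
    rw [h0, mul_zero] at this
    exact lt_irrefl _ this)
  exact ⟨hmon, hnd, h.monic_left, h.natDegree_left, t, by rw [ht, hnd],
    fun x hx => ⟨htr x hx, hsimple x (htr x hx)⟩⟩

/-- The remainder of the Euclidean algorithm for an interlacing pair. -/
theorem Interlaces.euclid {m : ℕ} {p c : ℝ[X]} (h : Interlaces (m + 1) p c) :
    ∃ (b s : ℝ) (d : ℝ[X]), 0 < s ∧ p = (X - C b) * c - C s * d ∧ Interlaces m c d := by
  -- The value of b that cancels the coefficient of X^(m+1) in (X - b) c - p.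
  set b : ℝ := c.coeff m - p.coeff (m + 1) with hb
  set r : ℝ[X] := (X - C b) * c - p with hr
  have hcm : c.coeff (m + 1) = 1 := by
    have := h.monic_right.coeff_natDegree
    rwa [h.natDegree_right] at this
  have hpm : p.coeff (m + 2) = 1 := by
    have := h.monic_left.coeff_natDegree
    rwa [h.natDegree_left] at this
  have hrdeg : r.degree < (m + 1 : ℕ) := by
    rw [degree_lt_iff_coeff_zero]
    intro k hk
    obtain ⟨j, rfl⟩ : ∃ j, k = j + 1 := ⟨k - 1, by omega⟩
    rw [hr, coeff_sub, sub_mul, coeff_sub, coeff_X_mul, coeff_C_mul]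
    rcases Nat.lt_or_ge j (m + 1) with hj | hj
    · obtain rfl : j = m := by omega
      rw [hcm, hb]; ring
    · rcases Nat.lt_or_ge j (m + 2) with hj' | hj'
      · obtain rfl : j = m + 1 := by omega
        rw [hcm, hpm, coeff_eq_zero_of_natDegree_lt (p := c)
          (by rw [h.natDegree_right]; omega)]; ring
      · rw [coeff_eq_zero_of_natDegree_lt (p := c) (by rw [h.natDegree_right]; omega),
          coeff_eq_zero_of_natDegree_lt (p := c) (by rw [h.natDegree_right]; omega),
          coeff_eq_zero_of_natDegree_lt (p := p) (by rw [h.natDegree_left]; omega)]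
        ring
  -- At a root of c the remainder equals -p, and the Wronskian reduces to -p c'.
  have hsgn : ∀ x : ℝ, c.eval x = 0 → 0 < r.eval x * (derivative c).eval x := by
    intro x hx
    have := h.wronskian_pos x
    rw [hx] at this
    rw [hr, eval_sub, eval_mul, hx]
    linarith
  obtain ⟨t, ht, htr⟩ := exists_finset_roots h.monic_right (by
    intro x hx h0
    have := h.im_mul_conj_pos hx
    rw [h0] at this
    simp at this) (by
    intro x hx h0
    have := hsgn x hx
    rw [h0, mul_zero] at this
    exact lt_irrefl _ this)
  rw [h.natDegree_right] at ht
  have hcn := eq_nodal_of_roots h.monic_right (by rw [ht, h.natDegree_right]) htr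
  -- The leading coefficient of the remainder is the sum of the residues of r / c at the roots of c,
  -- all positive; so the degree drops by exactly one and s > 0.
  have hcoeff : r.coeff m = ∑ x ∈ t, r.eval x / (derivative c).eval x := by
    have := Lagrange.coeff_eq_sum (s := t) (v := (id : ℝ → ℝ)) (P := r)
      Function.injective_id.injOn (by rw [ht]; exact hrdeg)
    rw [ht] at this
    rw [show m = m + 1 - 1 by omega, this]
    refine Finset.sum_congr rfl fun x hx => ?_
    have h1 := Lagrange.eval_nodal_derivative_eval_node_eq (v := (id : ℝ → ℝ)) hx
    rw [hcn]
    simp only [id] at h1 ⊢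
    rw [h1, Lagrange.eval_nodal]
    rfl
  have hs : 0 < r.coeff m := by
    rw [hcoeff]
    refine Finset.sum_pos (fun x hx => ?_) (Finset.card_pos.1 (by omega))
    have := hsgn x (htr x hx)
    rcases mul_pos_iff.1 this with h | h
    · exact div_pos h.1 h.2
    · exact div_pos_of_neg_of_neg h.1 h.2
  have hrnd : r.natDegree = m := by
    refine natDegree_eq_of_le_of_coeff_ne_zero ?_ hs.ne'
    by_cases hr0 : r = 0
    · simp [hr0]
    · have := (natDegree_lt_iff_degree_lt hr0).2 hrdeg
      omega
  refine ⟨b, r.coeff m, C (r.coeff m)⁻¹ * r, hs, ?_, ?_⟩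
  · rw [← mul_assoc, ← C_mul, mul_inv_cancel₀ hs.ne', C_1, one_mul, hr]
    ring
  · refine ⟨h.monic_right, h.natDegree_right, ?_, ?_, t, ht, fun x hx => ⟨htr x hx, ?_⟩⟩
    · rw [Monic, leadingCoeff, natDegree_C_mul (inv_ne_zero hs.ne'), hrnd, coeff_C_mul,
        inv_mul_cancel₀ hs.ne']
    · rw [natDegree_C_mul (inv_ne_zero hs.ne'), hrnd]
    · rw [eval_mul, eval_C, mul_assoc]
      exact mul_pos (inv_pos.2 hs) (hsgn x (htr x hx))

/-! ### Characteristic polynomials of Jacobi matrices -/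

/-- The characteristic polynomials of a Jacobi matrix and of the matrix obtained by deleting its
first row and column. -/
def jacobiPolys : (m : ℕ) → (Fin m → ℝ) → (Fin (m + 1) → ℝ) → ℝ[X] × ℝ[X]
  | 0, _, b => (X - C (b 0), 1)
  | m + 1, a, b =>
    ((X - C (b 0)) * (jacobiPolys m (Fin.tail a) (Fin.tail b)).1 -
      C (a 0 ^ 2) * (jacobiPolys m (Fin.tail a) (Fin.tail b)).2,
      (jacobiPolys m (Fin.tail a) (Fin.tail b)).1)

/-- Laplace expansion along the first row, then along the first column; only the first row and
column need to be sparse. -/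
theorem det_eq_of_tridiagonal_corner {R : Type*} [CommRing R] {m : ℕ}
    (M : Matrix (Fin (m + 2)) (Fin (m + 2)) R) (h0 : ∀ j : Fin m, M 0 j.succ.succ = 0)
    (h1 : ∀ j : Fin m, M j.succ.succ 0 = 0) :
    M.det = M 0 0 * (M.submatrix Fin.succ Fin.succ).det -
      M 0 1 * M 1 0 * ((M.submatrix Fin.succ Fin.succ).submatrix Fin.succ Fin.succ).det := by
  rw [Matrix.det_succ_row_zero, Fin.sum_univ_succ, Fin.sum_univ_succ]
  rw [Finset.sum_eq_zero (fun j _ => by rw [h0]; ring)]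
  have h2 : (M.submatrix Fin.succ (Fin.succAbove (Fin.succ 0))).det =
      M 1 0 * ((M.submatrix Fin.succ Fin.succ).submatrix Fin.succ Fin.succ).det := by
    rw [Matrix.det_succ_column_zero, Fin.sum_univ_succ,
      Finset.sum_eq_zero (fun j _ => by
        rw [Matrix.submatrix_apply]
        have : (Fin.succ (0 : Fin (m + 1))).succAbove 0 = 0 := by simp
        rw [this, h1]; ring)]
    have : (Fin.succ (0 : Fin (m + 1))).succAbove 0 = 0 := by simp
    have h3 : ((M.submatrix Fin.succ (Fin.succAbove (Fin.succ 0))).submatrix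
        (Fin.succAbove 0) Fin.succ) = (M.submatrix Fin.succ Fin.succ).submatrix Fin.succ Fin.succ := by
      ext i j
      simp only [Matrix.submatrix_apply, Fin.succAbove_zero]
      congr 1
    rw [Matrix.submatrix_apply, this, h3]
    simp
  rw [h2]
  simp [Fin.succAbove_zero]
  ring

theorem jacobiMatrix_succ_succ {m : ℕ} (a : Fin (m + 1) → ℝ) (b : Fin (m + 2) → ℝ)
    (i j : Fin (m + 1)) :
    jacobiMatrix (n := m + 2) a b i.succ j.succ =
      jacobiMatrix (n := m + 1) (Fin.tail a) (Fin.tail b) i j := by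
  simp only [jacobiMatrix, Matrix.of_apply, Fin.succ_inj, Fin.val_succ, Fin.tail]
  congr 1
  by_cases h1 : i.1 + 1 = j.1
  · rw [dif_pos h1, dif_pos (by omega)]
    rfl
  · rw [dif_neg h1, dif_neg (by omega)]
    by_cases h2 : j.1 + 1 = i.1
    · rw [dif_pos h2, dif_pos (by omega)]
      rfl
    · rw [dif_neg h2, dif_neg (by omega)]

theorem charpoly_jacobiMatrix (m : ℕ) (a : Fin m → ℝ) (b : Fin (m + 1) → ℝ) :
    (jacobiMatrix (n := m + 1) a b).charpoly = (jacobiPolys m a b).1 ∧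
      ((jacobiMatrix (n := m + 1) a b).submatrix Fin.succ Fin.succ).charpoly =
        (jacobiPolys m a b).2 := by
  induction m with
  | zero =>
    refine ⟨?_, by simp [jacobiPolys, Matrix.charpoly]⟩
    simp [jacobiPolys, Matrix.charpoly, jacobiMatrix]
  | succ m ih =>
    have hsub : (jacobiMatrix (n := m + 2) a b).submatrix Fin.succ Fin.succ =
        jacobiMatrix (n := m + 1) (Fin.tail a) (Fin.tail b) := by
      ext i j
      exact jacobiMatrix_succ_succ a b i j
    have hcs : ∀ {k : ℕ} (N : Matrix (Fin (k + 1)) (Fin (k + 1)) ℝ),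
        N.charmatrix.submatrix Fin.succ Fin.succ = (N.submatrix Fin.succ Fin.succ).charmatrix := by
      intro k N
      ext i j : 2
      simp [Matrix.charmatrix_apply, Matrix.diagonal_apply]
    have h2 := ih (Fin.tail a) (Fin.tail b)
    refine ⟨?_, by rw [hsub, h2.1]; rfl⟩
    rw [Matrix.charpoly, det_eq_of_tridiagonal_corner, hcs, hcs, hsub]
    · change _ * Matrix.charpoly _ - _ * Matrix.charpoly _ = _
      rw [h2.1, h2.2]
      simp [jacobiPolys, jacobiMatrix]
      ring_nf
      left
      trivial
    · intro j
      simp [jacobiMatrix, Fin.ext_iff]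
    · intro j
      simp [jacobiMatrix, Fin.ext_iff]

/-- The first row of X - (perturbed J) is (1 + i l) times that of X - J, minus i l X e₁; the other
rows agree. Linearity of the determinant in the first row splits off the minor. -/
theorem charpoly_multPerturbation {m : ℕ} [NeZero (m + 1)]
    (J : Matrix (Fin (m + 1)) (Fin (m + 1)) ℝ) (l : ℝ) :
    (multPerturbation J l).charpoly =
      C (1 + Complex.I * (l : ℂ)) * J.charpoly.map (algebraMap ℝ ℂ) -
        C (Complex.I * (l : ℂ)) * X *
          (J.submatrix Fin.succ Fin.succ).charpoly.map (algebraMap ℝ ℂ) := by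
  set A : Matrix (Fin (m + 1)) (Fin (m + 1)) ℂ := J.map (algebraMap ℝ ℂ) with hA
  have hent : ∀ i j, multPerturbation J l i j =
      (if i = 0 then 1 + Complex.I * (l : ℂ) else 1) * A i j := by
    intro i j
    rw [multPerturbation, Matrix.add_mul, Matrix.one_mul, Matrix.smul_mul, Matrix.add_apply,
      Matrix.smul_apply, smul_eq_mul]
    by_cases hi : i = 0
    · subst hi
      rw [if_pos rfl, Matrix.single_mul_apply_same]
      simp [hA]
      ring
    · rw [if_neg hi, Matrix.single_mul_apply_of_ne _ _ _ _ _ hi]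
      simp [hA]
  have hsucc : ∀ (f : Fin m → Fin (m + 1)),
      ((multPerturbation J l).charmatrix.submatrix Fin.succ f) =
        A.charmatrix.submatrix Fin.succ f := by
    intro f
    ext i j : 2
    rw [Matrix.submatrix_apply, Matrix.submatrix_apply, Matrix.charmatrix_apply,
      Matrix.charmatrix_apply, hent, if_neg (Fin.succ_ne_zero i), one_mul]
  have hzero : ∀ j, (multPerturbation J l).charmatrix 0 j =
      C (1 + Complex.I * (l : ℂ)) * A.charmatrix 0 j -
        C (Complex.I * (l : ℂ)) * X * (if j = 0 then 1 else 0) := by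
    intro j
    rw [Matrix.charmatrix_apply, Matrix.charmatrix_apply, hent, if_pos rfl, Matrix.diagonal_apply]
    by_cases hj : j = 0
    · subst hj
      simp
      ring
    · rw [if_neg (Ne.symm hj), if_neg hj]
      simp
  have hcs : A.charmatrix.submatrix Fin.succ Fin.succ =
      (A.submatrix Fin.succ Fin.succ).charmatrix := by
    ext i j : 2
    simp [Matrix.charmatrix_apply, Matrix.diagonal_apply]
  have h1 : J.charpoly.map (algebraMap ℝ ℂ) = A.charpoly := (Matrix.charpoly_map J _).symm
  have h2 : (J.submatrix Fin.succ Fin.succ).charpoly.map (algebraMap ℝ ℂ) =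
      (A.submatrix Fin.succ Fin.succ).charpoly := by
    rw [← Matrix.charpoly_map, hA, Matrix.submatrix_map]
  rw [h1, h2, Matrix.charpoly, Matrix.charpoly, Matrix.charpoly, Matrix.det_succ_row_zero,
    Matrix.det_succ_row_zero A.charmatrix, Finset.mul_sum, ← hcs]
  simp_rw [hsucc, hzero]
  rw [← sub_eq_zero, sub_sub_eq_add_sub, add_comm, ← add_sub, ← Finset.sum_sub_distrib,
    Finset.sum_eq_single (0 : Fin (m + 1))]
  · simp [Fin.succAbove_zero]
    ring
  · intro j _ hj
    rw [if_neg hj]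
    ring
  · simp

theorem interlaces_jacobiPolys (m : ℕ) (a : Fin m → ℝ) (b : Fin (m + 1) → ℝ)
    (ha : ∀ j, 0 < a j) : Interlaces m (jacobiPolys m a b).1 (jacobiPolys m a b).2 := by
  induction m with
  | zero =>
    rw [interlaces_zero_iff]
    exact ⟨monic_X_sub_C _, natDegree_X_sub_C _, rfl⟩
  | succ m ih =>
    exact (ih (Fin.tail a) (Fin.tail b) fun j => ha _).mul_sub (b 0) (pow_pos (ha 0) 2)

/-- The Euclidean algorithm run to the end: each step yields one diagonal entry b and one
off-diagonal entry √s. -/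
theorem Interlaces.exists_jacobiPolys {m : ℕ} {p c : ℝ[X]} (h : Interlaces m p c) :
    ∃ (a : Fin m → ℝ) (b : Fin (m + 1) → ℝ), (∀ j, 0 < a j) ∧ jacobiPolys m a b = (p, c) := by
  induction m generalizing p c with
  | zero =>
    obtain ⟨h1, h2, rfl⟩ := interlaces_zero_iff.1 h
    refine ⟨Fin.elim0, fun _ => -p.coeff 0, fun j => j.elim0, ?_⟩
    have : p = X + C (p.coeff 0) := by
      conv_lhs => rw [h1.as_sum, h2]
      simp
    rw [jacobiPolys, Prod.mk.injEq]
    refine ⟨?_, rfl⟩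
    conv_rhs => rw [this]
    simp
  | succ m ih =>
    obtain ⟨b, s, d, hs, hp, hcd⟩ := h.euclid
    obtain ⟨a', b', ha', hab⟩ := ih hcd
    refine ⟨Fin.cons (Real.sqrt s) a', Fin.cons b b', ?_, ?_⟩
    · intro j
      refine Fin.cases ?_ (fun i => ?_) j
      · simpa using hs
      · simpa using ha' i
    · rw [jacobiPolys]
      simp only [Fin.tail_cons, Fin.cons_zero, hab, Real.sq_sqrt hs.le]
      rw [hp]

/-! ### Second coefficients -/

/-- The square sum of the roots of a monic polynomial of degree `n`, in terms of its
coefficients. -/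
def rootSquareSum {R : Type*} [CommRing R] (n : ℕ) (p : R[X]) : R :=
  -- The factor X² moves the coefficients of index n - 1 and n - 2 to n + 1 and n, so that n = 1
  -- needs no truncated subtraction.
  (X ^ 2 * p).coeff (n + 1) ^ 2 - 2 * (X ^ 2 * p).coeff n

theorem coeff_top_of_monic {R : Type*} [CommRing R] {p : R[X]} {n : ℕ} (hp : p.Monic)
    (hn : p.natDegree = n) : (X ^ 2 * p).coeff (n + 2) = 1 := by
  rw [coeff_X_pow_mul, ← hn]
  exact hp

/-- Both sides are tr J². This makes the Gaussian exponent a function of p alone. -/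
theorem rootSquareSum_jacobiPolys (m : ℕ) (a : Fin m → ℝ) (b : Fin (m + 1) → ℝ)
    (ha : ∀ j, 0 < a j) : rootSquareSum (m + 1) (jacobiPolys m a b).1 =
      2 * ∑ j, a j ^ 2 + ∑ j, b j ^ 2 := by
  induction m with
  | zero =>
    have h1 : (X ^ 2 * (X - C (b 0))).coeff 2 = -b 0 := by
      rw [show (2 : ℕ) = 0 + 2 by rfl, coeff_X_pow_mul]; simp
    have h2 : (X ^ 2 * (X - C (b 0))).coeff 1 = 0 := by
      rw [coeff_X_pow_mul']; simp
    simp [rootSquareSum, jacobiPolys, h1, h2]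
  | succ m ih =>
    have hi := interlaces_jacobiPolys m (Fin.tail a) (Fin.tail b) fun j => ha _
    have h1 := ih (Fin.tail a) (Fin.tail b) fun j => ha _
    set c := (jacobiPolys m (Fin.tail a) (Fin.tail b)).1
    set d := (jacobiPolys m (Fin.tail a) (Fin.tail b)).2
    have hc := coeff_top_of_monic hi.monic_left hi.natDegree_left
    have hd := coeff_top_of_monic hi.monic_right hi.natDegree_right
    have hd' : (X ^ 2 * d).coeff (m + 3) = 0 := by
      rw [coeff_X_pow_mul, coeff_eq_zero_of_natDegree_lt]
      rw [hi.natDegree_right]; omega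
    have hp : X ^ 2 * (jacobiPolys (m + 1) a b).1 =
        X * (X ^ 2 * c) - C (b 0) * (X ^ 2 * c) - C (a 0 ^ 2) * (X ^ 2 * d) := by
      rw [jacobiPolys]
      ring
    have e1 : (X ^ 2 * (jacobiPolys (m + 1) a b).1).coeff (m + 3) =
        (X ^ 2 * c).coeff (m + 2) - b 0 := by
      rw [hp, coeff_sub, coeff_sub, coeff_X_mul, coeff_C_mul, coeff_C_mul, hd', hc]
      ring
    have e2 : (X ^ 2 * (jacobiPolys (m + 1) a b).1).coeff (m + 2) =
        (X ^ 2 * c).coeff (m + 1) - b 0 * (X ^ 2 * c).coeff (m + 2) - a 0 ^ 2 := by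
      rw [hp, coeff_sub, coeff_sub, coeff_X_mul, coeff_C_mul, coeff_C_mul, hd]
      ring
    have h2 : rootSquareSum (m + 1 + 1) (jacobiPolys (m + 1) a b).1 =
        rootSquareSum (m + 1) c + b 0 ^ 2 + 2 * a 0 ^ 2 := by
      rw [rootSquareSum, rootSquareSum, e1, e2]
      ring
    rw [h2, h1, Fin.sum_univ_succ (fun j => a j ^ 2), Fin.sum_univ_succ (fun j => b j ^ 2)]
    simp only [Fin.tail]
    ring

/-- Newton's identity e₁² - 2 e₂ = ∑ z_j², by induction on the number of factors. -/
theorem coeff_prod_X_sub_C {R ι : Type*} [CommRing R] [Nontrivial R] [DecidableEq ι]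
    (s : Finset ι) (z : ι → R) :
    (X ^ 2 * ∏ j ∈ s, (X - C (z j))).coeff (s.card + 1) = -∑ j ∈ s, z j ∧
      rootSquareSum s.card (∏ j ∈ s, (X - C (z j))) = ∑ j ∈ s, z j ^ 2 := by
  induction s using Finset.induction_on with
  | empty => simp [rootSquareSum, coeff_X_pow]
  | insert i s hi ih =>
    set f := ∏ j ∈ s, (X - C (z j))
    have hf := coeff_top_of_monic (p := f) (n := s.card) (monic_prod_X_sub_C _ _)
      (natDegree_finsetProd_X_sub_C_eq_card s z)
    have hp : X ^ 2 * ∏ j ∈ insert i s, (X - C (z j)) =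
        X * (X ^ 2 * f) - C (z i) * (X ^ 2 * f) := by
      rw [Finset.prod_insert hi]; ring
    rw [rootSquareSum] at ih
    rw [rootSquareSum, Finset.card_insert_of_notMem hi, hp, Finset.sum_insert hi,
      Finset.sum_insert hi]
    simp only [coeff_sub, coeff_X_mul, coeff_C_mul, hf]
    refine ⟨by rw [ih.1]; ring, ?_⟩
    rw [← ih.2]
    ring

/-! ### The phase of a complex polynomial along the real line -/

/-- The arccotangent of Re z / Im z: one smooth formula for both half-planes. -/
theorem argModPi_eq {z : ℂ} (hz : z.im ≠ 0) :
    argModPi z = Real.pi / 2 - Real.arctan (z.re / z.im) := by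
  have htan : Real.tan (Real.pi / 2 - z.arg) = z.re / z.im := by
    rw [Real.tan_pi_div_two_sub, Complex.tan_arg, inv_div]
  rcases lt_or_gt_of_ne hz with h | h
  · have h1 : z.arg < 0 := Complex.arg_neg_iff.2 h
    have h2 := Complex.neg_pi_lt_arg z
    have := Real.arctan_eq_of_tan_eq (x := Real.pi / 2 - z.arg - Real.pi) (y := z.re / z.im)
      (by rw [Real.tan_sub_pi, htan]) ⟨by linarith, by linarith⟩
    rw [this, argModPi, if_neg (not_lt.2 h.le), if_neg h.ne]
    ring
  · have h1 : 0 < z.arg := by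
      rcases (Complex.arg_nonneg_iff.2 h.le).lt_or_eq with h1 | h1
      · exact h1
      · exact absurd (Complex.arg_eq_zero_iff.1 h1.symm).2 hz
    have h2 : z.arg < Real.pi := Complex.arg_lt_pi_iff.2 (Or.inr hz)
    have := Real.arctan_eq_of_tan_eq (x := Real.pi / 2 - z.arg) htan ⟨by linarith, by linarith⟩
    rw [this, argModPi, if_pos h]
    ring

theorem exists_eq_mul_exp_argModPi {z : ℂ} (hz : z.im ≠ 0) :
    ∃ r : ℝ, r ≠ 0 ∧ z = r * Complex.exp (argModPi z * Complex.I) := by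
  have h0 : ‖z‖ ≠ 0 := by
    rw [norm_ne_zero_iff]
    rintro rfl
    simp at hz
  rcases lt_or_gt_of_ne hz with h | h
  -- In the lower half-plane the argument is shifted by π, and the negative modulus compensates.
  · refine ⟨-‖z‖, neg_ne_zero.2 h0, ?_⟩
    rw [argModPi, if_neg (not_lt.2 h.le), if_neg h.ne, Complex.ofReal_add, add_mul, Complex.exp_add,
      Complex.exp_pi_mul_I]
    conv_lhs => rw [← Complex.norm_mul_exp_arg_mul_I z]
    push_cast
    ring
  · refine ⟨‖z‖, h0, ?_⟩
    rw [argModPi, if_pos h, Complex.norm_mul_exp_arg_mul_I]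

theorem exists_prod_eq_mul_exp_argSum {n : ℕ} {z : Fin n → ℂ} (hz : ∀ j, (z j).im ≠ 0) :
    ∃ r : ℝ, r ≠ 0 ∧ ∏ j, z j = r * Complex.exp (argSum z * Complex.I) := by
  choose r hr hrz using fun j => exists_eq_mul_exp_argModPi (hz j)
  refine ⟨∏ j, r j, Finset.prod_ne_zero_iff.2 fun j _ => hr j, ?_⟩
  rw [argSum, Complex.ofReal_sum, Finset.sum_mul, Complex.exp_sum, Complex.ofReal_prod,
    ← Finset.prod_mul_distrib]
  exact Finset.prod_congr rfl fun j _ => hrz j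

theorem argModPi_pos {z : ℂ} (hz : z.im ≠ 0) : 0 < argModPi z := by
  rw [argModPi_eq hz]
  linarith [Real.arctan_lt_pi_div_two (z.re / z.im)]

/-- The sum of the arguments modulo `π` of the points `z j`, seen from the real point `x`. -/
def phase {n : ℕ} (z : Fin n → ℂ) (x : ℝ) : ℝ := argSum fun j => z j - x

/-- The derivative of `phase`. -/
def phaseDeriv {n : ℕ} (z : Fin n → ℂ) (x : ℝ) : ℝ := ∑ j, (z j).im / ‖z j - x‖ ^ 2

/-- The number of points in the upper half-plane. -/
def upperCard {n : ℕ} (z : Fin n → ℂ) : ℕ := (Finset.univ.filter fun j => 0 < (z j).im).card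

theorem phase_zero {n : ℕ} (z : Fin n → ℂ) : phase z 0 = argSum z := by
  simp [phase]

theorem phase_eq {n : ℕ} {z : Fin n → ℂ} (hz : ∀ j, (z j).im ≠ 0) (x : ℝ) :
    phase z x = ∑ j, (Real.pi / 2 - Real.arctan (((z j).re - x) / (z j).im)) := by
  rw [phase, argSum]
  refine Finset.sum_congr rfl fun j _ => ?_
  rw [argModPi_eq (by simpa using hz j)]
  simp

theorem argModPi_neg {z : ℂ} (hz : z.im ≠ 0) : argModPi (-z) = argModPi z := by
  rw [argModPi_eq hz, argModPi_eq (by simpa using hz)]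
  simp

/-- This reflection reduces the negative half-line to the positive one, with -z in place of z. -/
theorem phase_neg {n : ℕ} {z : Fin n → ℂ} (hz : ∀ j, (z j).im ≠ 0) (x : ℝ) :
    phase (-z) x = phase z (-x) := by
  rw [phase, phase, argSum, argSum]
  refine Finset.sum_congr rfl fun j _ => ?_
  rw [← argModPi_neg (by simpa using hz j)]
  congr 1
  simp [add_comm]

theorem phaseDeriv_neg {n : ℕ} (z : Fin n → ℂ) (x : ℝ) :
    phaseDeriv (-z) x = -phaseDeriv z (-x) := by
  rw [phaseDeriv, phaseDeriv, ← Finset.sum_neg_distrib]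
  refine Finset.sum_congr rfl fun j _ => ?_
  rw [← norm_neg (z j - _)]
  simp [neg_div, ← sub_eq_add_neg, neg_sub_comm]

theorem upperCard_add_upperCard_neg {n : ℕ} {z : Fin n → ℂ} (hz : ∀ j, (z j).im ≠ 0) :
    upperCard z + upperCard (-z) = n := by
  have h := Finset.card_filter_add_card_filter_not (s := (Finset.univ : Finset (Fin n)))
    (fun j => 0 < (z j).im)
  rw [Finset.card_univ, Fintype.card_fin] at h
  refine Eq.trans ?_ h
  rw [upperCard, upperCard]
  congr 2
  ext j
  have := hz j
  simp only [Pi.neg_apply, Complex.neg_im, Left.neg_pos_iff, Finset.mem_filter, Finset.mem_univ,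
    true_and, not_lt]
  exact ⟨fun h => h.le, fun h => lt_of_le_of_ne h this⟩

theorem hasDerivAt_phase {n : ℕ} {z : Fin n → ℂ} (hz : ∀ j, (z j).im ≠ 0) (x : ℝ) :
    HasDerivAt (phase z) (phaseDeriv z x) x := by
  have : phase z = fun x => ∑ j, (Real.pi / 2 - Real.arctan (((z j).re - x) / (z j).im)) :=
    funext (phase_eq hz)
  rw [this, phaseDeriv]
  refine HasDerivAt.fun_sum fun j _ => ?_
  have h1 : HasDerivAt (fun x : ℝ => ((z j).re - x) / (z j).im) (-1 / (z j).im) x :=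
    ((hasDerivAt_id x).const_sub _).div_const _
  have h2 := (h1.arctan).const_sub (Real.pi / 2)
  convert h2 using 1
  have h3 : ‖z j - x‖ ^ 2 = ((z j).re - x) ^ 2 + (z j).im ^ 2 := by
    rw [← Complex.normSq_eq_norm_sq, Complex.normSq_apply]
    simp
    ring
  have hj := hz j
  have h4 : 0 < ((z j).re - x) ^ 2 + (z j).im ^ 2 := by positivity
  have h5 : 1 + (((z j).re - x) / (z j).im) ^ 2 =
      (((z j).re - x) ^ 2 + (z j).im ^ 2) / (z j).im ^ 2 := by
    field_simp
    ring
  rw [h3, h5]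
  field_simp

theorem continuous_phase {n : ℕ} {z : Fin n → ℂ} (hz : ∀ j, (z j).im ≠ 0) :
    Continuous (phase z) :=
  continuous_iff_continuousAt.2 fun x => (hasDerivAt_phase hz x).continuousAt

/-- A point in the upper half-plane seen from far to the right has argument close to π; one in the
lower half-plane has argument modulo π close to 0. -/
theorem tendsto_phase_atTop {n : ℕ} {z : Fin n → ℂ} (hz : ∀ j, (z j).im ≠ 0) :
    Filter.Tendsto (phase z) Filter.atTop (nhds (upperCard z * Real.pi)) := by
  have h0 : phase z = fun x => ∑ j, (Real.pi / 2 - Real.arctan (((z j).re - x) / (z j).im)) :=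
    funext (phase_eq hz)
  have h1 : (upperCard z : ℝ) * Real.pi =
      ∑ j, (Real.pi / 2 - if 0 < (z j).im then -(Real.pi / 2) else Real.pi / 2) := by
    rw [upperCard, Finset.card_filter, Nat.cast_sum, Finset.sum_mul]
    refine Finset.sum_congr rfl fun j _ => ?_
    split_ifs <;> simp
  rw [h0, h1]
  refine tendsto_finsetSum _ fun j _ => Filter.Tendsto.const_sub _ ?_
  have h2 : Filter.Tendsto (fun x : ℝ => (z j).re - x) Filter.atTop Filter.atBot :=
    Filter.tendsto_atBot_add_const_left _ _ Filter.tendsto_neg_atTop_atBot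
  split_ifs with h
  · refine (Real.tendsto_arctan_atBot.mono_right nhdsWithin_le_nhds).comp ?_
    exact h2.atBot_div_const h
  · have h' : (z j).im < 0 := lt_of_le_of_ne (not_lt.1 h) (hz j)
    refine (Real.tendsto_arctan_atTop.mono_right nhdsWithin_le_nhds).comp ?_
    simp only [div_eq_mul_inv]
    exact h2.atBot_mul_const_of_neg (inv_lt_zero.2 h')

/-! ### Crossings of the levels π/2 + iπ by the phase. -/

theorem exists_lt_of_hasDerivAt_pos {f : ℝ → ℝ} {f' x a : ℝ} (h : HasDerivAt f f' x) (hf : 0 < f')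
    (ha : a < x) : ∃ y, a < y ∧ y < x ∧ f y < f x := by
  have h1 := (hasDerivAt_iff_tendsto_slope.1 h).eventually (lt_mem_nhds hf)
  have h2 : ∀ᶠ y in nhdsWithin x (Set.Iio x), 0 < slope f x y :=
    h1.filter_mono (nhdsWithin_mono _ fun y hy => ne_of_lt hy)
  obtain ⟨y, hy, hys⟩ := (h2.and (Ioo_mem_nhdsLT ha)).exists
  refine ⟨y, hys.1, hys.2, ?_⟩
  rw [slope_def_field] at hy
  have h3 : y - x < 0 := sub_neg.2 hys.2
  by_contra h4
  have := div_nonpos_of_nonneg_of_nonpos (sub_nonneg.2 (not_lt.1 h4)) h3.le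
  linarith

/-- A function that can meet the level v only with positive slope cannot come back down to it. -/
theorem lt_of_upcrossing {f f' : ℝ → ℝ} (hf : ∀ x, HasDerivAt f (f' x) x) {a v : ℝ} (ha : v ≤ f a)
    (h : ∀ x, a ≤ x → f x = v → 0 < f' x) {x : ℝ} (hx : a < x) : v < f x := by
  have hle : ∀ y, a ≤ y → v ≤ f y := by
    intro y hy
    exact image_le_of_deriv_right_lt_deriv_boundary' (f := fun _ => v) (f' := fun _ => 0)
      (B := f) (B' := f') continuousOn_const (fun _ _ => hasDerivWithinAt_const _ _ _) ha
      (fun t _ => (hf t).continuousAt.continuousWithinAt)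
      (fun t _ => (hf t).hasDerivWithinAt) (fun t ht htv => h t ht.1 htv.symm)
      (Set.right_mem_Icc.2 hy)
  refine lt_of_le_of_ne (hle x hx.le) fun hv => ?_
  obtain ⟨y, h1, h2, h3⟩ := exists_lt_of_hasDerivAt_pos (hf x) (h x hx.le hv.symm) hx
  linarith [hle y h1.le]

/-- Every level (2 i + 1) π/2 is met at most once. Levels with i < k lie below the starting value
and are never met. A level with i at least `upperCard z` exceeds the limit at +∞, but once met it
would bound the phase below forever. So only the levels with k ≤ i < `upperCard z` remain. -/
theorem card_le_of_upcrossing {n : ℕ} {z : Fin n → ℂ} (hz : ∀ j, (z j).im ≠ 0) {k : ℤ}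
    (hk : k * Real.pi - Real.pi / 2 < argSum z)
    (hup : ∀ x, 0 < x → Real.cos (phase z x) = 0 → 0 < phaseDeriv z x)
    {s : Finset ℝ} (hs : ∀ x ∈ s, 0 < x ∧ Real.cos (phase z x) = 0) :
    s.card ≤ ((upperCard z : ℤ) - k).toNat := by
  have hpi := Real.pi_pos
  have hlev : ∀ x ∈ s, ∃ i : ℤ, phase z x = (2 * i + 1) * Real.pi / 2 :=
    fun x hx => Real.cos_eq_zero_iff.1 (hs x hx).2
  have hcos : ∀ (i : ℤ) x, phase z x = (2 * i + 1) * Real.pi / 2 → Real.cos (phase z x) = 0 :=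
    fun i x h => Real.cos_eq_zero_iff.2 ⟨i, h⟩
  choose! i hi using hlev
  rw [← Int.card_Ico]
  refine Finset.card_le_card_of_injOn i ?_ ?_
  · intro x hx
    have hx' : x ∈ s := hx
    rw [Finset.coe_Ico, Set.mem_Ico]
    constructor
    · by_contra hlt
      have h1 : (i x : ℝ) + 1 ≤ k := by exact_mod_cast (not_le.1 hlt)
      have h2 : (2 * i x + 1) * Real.pi / 2 < phase z 0 := by
        rw [phase_zero]
        nlinarith
      have := lt_of_upcrossing (hasDerivAt_phase hz) h2.le (fun y hy hyv =>
        hup y (lt_of_le_of_ne hy (by rintro rfl; exact h2.ne' hyv)) (hcos _ y hyv)) (hs x hx').1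
      exact this.ne' (hi x hx')
    · by_contra hge
      have h1 : (upperCard z : ℝ) ≤ i x := by exact_mod_cast (not_lt.1 hge)
      have h2 : ∀ y, x ≤ y → (2 * i x + 1) * Real.pi / 2 ≤ phase z y := by
        intro y hy
        rcases hy.eq_or_lt with rfl | hy
        · exact (hi x hx').ge
        · exact (lt_of_upcrossing (hasDerivAt_phase hz) (hi x hx').ge (fun t ht htv =>
            hup t ((hs x hx').1.trans_le ht) (hcos _ t htv)) hy).le
      have := ge_of_tendsto (tendsto_phase_atTop hz) (Filter.eventually_atTop.2 ⟨x, h2⟩)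
      nlinarith
  · have key : ∀ x ∈ s, ∀ y ∈ s, i x = i y → ¬ x < y := by
      intro x hx y hy hxy hlt
      have := lt_of_upcrossing (hasDerivAt_phase hz) (hi x hx).ge (fun t ht htv =>
            hup t ((hs x hx).1.trans_le ht) (hcos _ t htv)) hlt
      rw [hi y hy, hxy] at this
      exact lt_irrefl _ this
    intro x hx y hy hxy
    exact le_antisymm (not_lt.1 (key y hy x hx hxy.symm)) (not_lt.1 (key x hx y hy hxy))

/-- Intermediate value theorem: the level lies between the starting value, below π/2, and the limit
`upperCard z` · π. -/
theorem exists_phase_eq {n : ℕ} {z : Fin n → ℂ} (hz : ∀ j, (z j).im ≠ 0)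
    (h0 : argSum z < Real.pi / 2) {k : ℕ} (hk : k < upperCard z) :
    ∃ x, 0 < x ∧ phase z x = (2 * k + 1) * Real.pi / 2 := by
  have hpi := Real.pi_pos
  have h1 : (k : ℝ) + 1 ≤ upperCard z := by exact_mod_cast hk
  have h2 : (2 * k + 1) * Real.pi / 2 < upperCard z * Real.pi := by nlinarith
  have h3 : phase z 0 < (2 * k + 1) * Real.pi / 2 := by
    rw [phase_zero]
    have : (0 : ℝ) ≤ k := Nat.cast_nonneg k
    nlinarith
  obtain ⟨y, hy, hy0⟩ := (((tendsto_phase_atTop hz).eventually (lt_mem_nhds h2)).and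
    (Filter.eventually_gt_atTop 0)).exists
  obtain ⟨x, hx, hxv⟩ := intermediate_value_Icc hy0.le (continuous_phase hz).continuousOn
    ⟨h3.le, hy.le⟩
  refine ⟨x, lt_of_le_of_ne hx.1 ?_, hxv⟩
  rintro rfl
  exact h3.ne hxv

/-- A negative slope at x would put the phase above v just before x; since it starts below v, it
would meet v a second time. -/
theorem phaseDeriv_nonneg {n : ℕ} {z : Fin n → ℂ} (hz : ∀ j, (z j).im ≠ 0) {v x : ℝ}
    (h0 : argSum z < v) (hx : 0 < x) (hxv : phase z x = v)
    (huniq : ∀ y, 0 < y → phase z y = v → y = x) : 0 ≤ phaseDeriv z x := by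
  by_contra hneg
  obtain ⟨y, hy0, hyx, hy⟩ := exists_lt_of_hasDerivAt_pos ((hasDerivAt_phase hz x).neg)
    (by linarith) hx
  have hy' : v < phase z y := by
    simp only [Pi.neg_apply] at hy
    linarith
  rw [← phase_zero] at h0
  obtain ⟨t, ht, htv⟩ := intermediate_value_Icc hy0.le (continuous_phase hz).continuousOn
    ⟨h0.le, hy'.le⟩
  have ht0 : 0 < t := lt_of_le_of_ne ht.1 (by rintro rfl; exact h0.ne htv)
  have := huniq t ht0 htv
  linarith [ht.2]

/-! ### Eigenvalues of the perturbation and interlacing -/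

theorem eval_map_algebraMap_ofReal (p : ℝ[X]) (x : ℝ) :
    (p.map (algebraMap ℝ ℂ)).eval (x : ℂ) = (p.eval x : ℝ) := by
  rw [← Complex.coe_algebraMap, eval_map_algebraMap, aeval_algebraMap_apply]
  simp

section

variable {n : ℕ} {z : Fin n → ℂ} {p h : ℝ[X]}

theorem eval_add_eq
    (hχ : ∏ j, (X - C (z j)) = p.map (algebraMap ℝ ℂ) + C Complex.I * h.map (algebraMap ℝ ℂ))
    (x : ℝ) : ∏ j, (x - z j) = ((p.eval x : ℝ) : ℂ) + Complex.I * ((h.eval x : ℝ) : ℂ) := by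
  have := congrArg (eval (x : ℂ)) hχ
  rw [eval_prod, eval_add, eval_mul, eval_map_algebraMap_ofReal, eval_map_algebraMap_ofReal] at this
  simpa using this

/-- On the real line p + i h = ∏ (x - z_j), whose argument modulo π is the phase; the sign (-1)^n is
absorbed in r. -/
theorem exists_polar
    (hχ : ∏ j, (X - C (z j)) = p.map (algebraMap ℝ ℂ) + C Complex.I * h.map (algebraMap ℝ ℂ))
    (hz : ∀ j, (z j).im ≠ 0) (x : ℝ) :
    ∃ r : ℝ, r ≠ 0 ∧ p.eval x = r * Real.cos (phase z x) ∧ h.eval x = r * Real.sin (phase z x) := by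
  obtain ⟨r, hr, hrz⟩ := exists_prod_eq_mul_exp_argSum (z := fun j => z j - x)
    (fun j => by simpa using hz j)
  have h1 := eval_add_eq hχ x
  have h2 : ∏ j, ((x : ℂ) - z j) = (-1 : ℂ) ^ n * ∏ j, (z j - x) := by
    rw [show (-1 : ℂ) ^ n = ∏ j : Fin n, (-1 : ℂ) by simp, ← Finset.prod_mul_distrib]
    exact Finset.prod_congr rfl fun j _ => by ring
  rw [h2, hrz, Complex.exp_mul_I, ← Complex.ofReal_cos, ← Complex.ofReal_sin] at h1
  refine ⟨(-1) ^ n * r, by simp [hr], ?_, ?_⟩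
  · have := congrArg Complex.re h1
    rw [show (-1 : ℂ) ^ n = (((-1) ^ n : ℝ) : ℂ) by push_cast; rfl] at this
    simp only [Complex.add_re, Complex.mul_re, Complex.ofReal_re, Complex.ofReal_im, Complex.I_re,
      Complex.I_im, Complex.add_im, Complex.mul_im] at this
    rw [phase]
    linarith
  · have := congrArg Complex.im h1
    rw [show (-1 : ℂ) ^ n = (((-1) ^ n : ℝ) : ℂ) by push_cast; rfl] at this
    simp only [Complex.add_re, Complex.mul_re, Complex.ofReal_re, Complex.ofReal_im, Complex.I_re,
      Complex.I_im, Complex.add_im, Complex.mul_im] at this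
    rw [phase]
    linarith

theorem cos_phase_eq_zero_iff
    (hχ : ∏ j, (X - C (z j)) = p.map (algebraMap ℝ ℂ) + C Complex.I * h.map (algebraMap ℝ ℂ))
    (hz : ∀ j, (z j).im ≠ 0) (x : ℝ) : Real.cos (phase z x) = 0 ↔ p.eval x = 0 := by
  obtain ⟨r, hr, h1, -⟩ := exists_polar hχ hz x
  rw [h1, mul_eq_zero, or_iff_right hr]

/-- Both sides are Im(χ' · conj χ), that is |χ|² times the derivative of arg χ, expanded over the
linear factors of χ. -/
theorem wronskian_eq
    (hχ : ∏ j, (X - C (z j)) = p.map (algebraMap ℝ ℂ) + C Complex.I * h.map (algebraMap ℝ ℂ))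
    (hz : ∀ j, (z j).im ≠ 0) (x : ℝ) :
    (derivative h).eval x * p.eval x - (derivative p).eval x * h.eval x =
      ((p.eval x) ^ 2 + (h.eval x) ^ 2) * phaseDeriv z x := by
  have h0 := eval_add_eq hχ x
  have h1 := congrArg (fun f => eval (x : ℂ) (derivative f)) hχ
  simp only [derivative_add, derivative_mul, derivative_C, zero_mul, zero_add, derivative_map,
    eval_add, eval_mul, eval_C, eval_map_algebraMap_ofReal] at h1
  have h2 : eval (x : ℂ) (derivative (∏ j, (X - C (z j)))) =
      ∑ j, ∏ k ∈ Finset.univ.erase j, ((x : ℂ) - z k) := by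
    have := Lagrange.derivative_nodal (s := Finset.univ) (v := z)
    rw [Lagrange.nodal_eq] at this
    rw [this, eval_finsetSum]
    exact Finset.sum_congr rfl fun j _ => Lagrange.eval_nodal
  rw [h2] at h1
  have h3 : (derivative h).eval x * p.eval x - (derivative p).eval x * h.eval x =
      ((∑ j, ∏ k ∈ Finset.univ.erase j, ((x : ℂ) - z k)) *
        (starRingEnd ℂ) (∏ j, ((x : ℂ) - z j))).im := by
    rw [h1, h0]
    simp
    ring
  have h4 : (p.eval x) ^ 2 + (h.eval x) ^ 2 = Complex.normSq (∏ j, ((x : ℂ) - z j)) := by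
    rw [h0, Complex.normSq_apply]
    simp
    ring
  rw [h3, h4, phaseDeriv, Finset.sum_mul, Complex.im_sum, Finset.mul_sum]
  refine Finset.sum_congr rfl fun j _ => ?_
  have hne : (x : ℂ) - z j ≠ 0 := by
    intro h
    apply hz j
    simpa using congrArg Complex.im h
  have h5 : ‖z j - x‖ ^ 2 = Complex.normSq ((x : ℂ) - z j) := by
    rw [Complex.normSq_eq_norm_sq, norm_sub_rev]
  have h6 := Complex.normSq_pos.2 hne
  rw [← Finset.mul_prod_erase Finset.univ (fun j => (x : ℂ) - z j) (Finset.mem_univ j), map_mul,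
    map_mul, h5, mul_comm ((starRingEnd ℂ) ((x : ℂ) - z j)), ← mul_assoc, Complex.mul_conj]
  rw [Complex.im_ofReal_mul, Complex.conj_im, Complex.sub_im, Complex.ofReal_im]
  field_simp
  ring

end

/-- At a root of p one has h = -l x c, so the Wronskian of (p, h) is l x c p', and c p' > 0. The
phase thus moves upward when x moves away from 0. -/
theorem upcrossing_of_interlaces {m : ℕ} {p c : ℝ[X]} (hI : Interlaces m p c) {l : ℝ} (hl : 0 < l)
    {z : Fin (m + 1) → ℂ}
    (hχ : ∏ j, (X - C (z j)) = p.map (algebraMap ℝ ℂ) +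
      C Complex.I * (C l * (p - X * c)).map (algebraMap ℝ ℂ))
    (hz : ∀ j, (z j).im ≠ 0) {x : ℝ} (hx : x ≠ 0) (hpx : p.eval x = 0) :
    0 < phaseDeriv z x * x := by
  have h1 := wronskian_eq hχ hz x
  have h2 := hI.wronskian_pos x
  rw [hpx] at h1 h2
  have h3 : (C l * (p - X * c)).eval x = -(l * x * c.eval x) := by
    simp [hpx]; ring
  rw [h3] at h1
  have h4 : 0 < (derivative p).eval x * c.eval x := by linarith
  have hc : c.eval x ≠ 0 := by
    intro h; simp [h] at h4
  have h5 : 0 < (l * x * c.eval x) ^ 2 := by positivity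
  have h6 : (l * x * c.eval x) ^ 2 * (phaseDeriv z x * x) =
      l * x ^ 2 * ((derivative p).eval x * c.eval x) := by
    linear_combination (-x) * h1
  have h7 : 0 < (l * x * c.eval x) ^ 2 * (phaseDeriv z x * x) := by
    rw [h6]; positivity
  exact (pos_iff_pos_of_mul_pos h7).1 h5

/-- A real eigenvalue would be a common root of p and c, which the Wronskian forbids. At 0 one has h
= l p, hence the tangent. The bound by π/2 comes from counting: p has m + 1 real roots, and level
crossings can supply that many only if the phase starts in its lowest interval. -/
theorem configuration_of_interlaces {m : ℕ} {p c : ℝ[X]} (hI : Interlaces m p c)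
    (hp0 : p.eval 0 ≠ 0) {l : ℝ} (hl : 0 < l) {z : Fin (m + 1) → ℂ}
    (hχ : ∏ j, (X - C (z j)) = p.map (algebraMap ℝ ℂ) +
      C Complex.I * (C l * (p - X * c)).map (algebraMap ℝ ℂ)) :
    (∀ j, (z j).im ≠ 0) ∧ argSum z < Real.pi / 2 ∧ Real.tan (argSum z) = l := by
  have hpi := Real.pi_pos
  have hz : ∀ j, (z j).im ≠ 0 := by
    intro j hj
    have hre : ((z j).re : ℂ) = z j := Complex.ext (by simp) (by simp [hj])
    have h1 := eval_add_eq hχ (z j).re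
    rw [Finset.prod_eq_zero (Finset.mem_univ j) (by rw [hre, sub_self])] at h1
    have h2 := congrArg Complex.re h1
    have h3 := congrArg Complex.im h1
    simp at h2 h3
    rw [← h2] at h3
    have hx : (z j).re ≠ 0 := by
      intro h
      rw [h] at h2
      exact hp0 h2.symm
    have hc : c.eval (z j).re = 0 := by
      rcases h3 with h3 | h3
      · exact absurd h3 hl.ne'
      · simpa [hx] using h3
    have := hI.wronskian_pos (z j).re
    rw [hc, ← h2] at this
    simp at this
  obtain ⟨r, hr, hrc, hrs⟩ := exists_polar hχ hz 0
  rw [phase_zero] at hrc hrs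
  have hcos : Real.cos (argSum z) ≠ 0 := by
    intro h
    rw [h, mul_zero] at hrc
    exact hp0 hrc
  have htan : Real.tan (argSum z) = l := by
    rw [Real.tan_eq_sin_div_cos, div_eq_iff hcos]
    have : r * Real.sin (argSum z) = r * (l * Real.cos (argSum z)) := by
      rw [← hrs]
      simp only [eval_mul, eval_sub, eval_C, eval_X, zero_mul, sub_zero, hrc]
      ring
    exact mul_left_cancel₀ hr this
  have hpos : 0 < argSum z := Finset.sum_pos (fun j _ => argModPi_pos (hz j)) Finset.univ_nonempty
  refine ⟨hz, ?_, htan⟩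
  set k : ℤ := ⌊argSum z / Real.pi⌋ with hk
  have hk0 : 0 ≤ k := Int.floor_nonneg.2 (by positivity)
  have hk1 : k * Real.pi ≤ argSum z := by
    rw [← le_div_iff₀ hpi]; exact Int.floor_le _
  have hk2 : argSum z < (k + 1) * Real.pi := by
    rw [← div_lt_iff₀ hpi]; exact Int.lt_floor_add_one _
  -- In the upper half of the period the tangent is nonpositive (at the endpoint `Real.tan` is 0),
  -- whereas l > 0.
  have hk3 : argSum z < k * Real.pi + Real.pi / 2 := by
    by_contra hge
    have h1 : Real.tan (argSum z - (k + 1 : ℤ) * Real.pi) = l := by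
      rw [Real.tan_sub_int_mul_pi, htan]
    have h2 : Real.tan (argSum z - (k + 1 : ℤ) * Real.pi) ≤ 0 := by
      refine Real.tan_nonpos_of_nonpos_of_neg_pi_div_two_le ?_ ?_
      · push_cast; linarith
      · push_cast; linarith
    linarith
  obtain ⟨s, hs, hsr⟩ := hI.exists_roots
  have hs0 : ∀ x ∈ s, x ≠ 0 := by
    rintro x hx rfl
    exact hp0 (hsr 0 hx).1
  have hzn : ∀ j, ((-z) j).im ≠ 0 := fun j => by simpa using hz j
  have hsum : argSum (-z) = argSum z := by
    rw [← phase_zero, phase_neg hz, neg_zero, phase_zero]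
  have hlow : k * Real.pi - Real.pi / 2 < argSum z := by linarith
  have hplus := card_le_of_upcrossing hz (k := k) hlow
    (s := s.filter fun x => 0 < x) (fun x hx hc => by
      have := upcrossing_of_interlaces hI hl hχ hz hx.ne' ((cos_phase_eq_zero_iff hχ hz x).1 hc)
      exact (pos_iff_pos_of_mul_pos this).2 hx) (fun x hx => by
      rw [Finset.mem_filter] at hx
      exact ⟨hx.2, (cos_phase_eq_zero_iff hχ hz x).2 (hsr x hx.1).1⟩)
  have hminus := card_le_of_upcrossing hzn (k := k) (by rw [hsum]; exact hlow)
    (s := (s.filter fun x => ¬ 0 < x).image Neg.neg) (fun x hx hc => by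
      rw [phase_neg hz] at hc
      have := upcrossing_of_interlaces hI hl hχ hz (x := -x) (by simpa using hx.ne')
        ((cos_phase_eq_zero_iff hχ hz (-x)).1 hc)
      rw [phaseDeriv_neg]
      rw [mul_neg, ← neg_mul] at this
      exact (pos_iff_pos_of_mul_pos this).2 hx) (fun x hx => by
      obtain ⟨y, hy, rfl⟩ := Finset.mem_image.1 hx
      rw [Finset.mem_filter] at hy
      rw [phase_neg hz, neg_neg]
      exact ⟨neg_pos.2 (lt_of_le_of_ne (not_lt.1 hy.2) (hs0 y hy.1)),
        (cos_phase_eq_zero_iff hχ hz y).2 (hsr y hy.1).1⟩)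
  rw [Finset.card_image_of_injective _ neg_injective] at hminus
  have hcard := Finset.card_filter_add_card_filter_not (s := s) (fun x => 0 < x)
  have hN := upperCard_add_upperCard_neg hz
  -- The m + 1 roots are at most (N - k)⁺ + (m + 1 - N - k)⁺ in number, with k ≥ 0; since m + 1 > 0
  -- this forces k = 0.
  have hkz : k = 0 := by omega
  rw [hkz] at hk3
  simpa using hk3

/-- The phase must meet `upperCard z` levels to the right of 0 and `upperCard (-z)` to the left.
These account for the whole degree of p, so its roots are real and simple, and each level is met
once on each side. Uniqueness fixes the sign of the phase derivative, hence the sign of the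
residues. -/
theorem exists_interlaces_of_configuration {m : ℕ} {z : Fin (m + 1) → ℂ}
    (hz : ∀ j, (z j).im ≠ 0) (hsum : argSum z < Real.pi / 2) {p h : ℝ[X]}
    (hp : p.Monic) (hpd : p.natDegree = m + 1) (hh : h.natDegree < m + 1)
    (hχ : ∏ j, (X - C (z j)) = p.map (algebraMap ℝ ℂ) + C Complex.I * h.map (algebraMap ℝ ℂ)) :
    0 < Real.tan (argSum z) ∧ p.eval 0 ≠ 0 ∧
      ∃ c, Interlaces m p c ∧ h = C (Real.tan (argSum z)) * (p - X * c) := by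
  have hpi := Real.pi_pos
  have hpos : 0 < argSum z := Finset.sum_pos (fun j _ => argModPi_pos (hz j)) Finset.univ_nonempty
  have hl : 0 < Real.tan (argSum z) := Real.tan_pos_of_pos_of_lt_pi_div_two hpos hsum
  have hcos : 0 < Real.cos (argSum z) := Real.cos_pos_of_mem_Ioo ⟨by linarith, hsum⟩
  obtain ⟨r, hr, hrc, hrs⟩ := exists_polar hχ hz 0
  rw [phase_zero] at hrc hrs
  have hp0 : p.eval 0 ≠ 0 := by
    rw [hrc]; exact mul_ne_zero hr hcos.ne'
  set l := Real.tan (argSum z) with hldef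
  have hh0 : h.eval 0 = l * p.eval 0 := by
    rw [hrc, hrs, hldef, Real.tan_eq_sin_div_cos]
    field_simp
  have hzn : ∀ j, ((-z) j).im ≠ 0 := fun j => by simpa using hz j
  have hsumn : argSum (-z) = argSum z := by
    rw [← phase_zero, phase_neg hz, neg_zero, phase_zero]
  -- the real roots of `p`
  choose f hf0 hf using fun k : Fin (upperCard z) => exists_phase_eq hz hsum k.2
  choose g hg0 hg using fun k : Fin (upperCard (-z)) => exists_phase_eq hzn (by rwa [hsumn]) k.2
  have hlev : ∀ k k' : ℕ, (2 * (k : ℝ) + 1) * Real.pi / 2 = (2 * (k' : ℝ) + 1) * Real.pi / 2 →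
      k = k' := by
    intro k k' hkk
    have : (k : ℝ) = k' := by nlinarith
    exact_mod_cast this
  have hfinj : Function.Injective f := fun k k' hkk => Fin.ext (hlev _ _ (by
    rw [← hf, ← hf, hkk]))
  have hginj : Function.Injective g := fun k k' hkk => Fin.ext (hlev _ _ (by
    rw [← hg, ← hg, hkk]))
  set s : Finset ℝ := Finset.univ.image f with hs
  set t : Finset ℝ := Finset.univ.image fun k => -g k with ht
  have hscard : s.card = upperCard z := by
    rw [hs, Finset.card_image_of_injective _ hfinj, Finset.card_univ, Fintype.card_fin]
  have htcard : t.card = upperCard (-z) := by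
    rw [ht, Finset.card_image_of_injective _ (show Function.Injective fun k => -g k from
      neg_injective.comp hginj), Finset.card_univ, Fintype.card_fin]
  have hsmem : ∀ x ∈ s, 0 < x := by
    intro x hx
    obtain ⟨k, -, rfl⟩ := Finset.mem_image.1 hx
    exact hf0 k
  have htmem : ∀ x ∈ t, x < 0 := by
    intro x hx
    obtain ⟨k, -, rfl⟩ := Finset.mem_image.1 hx
    exact neg_neg_of_pos (hg0 k)
  have hdisj : Disjoint s t := by
    rw [Finset.disjoint_left]
    intro x hx hx'
    exact lt_asymm (hsmem x hx) (htmem x hx')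
  have hcosk : ∀ k : ℕ, Real.cos ((2 * (k : ℝ) + 1) * Real.pi / 2) = 0 := fun k =>
    Real.cos_eq_zero_iff.2 ⟨k, by push_cast; rfl⟩
  have hroot : ∀ x ∈ s ∪ t, p.eval x = 0 := by
    intro x hx
    rw [← cos_phase_eq_zero_iff hχ hz]
    rcases Finset.mem_union.1 hx with hx | hx
    · obtain ⟨k, -, rfl⟩ := Finset.mem_image.1 hx
      rw [hf, hcosk]
    · obtain ⟨k, -, rfl⟩ := Finset.mem_image.1 hx
      rw [← phase_neg hz, hg, hcosk]
  have hcard : (s ∪ t).card = m + 1 := by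
    rw [Finset.card_union_of_disjoint hdisj, hscard, htcard, upperCard_add_upperCard_neg hz]
  have hnodal := eq_nodal_of_roots hp (by rw [hcard, hpd]) hroot
  have hmem : ∀ x, p.eval x = 0 → x ∈ s ∪ t := by
    intro x hx
    rw [hnodal, Lagrange.eval_nodal, Finset.prod_eq_zero_iff] at hx
    obtain ⟨y, hy, hxy⟩ := hx
    rw [sub_eq_zero.1 hxy]
    exact hy
  have hsimple : ∀ x ∈ s ∪ t, (derivative p).eval x ≠ 0 := by
    intro x hx
    have := Lagrange.eval_nodal_derivative_eval_node_eq (v := (id : ℝ → ℝ)) hx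
    simp only [id] at this
    rw [hnodal, this, Lagrange.eval_nodal, Finset.prod_ne_zero_iff]
    intro y hy
    exact sub_ne_zero.2 (Finset.ne_of_mem_erase hy).symm
  -- the direction in which the phase crosses the levels
  have hcross : ∀ x ∈ s ∪ t, 0 ≤ phaseDeriv z x * x := by
    intro x hx
    have hlt : ∀ k : ℕ, argSum z < (2 * (k : ℝ) + 1) * Real.pi / 2 := by
      intro k
      have : (0 : ℝ) ≤ k := Nat.cast_nonneg k
      nlinarith
    rcases Finset.mem_union.1 hx with hx | hx
    · refine mul_nonneg ?_ (hsmem x hx).le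
      obtain ⟨k, -, rfl⟩ := Finset.mem_image.1 hx
      refine phaseDeriv_nonneg hz (hlt k) (hf0 k) (hf k) fun y hy hyv => ?_
      have hy' := hmem y ((cos_phase_eq_zero_iff hχ hz y).1 (by rw [hyv, hcosk]))
      rcases Finset.mem_union.1 hy' with hy' | hy'
      · obtain ⟨k', -, rfl⟩ := Finset.mem_image.1 hy'
        rw [Fin.ext (hlev k' k (by rw [← hf, hyv]))]
      · exact absurd (htmem y hy') (not_lt.2 hy.le)
    · obtain ⟨k, -, rfl⟩ := Finset.mem_image.1 hx
      rw [mul_neg, ← neg_mul, ← phaseDeriv_neg]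
      refine mul_nonneg ?_ (hg0 k).le
      refine phaseDeriv_nonneg hzn (by rw [hsumn]; exact hlt k) (hg0 k) (hg k) fun y hy hyv => ?_
      have hy' := hmem (-y) ((cos_phase_eq_zero_iff hχ hz (-y)).1 (by
        rw [← phase_neg hz, hyv, hcosk]))
      rcases Finset.mem_union.1 hy' with hy' | hy'
      · exact absurd (hsmem _ hy') (by linarith)
      · obtain ⟨k', -, hk'⟩ := Finset.mem_image.1 hy'
        have hk'' : g k' = y := neg_injective hk'
        rw [← hk'', Fin.ext (hlev k' k (by rw [← hg, hk'', hyv]))]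
  -- the companion polynomial
  set q : ℝ[X] := p - C l⁻¹ * h with hq
  -- The equality h(0) = l p(0) is what makes p - h / l divisible by X; the quotient is c.
  have hq0 : q.coeff 0 = 0 := by
    rw [coeff_zero_eq_eval_zero, hq, eval_sub, eval_mul, eval_C, hh0]
    field_simp
    ring
  have hXq : X * q.divX = q := by
    have := X_mul_divX_add q
    rwa [hq0, C_0, add_zero] at this
  have hhl : h = C l * (p - X * q.divX) := by
    rw [hXq, hq, sub_sub_cancel, ← mul_assoc, ← C_mul, mul_inv_cancel₀ hl.ne', C_1, one_mul]
  have hdlt : (C l⁻¹ * h).degree < p.degree := by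
    rw [degree_C_mul (inv_ne_zero hl.ne'), degree_eq_natDegree hp.ne_zero, hpd]
    exact lt_of_le_of_lt degree_le_natDegree (by exact_mod_cast hh)
  have hqm : q.Monic := hp.sub_of_left hdlt
  have hqd : q.natDegree = m + 1 := by
    rw [hq, natDegree_sub_eq_left_of_natDegree_lt, hpd]
    rw [natDegree_C_mul (inv_ne_zero hl.ne'), hpd]
    exact hh
  have hcd : q.divX.natDegree = m := by
    rw [natDegree_divX_eq_natDegree_tsub_one, hqd]; rfl
  have hcm : q.divX.Monic := by
    rw [Monic, leadingCoeff, hcd, coeff_divX, ← hqd]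
    exact hqm
  refine ⟨hl, hp0, q.divX, ⟨hp, hpd, hcm, hcd, s ∪ t, hcard, fun x hx => ⟨hroot x hx, ?_⟩⟩, hhl⟩
  have hx0 : x ≠ 0 := by
    rintro rfl
    exact hp0 (hroot 0 hx)
  have h1 := wronskian_eq hχ hz x
  rw [hroot x hx] at h1
  have h3 : h.eval x = -(l * x * q.divX.eval x) := by
    rw [hhl]
    simp only [eval_mul, eval_sub, eval_C, eval_X, hroot x hx]
    ring
  -- A common root of p and c would annihilate h too, so cosine and sine of the phase would both
  -- vanish.
  have hne : q.divX.eval x ≠ 0 := by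
    intro h0
    rw [h0, mul_zero, neg_zero] at h3
    obtain ⟨r, hr, hrc, hrs⟩ := exists_polar hχ hz x
    rw [hroot x hx] at hrc
    rw [h3] at hrs
    have h4 := (mul_eq_zero.1 hrc.symm).resolve_left hr
    have h5 := (mul_eq_zero.1 hrs.symm).resolve_left hr
    have := Real.sin_sq_add_cos_sq (phase z x)
    rw [h4, h5] at this
    norm_num at this
  have h4 : l * x ^ 2 * (q.divX.eval x * (derivative p).eval x) =
      h.eval x ^ 2 * (phaseDeriv z x * x) := by
    rw [h3] at h1 ⊢
    linear_combination x * h1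
  have h5 : 0 ≤ l * x ^ 2 * (q.divX.eval x * (derivative p).eval x) := by
    rw [h4]
    exact mul_nonneg (sq_nonneg _) (hcross x hx)
  have h6 : 0 < l * x ^ 2 := by positivity
  have h7 := nonneg_of_mul_nonneg_right h5 h6
  exact lt_of_le_of_ne h7 (mul_ne_zero hne (hsimple x hx)).symm

/-! ### Monic polynomials and their coefficient vectors -/

/-- The monic polynomial with given lower coefficients. -/
def monicPoly {R : Type*} [CommRing R] {n : ℕ} (v : Fin n → R) : R[X] :=
  X ^ n + ∑ i, C (v i) * X ^ (i : ℕ)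

/-- The first `n` coefficients of a polynomial. -/
def coeffVec {R : Type*} [CommRing R] (n : ℕ) (p : R[X]) : Fin n → R := fun i => p.coeff i

theorem coeff_monicPoly {R : Type*} [CommRing R] {n : ℕ} (v : Fin n → R) (k : ℕ) :
    (monicPoly v).coeff k = if h : k < n then v ⟨k, h⟩ else if k = n then 1 else 0 := by
  rw [monicPoly, coeff_add, coeff_X_pow, finsetSum_coeff]
  simp only [coeff_C_mul_X_pow]
  by_cases h : k < n
  · rw [dif_pos h, if_neg (by omega), Finset.sum_eq_single (⟨k, h⟩ : Fin n)]
    · simp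
    · intro i _ hi
      rw [if_neg]
      rintro rfl
      exact hi rfl
    · simp
  · rw [dif_neg h, Finset.sum_eq_zero, add_zero]
    intro i _
    rw [if_neg]
    have := i.2
    omega

theorem coeffVec_monicPoly {R : Type*} [CommRing R] {n : ℕ} (v : Fin n → R) :
    coeffVec n (monicPoly v) = v := by
  ext i
  simp [coeffVec, coeff_monicPoly]

theorem natDegree_monicPoly {R : Type*} [CommRing R] [Nontrivial R] {n : ℕ} (v : Fin n → R) :
    (monicPoly v).natDegree = n := by
  refine natDegree_eq_of_le_of_coeff_ne_zero ?_ (n := n) ?_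
  · rw [natDegree_le_iff_coeff_eq_zero]
    intro k hk
    rw [coeff_monicPoly, dif_neg (by omega), if_neg (by omega)]
  · simp [coeff_monicPoly]

theorem monic_monicPoly {R : Type*} [CommRing R] [Nontrivial R] {n : ℕ} (v : Fin n → R) :
    (monicPoly v).Monic := by
  rw [Monic, leadingCoeff, natDegree_monicPoly]
  simp [coeff_monicPoly]

theorem monicPoly_coeffVec {R : Type*} [CommRing R] {n : ℕ} {p : R[X]} (hp : p.Monic)
    (hn : p.natDegree = n) : monicPoly (coeffVec n p) = p := by
  ext k
  rw [coeff_monicPoly]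
  split_ifs with h1 h2
  · rfl
  · rw [h2, ← hn]; exact hp.symm
  · rw [coeff_eq_zero_of_natDegree_lt]; omega

theorem measurable_coeff_monicPoly {R : Type*} [CommRing R] [MeasurableSpace R] {n : ℕ} (k : ℕ) :
    Measurable fun v : Fin n → R => (monicPoly v).coeff k := by
  simp only [coeff_monicPoly]
  split_ifs
  · exact measurable_pi_apply _
  · exact measurable_const
  · exact measurable_const

/-! ### Lebesgue integrals over vectors -/

theorem lintegral_insertNth {m : ℕ} (i : Fin (m + 1)) {f : (Fin (m + 1) → ℝ) → ℝ≥0∞}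
    (hf : Measurable f) : ∫⁻ v, f v = ∫⁻ x : ℝ, ∫⁻ w : Fin m → ℝ, f (i.insertNth x w) := by
  have h := (volume_preserving_piFinSuccAbove (fun _ : Fin (m + 1) => ℝ) i).symm
  rw [← h.lintegral_comp_emb (MeasurableEquiv.measurableEmbedding _), Measure.volume_eq_prod,
    lintegral_prod]
  · rfl
  · exact (hf.comp (MeasurableEquiv.measurable _)).aemeasurable

theorem lintegral_fin_cons {m : ℕ} {f : (Fin (m + 1) → ℝ) → ℝ≥0∞}
    (hf : Measurable f) : ∫⁻ v, f v = ∫⁻ x : ℝ, ∫⁻ w : Fin m → ℝ, f (Fin.cons x w) := by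
  simpa using lintegral_insertNth 0 hf

theorem lintegral_fin_snoc {m : ℕ} {f : (Fin (m + 1) → ℝ) → ℝ≥0∞}
    (hf : Measurable f) :
    ∫⁻ v, f v = ∫⁻ x : ℝ, ∫⁻ w : Fin m → ℝ, f (Fin.snoc (α := fun _ => ℝ) w x) := by
  simpa [Fin.insertNth_last'] using lintegral_insertNth (Fin.last m) hf

theorem lintegral_smul_fin {m : ℕ} (f : (Fin m → ℝ) → ℝ≥0∞) {s : ℝ} (hs : s ≠ 0) :
    ∫⁻ w, f w = ENNReal.ofReal (|s| ^ m) * ∫⁻ w, f (s • w) := by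
  have h := Measure.map_addHaar_smul (volume : Measure (Fin m → ℝ)) hs
  have h1 : ∫⁻ w, f (s • w) = ∫⁻ w, f w ∂(Measure.map (s • ·) volume) := by
    symm
    exact lintegral_map_equiv f (MeasurableEquiv.smul₀ s hs)
  rw [h1, h, lintegral_smul_measure, smul_eq_mul, ← mul_assoc, ← ENNReal.ofReal_mul (by positivity)]
  rw [Module.finrank_fin_fun, abs_inv, abs_pow, mul_inv_cancel₀ (by positivity)]
  simp

theorem lintegral_mul_left_real (f : ℝ → ℝ≥0∞) {s : ℝ} (hs : s ≠ 0) :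
    ∫⁻ x, f x = ENNReal.ofReal |s| * ∫⁻ x, f (s * x) := by
  have h := Measure.map_addHaar_smul (volume : Measure ℝ) hs
  have h1 : ∫⁻ w, f (s • w) = ∫⁻ w, f w ∂(Measure.map (s • ·) volume) := by
    symm
    exact lintegral_map_equiv f (MeasurableEquiv.smul₀ s hs)
  change _ = _ * ∫⁻ x, f (s • x)
  rw [h1, h, lintegral_smul_measure, smul_eq_mul, ← mul_assoc, ← ENNReal.ofReal_mul (by positivity)]
  rw [Module.finrank_self, pow_one, abs_inv, mul_inv_cancel₀ (by positivity)]
  simp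

theorem lintegral_sq_mul (f : ℝ → ℝ≥0∞) :
    ∫⁻ x in Set.Ioi 0, f x = ∫⁻ x in Set.Ioi 0, ENNReal.ofReal (2 * x) * f (x ^ 2) := by
  have himg : (fun x : ℝ => x ^ 2) '' Set.Ioi 0 = Set.Ioi 0 := by
    ext y
    constructor
    · rintro ⟨x, hx, rfl⟩
      exact pow_pos (Set.mem_Ioi.1 hx) 2
    · intro hy
      exact ⟨Real.sqrt y, Real.sqrt_pos.2 hy, Real.sq_sqrt (le_of_lt hy)⟩
  have := lintegral_image_eq_lintegral_abs_deriv_mul (s := Set.Ioi 0) (f := fun x : ℝ => x ^ 2)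
    (f' := fun x => 2 * x) measurableSet_Ioi
    (fun x _ => by simpa using (hasDerivAt_pow 2 x).hasDerivWithinAt)
    (fun x hx y hy hxy => by
      exact (pow_left_inj₀ (le_of_lt hx) (le_of_lt hy) two_ne_zero).1 hxy) f
  rw [himg] at this
  rw [this]
  refine setLIntegral_congr_fun measurableSet_Ioi fun x hx => ?_
  have hx' : (0 : ℝ) < x := hx
  simp only [abs_of_pos (by positivity : 0 < 2 * x)]

/-- Substitution u = (s d, s): it parametrizes the remainders of a division by leading coefficient s
and normalized lower coefficients d. -/
theorem lintegral_cone {m : ℕ} {f : (Fin (m + 1) → ℝ) → ℝ≥0∞} (hf : Measurable f) :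
    ∫⁻ u in {u | 0 < u (Fin.last m)}, f u =
      ∫⁻ s in Set.Ioi (0 : ℝ), ENNReal.ofReal (s ^ m) *
        ∫⁻ d : Fin m → ℝ, f (Fin.snoc (α := fun _ => ℝ) (s • d) s) := by
  have hS : MeasurableSet {u : Fin (m + 1) → ℝ | 0 < u (Fin.last m)} :=
    measurableSet_lt measurable_const (measurable_pi_apply _)
  rw [← lintegral_indicator hS, lintegral_fin_snoc (hf.indicator hS),
    ← lintegral_indicator measurableSet_Ioi]
  refine lintegral_congr fun s => ?_
  by_cases hs : 0 < s
  · rw [Set.indicator_of_mem (Set.mem_Ioi.2 hs)]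
    simp only [Set.indicator, Set.mem_ofPred_eq, Fin.snoc_last, hs, if_true]
    rw [lintegral_smul_fin (fun w => f (Fin.snoc (α := fun _ => ℝ) w s)) hs.ne', abs_of_pos hs]
  · rw [Set.indicator_of_notMem (by simpa using hs)]
    simp [Set.indicator, hs]

/-! ### One step of the Euclidean algorithm in coordinates -/

/-- Coefficient vectors of a pair of monic polynomials of degrees `m + 1` and `m`. -/
abbrev PairCoeffs (m : ℕ) : Type := (Fin (m + 1) → ℝ) × (Fin m → ℝ)

/-- The coefficients of `(X - b) c - s d` and `c`. -/
def euclidStep {m : ℕ} (b s : ℝ) (y : PairCoeffs m) : PairCoeffs (m + 1) :=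
  (coeffVec (m + 2) ((X - C b) * monicPoly y.1 - C s * monicPoly y.2), y.1)

/-- The remainder of the division of `p` by `c`, up to sign. -/
def euclidRem {m : ℕ} (y : PairCoeffs (m + 1)) : ℝ[X] :=
  (X - C (y.2 (Fin.last m) - y.1 (Fin.last (m + 1)))) * monicPoly y.2 - monicPoly y.1

/-- The leading coefficient of the remainder. -/
def euclidLead {m : ℕ} (y : PairCoeffs (m + 1)) : ℝ := (euclidRem y).coeff m

/-- The pair consisting of `c` and the normalized remainder. -/
def euclidNext {m : ℕ} (y : PairCoeffs (m + 1)) : PairCoeffs m :=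
  -- The junk value when the leading coefficient is 0 is harmless: interlacing pairs have a positive
  -- one.
  (y.2, fun i => (euclidRem y).coeff i / euclidLead y)

theorem measurable_fin_snoc {m : ℕ} :
    Measurable fun q : (Fin m → ℝ) × ℝ => (Fin.snoc (α := fun _ => ℝ) q.1 q.2 : Fin (m + 1) → ℝ) := by
  refine measurable_pi_iff.2 fun i => ?_
  refine Fin.lastCases ?_ (fun i => ?_) i
  · simpa using measurable_snd
  · simpa using (by fun_prop : Measurable fun q : (Fin m → ℝ) × ℝ => q.1 i)

theorem measurable_fin_cons {m : ℕ} :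
    Measurable fun q : ℝ × (Fin m → ℝ) => (Fin.cons (α := fun _ => ℝ) q.1 q.2 : Fin (m + 1) → ℝ) := by
  refine measurable_pi_iff.2 fun i => ?_
  refine Fin.cases ?_ (fun i => ?_) i
  · simpa using measurable_fst
  · simpa using (by fun_prop : Measurable fun q : ℝ × (Fin m → ℝ) => q.2 i)

theorem coeff_X_sub_C_mul {R : Type*} [CommRing R] (b : R) (c : R[X]) (k : ℕ) :
    ((X - C b) * c).coeff k = (if k = 0 then 0 else c.coeff (k - 1)) - b * c.coeff k := by
  rw [sub_mul, coeff_sub, coeff_C_mul]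
  cases k with
  | zero => simp
  | succ k => simp

theorem measurable_coeff_X_sub_C_mul {m k : ℕ} :
    Measurable fun q : ℝ × (Fin m → ℝ) => ((X - C q.1) * monicPoly q.2).coeff k := by
  have h : ∀ k, Measurable fun q : ℝ × (Fin m → ℝ) => (monicPoly q.2).coeff k :=
    fun k => (measurable_coeff_monicPoly k).comp measurable_snd
  simp only [coeff_X_sub_C_mul]
  split_ifs
  · exact measurable_const.sub (measurable_fst.mul (h k))
  · exact (h _).sub (measurable_fst.mul (h k))

theorem measurable_coeff_euclidRem {m : ℕ} (k : ℕ) :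
    Measurable fun y : PairCoeffs (m + 1) => (euclidRem y).coeff k := by
  have h1 : Measurable fun y : PairCoeffs (m + 1) =>
      ((y.2 (Fin.last m) - y.1 (Fin.last (m + 1)), y.2) : ℝ × (Fin (m + 1) → ℝ)) := by fun_prop
  simp only [euclidRem, coeff_sub]
  exact (measurable_coeff_X_sub_C_mul.comp h1).sub
    ((measurable_coeff_monicPoly k).comp measurable_fst)

theorem measurable_euclidLead {m : ℕ} : Measurable (euclidLead (m := m)) :=
  measurable_coeff_euclidRem m

theorem measurable_euclidNext {m : ℕ} : Measurable (euclidNext (m := m)) :=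
  measurable_snd.prodMk (measurable_pi_iff.2 fun _ =>
    (measurable_coeff_euclidRem _).div measurable_euclidLead)

theorem measurable_euclidStep {m : ℕ} :
    Measurable fun q : ℝ × ℝ × PairCoeffs m => euclidStep q.1 q.2.1 q.2.2 := by
  refine Measurable.prodMk (measurable_pi_iff.2 fun i => ?_) (by fun_prop)
  simp only [coeffVec, coeff_sub, coeff_C_mul]
  have h1 : Measurable fun q : ℝ × ℝ × PairCoeffs m =>
      ((q.1, q.2.2.1) : ℝ × (Fin (m + 1) → ℝ)) := by fun_prop
  have h2 : Measurable fun q : ℝ × ℝ × PairCoeffs m => q.2.2.2 := by fun_prop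
  exact (measurable_coeff_X_sub_C_mul.comp h1).sub
    ((by fun_prop : Measurable fun q : ℝ × ℝ × PairCoeffs m => q.2.1).mul
      ((measurable_coeff_monicPoly _).comp h2))

theorem monicPoly_euclidStep {m : ℕ} (b s : ℝ) (y : PairCoeffs m) :
    monicPoly (euclidStep b s y).1 = (X - C b) * monicPoly y.1 - C s * monicPoly y.2 := by
  have hm := (monic_X_sub_C b).mul (monic_monicPoly y.1)
  have hd : ((X - C b) * monicPoly y.1).natDegree = m + 2 := by
    rw [(monic_X_sub_C b).natDegree_mul (monic_monicPoly y.1), natDegree_X_sub_C,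
      natDegree_monicPoly]
    omega
  have hlt : (C s * monicPoly y.2).natDegree < m + 2 := by
    refine lt_of_le_of_lt (natDegree_C_mul_le _ _) ?_
    rw [natDegree_monicPoly]
    omega
  have hdeg : ((X - C b) * monicPoly y.1 - C s * monicPoly y.2).natDegree = m + 2 := by
    rw [natDegree_sub_eq_left_of_natDegree_lt (by rwa [hd]), hd]
  have hmon : ((X - C b) * monicPoly y.1 - C s * monicPoly y.2).Monic := by
    refine hm.sub_of_left ?_
    rw [degree_eq_natDegree hm.ne_zero, hd]
    exact lt_of_le_of_lt degree_le_natDegree (by exact_mod_cast hlt)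
  rw [euclidStep, monicPoly_coeffVec hmon hdeg]

theorem euclidRem_euclidStep {m : ℕ} (b s : ℝ) (y : PairCoeffs m) :
    euclidRem (euclidStep b s y) = C s * monicPoly y.2 := by
  have h1 : (euclidStep b s y).1 (Fin.last (m + 1)) = y.1 (Fin.last m) - b := by
    simp only [euclidStep, coeffVec, Fin.val_last, coeff_sub, coeff_X_sub_C_mul, coeff_C_mul,
      coeff_monicPoly]
    rw [if_neg (by omega), dif_pos (by omega), dif_neg (by omega), if_pos trivial, dif_neg (by omega),
      if_neg (by omega)]
    simp [Fin.last]
  rw [euclidRem, monicPoly_euclidStep, h1]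
  simp only [euclidStep, sub_sub_cancel]

theorem euclidLead_euclidStep {m : ℕ} (b s : ℝ) (y : PairCoeffs m) :
    euclidLead (euclidStep b s y) = s := by
  simp [euclidLead, euclidRem_euclidStep, coeff_monicPoly]

theorem euclidNext_euclidStep {m : ℕ} (b : ℝ) {s : ℝ} (hs : s ≠ 0) (y : PairCoeffs m) :
    euclidNext (euclidStep b s y) = y := by
  refine Prod.ext rfl (funext fun i => ?_)
  simp [euclidNext, euclidLead_euclidStep, euclidRem_euclidStep, coeff_monicPoly, hs]

/-- For fixed c, the top coefficient of p is c_m - b and the others are those of (X - b) c minus the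
remainder. Both changes are translations up to sign, so only the splitting of the remainder as s
times a monic polynomial contributes, by s^m. -/
theorem lintegral_euclidStep {m : ℕ} (c : Fin (m + 1) → ℝ) {f : (Fin (m + 2) → ℝ) → ℝ≥0∞}
    (hf : Measurable f) :
    ∫⁻ p in {p | 0 < euclidLead (p, c)}, f p =
      ∫⁻ b, ∫⁻ s in Set.Ioi (0 : ℝ), ENNReal.ofReal (s ^ m) *
        ∫⁻ d : Fin m → ℝ, f (euclidStep b s (c, d)).1 := by
  have hS : MeasurableSet {p : Fin (m + 2) → ℝ | 0 < euclidLead (p, c)} :=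
    measurableSet_lt measurable_const (measurable_euclidLead.comp (by fun_prop))
  rw [← lintegral_indicator hS, lintegral_fin_snoc (hf.indicator hS),
    ← lintegral_sub_left_eq_self _ (c (Fin.last m))]
  refine lintegral_congr fun b => ?_
  set base : Fin (m + 1) → ℝ := fun i => ((X - C b) * monicPoly c).coeff i with hbase
  rw [← lintegral_sub_left_eq_self _ base]
  have hlead : ∀ u : Fin (m + 1) → ℝ,
      euclidLead (m := m) (Fin.snoc (α := fun _ => ℝ) (base - u) (c (Fin.last m) - b), c) =
        u (Fin.last m) := by
    intro u
    have h1 : (monicPoly (Fin.snoc (α := fun _ => ℝ) (base - u) (c (Fin.last m) - b) :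
        Fin (m + 2) → ℝ)).coeff m = base (Fin.last m) - u (Fin.last m) := by
      rw [coeff_monicPoly, dif_pos (by omega)]
      exact Fin.snoc_castSucc (α := fun _ => ℝ) (c (Fin.last m) - b) (base - u) (Fin.last m)
    simp only [euclidLead, euclidRem, coeff_sub, h1, Fin.snoc_last, sub_sub_cancel]
    simp [hbase]
  have hmeas : Measurable fun u : Fin (m + 1) → ℝ =>
      f (Fin.snoc (α := fun _ => ℝ) (base - u) (c (Fin.last m) - b)) :=
    hf.comp (measurable_fin_snoc.comp (by fun_prop : Measurable fun u : Fin (m + 1) → ℝ =>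
      ((base - u, c (Fin.last m) - b) : (Fin (m + 1) → ℝ) × ℝ)))
  have h2 : ∀ u : Fin (m + 1) → ℝ, ({p : Fin (m + 2) → ℝ | 0 < euclidLead (p, c)}.indicator f)
      (Fin.snoc (α := fun _ => ℝ) (base - u) (c (Fin.last m) - b)) =
      {u : Fin (m + 1) → ℝ | 0 < u (Fin.last m)}.indicator (fun u =>
        f (Fin.snoc (α := fun _ => ℝ) (base - u) (c (Fin.last m) - b))) u := by
    intro u
    simp only [Set.indicator, Set.mem_ofPred_eq, hlead]
  simp_rw [h2]
  rw [lintegral_indicator (measurableSet_lt measurable_const (measurable_pi_apply _)),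
    lintegral_cone hmeas]
  refine lintegral_congr fun s => ?_
  congr 1
  refine lintegral_congr fun d => ?_
  congr 1
  ext i
  refine Fin.lastCases ?_ (fun i => ?_) i
  · rw [Fin.snoc_last]
    simp only [euclidStep, coeffVec, Fin.val_last, coeff_sub, coeff_X_sub_C_mul, coeff_C_mul,
      coeff_monicPoly]
    rw [if_neg (by omega), dif_pos (by omega), dif_neg (by omega), if_pos trivial, dif_neg (by omega),
      if_neg (by omega)]
    simp [Fin.last]
  · rw [Fin.snoc_castSucc]
    simp only [euclidStep, coeffVec, coeff_sub, coeff_C_mul, Fin.val_castSucc, Pi.sub_apply, hbase]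
    congr 1
    refine Fin.lastCases ?_ (fun i => ?_) i
    · simp [coeff_monicPoly]
    · simp [coeff_monicPoly]

/-! ### The law of the pair of characteristic polynomials -/

/-- Coefficient vectors of interlacing pairs. -/
def interlacingSet (m : ℕ) : Set (PairCoeffs m) :=
  {y | Interlaces m (monicPoly y.1) (monicPoly y.2)}

/-- The Euclidean step in one direction, `Interlaces.mul_sub` in the other. It gives measurability
by recursion and the limits of integration. -/
theorem mem_interlacingSet_succ {m : ℕ} (y : PairCoeffs (m + 1)) :
    y ∈ interlacingSet (m + 1) ↔ 0 < euclidLead y ∧ euclidNext y ∈ interlacingSet m := by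
  constructor
  · intro h
    obtain ⟨b, s, d, hs, hp, hd⟩ := Interlaces.euclid h
    have hy : y = euclidStep b s (y.2, coeffVec m d) := by
      refine Prod.ext ?_ rfl
      rw [← coeffVec_monicPoly y.1, hp]
      simp only [euclidStep]
      rw [monicPoly_coeffVec hd.monic_right hd.natDegree_right]
    rw [hy, euclidLead_euclidStep, euclidNext_euclidStep b hs.ne']
    refine ⟨hs, ?_⟩
    change Interlaces m (monicPoly y.2) (monicPoly (coeffVec m d))
    rwa [monicPoly_coeffVec hd.monic_right hd.natDegree_right]
  · rintro ⟨hs, hy⟩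
    -- The coefficients of index m + 1 and m + 2 cancel, by the choice of b and by monicity.
    have hrem : euclidRem y = C (euclidLead y) * monicPoly (euclidNext y).2 := by
      ext k
      rw [coeff_C_mul, coeff_monicPoly]
      split_ifs with h1 h2
      · simp only [euclidNext]
        field_simp
      · rw [h2, mul_one]; rfl
      · rw [mul_zero, euclidRem, coeff_sub, coeff_X_sub_C_mul, coeff_monicPoly, coeff_monicPoly,
          coeff_monicPoly]
        rcases Nat.lt_or_ge k (m + 2) with hk | hk
        · obtain rfl : k = m + 1 := by omega
          rw [if_neg (by omega), dif_pos (by omega), dif_neg (by omega), if_pos rfl,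
            dif_pos (by omega)]
          simp [Fin.last]
        · rw [if_neg (by omega), dif_neg (by omega), dif_neg (by omega), dif_neg (by omega),
            if_neg (by omega : ¬ k = m + 1)]
          by_cases hk2 : k = m + 2
          · rw [if_pos (by omega), if_pos (by omega)]; ring
          · rw [if_neg (by omega), if_neg (by omega)]; ring
    have := Interlaces.mul_sub (c := monicPoly y.2) (d := monicPoly (euclidNext y).2) hy
      (y.2 (Fin.last m) - y.1 (Fin.last (m + 1))) hs
    rw [← hrem, euclidRem, sub_sub_cancel] at this
    exact this

theorem measurableSet_interlacingSet (m : ℕ) : MeasurableSet (interlacingSet m) := by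
  induction m with
  | zero =>
    have : interlacingSet 0 = Set.univ := by
      ext y
      simp only [interlacingSet, Set.mem_ofPred_eq, Set.mem_univ, iff_true]
      exact interlaces_zero_iff.2 ⟨monic_monicPoly _, natDegree_monicPoly _, by simp [monicPoly]⟩
    rw [this]
    exact MeasurableSet.univ
  | succ m ih =>
    have : interlacingSet (m + 1) = {y | 0 < euclidLead y} ∩ euclidNext ⁻¹' interlacingSet m := by
      ext y
      exact mem_interlacingSet_succ y
    rw [this]
    exact (measurableSet_lt measurable_const measurable_euclidLead).inter
      (measurable_euclidNext ih)

/-- The absolute value of the resultant of an interlacing pair. -/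
def pairResultant : (m : ℕ) → PairCoeffs m → ℝ
  | 0, _ => 1
  -- At each of the m + 1 roots of c, the value of p is -s times that of the normalized remainder.
  | m + 1, y => euclidLead y ^ (m + 1) * pairResultant m (euclidNext y)

theorem measurable_pairResultant (m : ℕ) : Measurable (pairResultant m) := by
  induction m with
  | zero => exact measurable_const
  | succ m ih => exact (measurable_euclidLead.pow_const _).mul (ih.comp measurable_euclidNext)

/-- The coefficients of the two characteristic polynomials of a Jacobi matrix. -/
def jacobiCoeffs (m : ℕ) (x : (Fin m → ℝ) × (Fin (m + 1) → ℝ)) : PairCoeffs m :=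
  (coeffVec (m + 1) (jacobiPolys m x.1 x.2).1, coeffVec m (jacobiPolys m x.1 x.2).2)

theorem monicPoly_jacobiCoeffs {m : ℕ} {x : (Fin m → ℝ) × (Fin (m + 1) → ℝ)}
    (hx : ∀ j, 0 < x.1 j) :
    monicPoly (jacobiCoeffs m x).1 = (jacobiPolys m x.1 x.2).1 ∧
      monicPoly (jacobiCoeffs m x).2 = (jacobiPolys m x.1 x.2).2 := by
  have h := interlaces_jacobiPolys m x.1 x.2 hx
  exact ⟨monicPoly_coeffVec h.monic_left h.natDegree_left,
    monicPoly_coeffVec h.monic_right h.natDegree_right⟩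

/-- No positivity of a is assumed: the degrees do not depend on it, so the later identities hold for
all parameters. -/
theorem monic_jacobiPolys (m : ℕ) (a : Fin m → ℝ) (b : Fin (m + 1) → ℝ) :
    ((jacobiPolys m a b).1.Monic ∧ (jacobiPolys m a b).1.natDegree = m + 1) ∧
      (jacobiPolys m a b).2.Monic ∧ (jacobiPolys m a b).2.natDegree = m := by
  induction m with
  | zero => exact ⟨⟨monic_X_sub_C _, natDegree_X_sub_C _⟩, monic_one, natDegree_one⟩
  | succ m ih =>
    obtain ⟨⟨h1, h2⟩, h3, h4⟩ := ih (Fin.tail a) (Fin.tail b)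
    have h5 := monicPoly_euclidStep (b 0) (a 0 ^ 2) (m := m)
      (coeffVec (m + 1) (jacobiPolys m (Fin.tail a) (Fin.tail b)).1,
        coeffVec m (jacobiPolys m (Fin.tail a) (Fin.tail b)).2)
    simp only [monicPoly_coeffVec h1 h2, monicPoly_coeffVec h3 h4] at h5
    refine ⟨?_, h1, h2⟩
    rw [jacobiPolys, ← h5]
    exact ⟨monic_monicPoly _, natDegree_monicPoly _⟩

theorem jacobiCoeffs_succ {m : ℕ} (a0 b0 : ℝ) (a : Fin m → ℝ) (b : Fin (m + 1) → ℝ) :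
    jacobiCoeffs (m + 1) (Fin.cons a0 a, Fin.cons b0 b) =
      euclidStep b0 (a0 ^ 2) (jacobiCoeffs m (a, b)) := by
  obtain ⟨⟨h1, h2⟩, h3, h4⟩ := monic_jacobiPolys m a b
  simp only [jacobiCoeffs, jacobiPolys, euclidStep, Fin.tail_cons, Fin.cons_zero,
    monicPoly_coeffVec h1 h2, monicPoly_coeffVec h3 h4]

theorem pairResultant_jacobiCoeffs {m : ℕ} (a : Fin m → ℝ) (b : Fin (m + 1) → ℝ)
    (ha : ∀ j, 0 < a j) :
    pairResultant m (jacobiCoeffs m (a, b)) = ∏ j, a j ^ (2 * ((j.rev : ℕ) + 1)) := by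
  induction m with
  | zero => simp [pairResultant]
  | succ m ih =>
    rw [← Fin.cons_self_tail a, ← Fin.cons_self_tail b, jacobiCoeffs_succ, pairResultant,
      euclidLead_euclidStep, euclidNext_euclidStep _ (pow_pos (ha 0) 2).ne',
      ih (Fin.tail a) (Fin.tail b) fun j => ha _, Fin.prod_univ_succ]
    simp only [Fin.cons_zero, Fin.cons_succ, Fin.rev_zero, Fin.val_last, Fin.rev_succ,
      Fin.val_castSucc]
    rw [← pow_mul]

theorem measurable_jacobiCoeffs (m : ℕ) : Measurable (jacobiCoeffs m) := by
  induction m with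
  | zero =>
    refine Measurable.prodMk (measurable_pi_iff.2 fun i => ?_) (measurable_pi_iff.2 fun i => i.elim0)
    have : (i : ℕ) = 0 := by omega
    simp only [coeffVec, jacobiPolys, this, coeff_sub, coeff_X_zero, coeff_C_zero]
    fun_prop
  | succ m ih =>
    have h : jacobiCoeffs (m + 1) = (fun q : ℝ × ℝ × PairCoeffs m => euclidStep q.1 q.2.1 q.2.2) ∘
        fun x => (x.2 0, x.1 0 ^ 2, jacobiCoeffs m (Fin.tail x.1, Fin.tail x.2)) := by
      funext x
      conv_lhs => rw [← Prod.mk.eta (p := x), ← Fin.cons_self_tail x.1, ← Fin.cons_self_tail x.2,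
        jacobiCoeffs_succ]
      rfl
    rw [h]
    refine measurable_euclidStep.comp (Measurable.prodMk (by fun_prop) (Measurable.prodMk
      (by fun_prop) (ih.comp (Measurable.prodMk ?_ ?_))))
    · exact measurable_pi_iff.2 fun i => (measurable_pi_apply _).comp measurable_fst
    · exact measurable_pi_iff.2 fun i => (measurable_pi_apply _).comp measurable_snd

theorem image_jacobiCoeffs {m : ℕ} {y : PairCoeffs m} (hy : y ∈ interlacingSet m) :
    ∃ x : (Fin m → ℝ) × (Fin (m + 1) → ℝ), (∀ j, 0 < x.1 j) ∧ jacobiCoeffs m x = y := by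
  obtain ⟨a, b, ha, hab⟩ := Interlaces.exists_jacobiPolys hy
  refine ⟨(a, b), ha, ?_⟩
  simp only [jacobiCoeffs, hab, coeffVec_monicPoly]

theorem measurable_euclidStep_right {m : ℕ} (b s : ℝ) :
    Measurable (euclidStep (m := m) b s) := by
  have h : Measurable fun y : PairCoeffs m => ((b, s, y) : ℝ × ℝ × PairCoeffs m) := by fun_prop
  have := (measurable_euclidStep (m := m)).comp h
  exact this

theorem measurableSet_forall_pos (m : ℕ) : MeasurableSet {a : Fin m → ℝ | ∀ j, 0 < a j} := by
  rw [show {a : Fin m → ℝ | ∀ j, 0 < a j} = ⋂ j, {a | 0 < a j} by ext; simp]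
  exact MeasurableSet.iInter fun j => measurableSet_lt measurable_const (measurable_pi_apply j)

theorem indicator_eq_indicator {α β γ : Type*} [Zero γ] {S : Set α} {T : Set β} {f : α → γ}
    {g : β → γ} {a : α} {b : β} (h : a ∈ S ↔ b ∈ T) (hfg : a ∈ S → f a = g b) :
    S.indicator f a = T.indicator g b := by
  by_cases ha : a ∈ S
  · rw [Set.indicator_of_mem ha, Set.indicator_of_mem (h.1 ha), hfg ha]
  · rw [Set.indicator_of_notMem ha, Set.indicator_of_notMem fun hb => ha (h.2 hb)]

theorem indicator_eq_indicator_indicator {α β γ : Type*} [Zero γ] {S T : Set α} {A : Set β}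
    {f : α → γ} {k : β → α} {b : β} (h : k b ∈ S ↔ b ∈ A ∧ k b ∈ T) :
    S.indicator f (k b) = A.indicator (fun b => T.indicator f (k b)) b := by
  by_cases hb : b ∈ A
  · rw [Set.indicator_of_mem hb]
    exact indicator_eq_indicator (h.trans (and_iff_right hb)) fun _ => rfl
  · rw [Set.indicator_of_notMem hb, Set.indicator_of_notMem fun hk => hb (h.1 hk).1]

/-- Tonelli twice. It puts the integral over c inside those over b and s, where it joins the
integral over the next remainder and the induction hypothesis applies. -/
theorem lintegral_swap_three {α β γ : Type*} [MeasurableSpace α] [MeasurableSpace β]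
    [MeasurableSpace γ] (μ : Measure α) (ν : Measure β) (ρ : Measure γ) [SFinite μ] [SFinite ν]
    [SFinite ρ] {T : α → β → γ → ℝ≥0∞} (hT : Measurable fun q : (α × β) × γ => T q.1.1 q.1.2 q.2)
    {w : β → ℝ≥0∞} (hw : Measurable w) (hw' : ∀ s, w s ≠ ⊤) :
    ∫⁻ c, ∫⁻ b, ∫⁻ s, w s * T b s c ∂ν ∂μ ∂ρ = ∫⁻ s, w s * ∫⁻ b, ∫⁻ c, T b s c ∂ρ ∂μ ∂ν := by
  have h1 : Measurable fun q : (γ × α) × β => w q.2 * T q.1.2 q.2 q.1.1 := by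
    have h : Measurable fun q : (γ × α) × β => ((q.1.2, q.2), q.1.1) := by fun_prop
    exact (hw.comp measurable_snd).mul (hT.comp h)
  have h2 : Measurable fun q : (α × β) × γ => w q.1.2 * T q.1.1 q.1.2 q.2 := by
    have h : Measurable fun q : (α × β) × γ => q.1.2 := by fun_prop
    exact (hw.comp h).mul hT
  rw [lintegral_lintegral_swap h1.lintegral_prod_right'.aemeasurable]
  have h3 : ∀ b, ∫⁻ c, ∫⁻ s, w s * T b s c ∂ν ∂ρ = ∫⁻ s, ∫⁻ c, w s * T b s c ∂ρ ∂ν := by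
    intro b
    have h : Measurable fun q : γ × β => ((q.1, b), q.2) := by fun_prop
    exact lintegral_lintegral_swap (h1.comp h).aemeasurable
  simp_rw [h3]
  rw [lintegral_lintegral_swap h2.lintegral_prod_right'.aemeasurable]
  refine lintegral_congr fun s => ?_
  rw [← lintegral_const_mul' _ _ (hw' s)]
  exact lintegral_congr fun b => lintegral_const_mul' _ _ (hw' s)

theorem monicPoly_zero {R : Type*} [CommRing R] (v : Fin 0 → R) : monicPoly v = 1 := by
  simp [monicPoly]

theorem interlacingSet_zero : interlacingSet 0 = Set.univ := by
  ext y
  simp only [interlacingSet, Set.mem_ofPred_eq, Set.mem_univ, iff_true]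
  exact interlaces_zero_iff.2 ⟨monic_monicPoly _, natDegree_monicPoly _, by
    rw [monicPoly_zero]⟩

theorem lintegral_fin_zero (f : (Fin 0 → ℝ) → ℝ≥0∞) : ∫⁻ v, f v = f default := by
  rw [lintegral_unique]
  simp only [volume_pi, Measure.pi_univ, Finset.univ_eq_empty, Finset.prod_empty, mul_one]
  exact congrArg f (Subsingleton.elim _ _)

/-- The Jacobian weight of the map from Jacobi parameters to characteristic polynomials. -/
def jacobiJacobian {m : ℕ} (a : Fin m → ℝ) : ℝ := ∏ j, 2 * a j ^ (2 * (j.rev : ℕ) + 1)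

/-- The new factor is s^m ds at s = a0², namely 2 a0^(2m+1) da0. -/
theorem jacobiJacobian_cons {m : ℕ} (a0 : ℝ) (a : Fin m → ℝ) :
    jacobiJacobian (Fin.cons (α := fun _ => ℝ) a0 a) = 2 * a0 ^ (2 * m + 1) * jacobiJacobian a := by
  rw [jacobiJacobian, Fin.prod_univ_succ]
  simp [Fin.rev_succ, jacobiJacobian]

theorem measurable_jacobiJacobian {m : ℕ} : Measurable (jacobiJacobian (m := m)) := by
  unfold jacobiJacobian
  fun_prop

/-- Integration in the Jacobi parameters, in terms of the characteristic polynomials. -/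
theorem lintegral_jacobiCoeffs (m : ℕ) {g : PairCoeffs m → ℝ≥0∞} (hg : Measurable g) :
    ∫⁻ x : (Fin m → ℝ) × (Fin (m + 1) → ℝ), {a : Fin m → ℝ | ∀ j, 0 < a j}.indicator
      (fun a => ENNReal.ofReal (jacobiJacobian a) * g (jacobiCoeffs m (a, x.2))) x.1 =
      ∫⁻ y in interlacingSet m, g y := by
  induction m with
  | zero =>
    rw [interlacingSet_zero, Measure.restrict_univ, Measure.volume_eq_prod, Measure.volume_eq_prod,
      lintegral_prod_symm _ hg.aemeasurable, lintegral_prod]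
    -- The only coefficient of p = X - b is -b.
    · rw [lintegral_fin_zero, lintegral_fin_zero, ← lintegral_neg_eq_self]
      refine lintegral_congr fun b => ?_
      simp only [Set.indicator, Set.mem_ofPred_eq, IsEmpty.forall_iff, if_true, jacobiJacobian,
        Finset.univ_eq_empty, Finset.prod_empty, ENNReal.ofReal_one, one_mul]
      congr 1
      refine Prod.ext (funext fun i => ?_) (Subsingleton.elim _ _)
      have : i = 0 := Fin.eq_zero i
      subst this
      simp [jacobiCoeffs, coeffVec, jacobiPolys]
    · simp only [Set.indicator, Set.mem_ofPred_eq, IsEmpty.forall_iff, if_true]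
      exact ((measurable_jacobiJacobian.comp measurable_fst).ennreal_ofReal.mul
        (hg.comp (measurable_jacobiCoeffs 0))).aemeasurable
  | succ m ih =>
    set G : (Fin (m + 1) → ℝ) → (Fin (m + 2) → ℝ) → ℝ≥0∞ := fun a b =>
      {a : Fin (m + 1) → ℝ | ∀ j, 0 < a j}.indicator
        (fun a => ENNReal.ofReal (jacobiJacobian a) * g (jacobiCoeffs (m + 1) (a, b))) a with hG
    have hGm : Measurable (Function.uncurry G) := by
      have : Function.uncurry G = ({a : Fin (m + 1) → ℝ | ∀ j, 0 < a j} ×ˢ Set.univ).indicator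
          fun x => ENNReal.ofReal (jacobiJacobian x.1) * g (jacobiCoeffs (m + 1) x) := by
        ext ⟨a, b⟩
        simp only [Function.uncurry_apply_pair, hG]
        exact indicator_eq_indicator ⟨fun h => ⟨h, trivial⟩, fun h => h.1⟩ fun _ => rfl
      rw [this]
      exact ((measurable_jacobiJacobian.comp measurable_fst).ennreal_ofReal.mul
        (hg.comp (measurable_jacobiCoeffs _))).indicator
          ((measurableSet_forall_pos _).prod MeasurableSet.univ)
    have hK : ∀ b s : ℝ, Measurable fun y => g (euclidStep (m := m) b s y) := fun b s =>
      hg.comp (measurable_euclidStep_right b s)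
    set H : ℝ → ℝ → PairCoeffs m → ℝ≥0∞ := fun b s =>
      (interlacingSet m).indicator fun y => g (euclidStep b s y) with hH
    have hHm : Measurable fun q : ℝ × ℝ × PairCoeffs m => H q.1 q.2.1 q.2.2 := by
      have : (fun q : ℝ × ℝ × PairCoeffs m => H q.1 q.2.1 q.2.2) =
          ((fun q : ℝ × ℝ × PairCoeffs m => q.2.2) ⁻¹' interlacingSet m).indicator
            fun q => g (euclidStep q.1 q.2.1 q.2.2) := by
        ext q
        exact indicator_eq_indicator Iff.rfl fun _ => rfl
      rw [this]
      exact (hg.comp measurable_euclidStep).indicator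
        (measurableSet_preimage (by fun_prop) (measurableSet_interlacingSet m))
    have hR := measurableSet_interlacingSet m
    -- the left-hand side
    have hL : ∫⁻ x : (Fin (m + 1) → ℝ) × (Fin (m + 2) → ℝ), G x.1 x.2 =
        ∫⁻ s in Set.Ioi (0 : ℝ), ENNReal.ofReal (s ^ m) * ∫⁻ b, ∫⁻ y, H b s y := by
      have hm1 : Measurable fun a => ∫⁻ b, G a b := hGm.lintegral_prod_right'
      have h0 := lintegral_prod (μ := volume) (ν := volume) (Function.uncurry G) hGm.aemeasurable
      change ∫⁻ x, Function.uncurry G x ∂(volume.prod volume) = _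
      rw [h0]
      change ∫⁻ a, ∫⁻ b, G a b = _
      -- The variable s on the right becomes a0².
      rw [lintegral_fin_cons hm1, lintegral_sq_mul, ← lintegral_indicator measurableSet_Ioi]
      refine lintegral_congr fun a0 => ?_
      have h1 : ∀ a : Fin m → ℝ, ∫⁻ b, G (Fin.cons a0 a) b =
          ∫⁻ b0, ∫⁻ b, G (Fin.cons a0 a) (Fin.cons b0 b) := fun a =>
        lintegral_fin_cons (hGm.comp (by fun_prop : Measurable fun b : Fin (m + 2) → ℝ =>
          (((Fin.cons a0 a : Fin (m + 1) → ℝ), b) : (Fin (m + 1) → ℝ) × (Fin (m + 2) → ℝ))))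
      have hm2 : Measurable fun q : ((Fin m → ℝ) × ℝ) × (Fin (m + 1) → ℝ) =>
          G (Fin.cons a0 q.1.1) (Fin.cons q.1.2 q.2) :=
        hGm.comp ((measurable_fin_cons.comp (by fun_prop :
          Measurable fun q : ((Fin m → ℝ) × ℝ) × (Fin (m + 1) → ℝ) =>
            ((a0, q.1.1) : ℝ × (Fin m → ℝ)))).prodMk (measurable_fin_cons.comp (by fun_prop :
          Measurable fun q : ((Fin m → ℝ) × ℝ) × (Fin (m + 1) → ℝ) =>
            ((q.1.2, q.2) : ℝ × (Fin (m + 1) → ℝ)))))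
      simp_rw [h1]
      rw [lintegral_lintegral_swap (hm2.lintegral_prod_right').aemeasurable]
      by_cases ha0 : 0 < a0
      · rw [Set.indicator_of_mem (Set.mem_Ioi.2 ha0), ← mul_assoc,
          ← ENNReal.ofReal_mul (by positivity), ← lintegral_const_mul']
        · refine lintegral_congr fun b0 => ?_
          rw [lintegral_indicator hR, ← ih (hK b0 (a0 ^ 2)), ← lintegral_const_mul' _ _ (by simp),
            Measure.volume_eq_prod, lintegral_prod]
          · refine lintegral_congr fun a => lintegral_congr fun b => ?_
            simp only [hG, Set.indicator, Set.mem_ofPred_eq, Fin.forall_fin_succ, Fin.cons_zero,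
              Fin.cons_succ, ha0, true_and, jacobiCoeffs_succ, jacobiJacobian_cons]
            split_ifs
            · rw [← mul_assoc, ENNReal.ofReal_mul (by positivity)]
              congr 3
              ring
            · simp
          · refine Measurable.aemeasurable (Measurable.const_mul ?_ _)
            have : (fun x : (Fin m → ℝ) × (Fin (m + 1) → ℝ) =>
                {a : Fin m → ℝ | ∀ j, 0 < a j}.indicator (fun a =>
                  ENNReal.ofReal (jacobiJacobian a) *
                    g (euclidStep b0 (a0 ^ 2) (jacobiCoeffs m (a, x.2)))) x.1) =
                ({a : Fin m → ℝ | ∀ j, 0 < a j} ×ˢ Set.univ).indicator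
                  fun x => ENNReal.ofReal (jacobiJacobian x.1) *
                    g (euclidStep b0 (a0 ^ 2) (jacobiCoeffs m x)) := by
              ext ⟨a, b⟩
              exact indicator_eq_indicator ⟨fun h => ⟨h, trivial⟩, fun h => h.1⟩ fun _ => rfl
            rw [this]
            exact ((measurable_jacobiJacobian.comp measurable_fst).ennreal_ofReal.mul
              ((hK _ _).comp (measurable_jacobiCoeffs _))).indicator
                ((measurableSet_forall_pos _).prod MeasurableSet.univ)
        · simp
      · rw [Set.indicator_of_notMem (by simpa using ha0)]
        simp [hG, Set.indicator, Fin.forall_fin_succ, ha0]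
    -- the right-hand side
    have hT : Measurable fun q : (ℝ × ℝ) × (Fin (m + 1) → ℝ) => ∫⁻ d, H q.1.1 q.1.2 (q.2, d) :=
      (hHm.comp (by fun_prop : Measurable fun q : ((ℝ × ℝ) × (Fin (m + 1) → ℝ)) × (Fin m → ℝ) =>
        ((q.1.1.1, q.1.1.2, q.1.2, q.2) : ℝ × ℝ × PairCoeffs m))).lintegral_prod_right'
    have hRr : ∫⁻ y in interlacingSet (m + 1), g y =
        ∫⁻ c : Fin (m + 1) → ℝ, ∫⁻ b, ∫⁻ s in Set.Ioi (0 : ℝ), ENNReal.ofReal (s ^ m) *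
          ∫⁻ d : Fin m → ℝ, H b s (c, d) := by
      have hR1 := measurableSet_interlacingSet (m + 1)
      rw [← lintegral_indicator hR1, Measure.volume_eq_prod,
        lintegral_prod_symm _ (hg.indicator hR1).aemeasurable]
      refine lintegral_congr fun c => ?_
      have hfm : Measurable fun p : Fin (m + 2) → ℝ => (euclidNext ⁻¹' interlacingSet m).indicator g
          (p, c) := (hg.indicator (measurableSet_preimage measurable_euclidNext hR)).comp (by fun_prop)
      have hsplit : ∀ p : Fin (m + 2) → ℝ, (interlacingSet (m + 1)).indicator g (p, c) =
          {p | 0 < euclidLead (p, c)}.indicator (fun p =>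
            (euclidNext ⁻¹' interlacingSet m).indicator g (p, c)) p := by
        intro p
        exact indicator_eq_indicator_indicator (k := fun p => (p, c)) (mem_interlacingSet_succ _)
      have hA : MeasurableSet {p : Fin (m + 2) → ℝ | 0 < euclidLead (p, c)} := by
        have h : Measurable fun p : Fin (m + 2) → ℝ => ((p, c) : PairCoeffs (m + 1)) := by fun_prop
        exact measurableSet_lt measurable_const (measurable_euclidLead.comp h)
      simp_rw [hsplit]
      rw [lintegral_indicator hA, lintegral_euclidStep c hfm]
      refine lintegral_congr fun b => setLIntegral_congr_fun measurableSet_Ioi fun s hs => ?_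
      congr 1
      refine lintegral_congr fun d => ?_
      have : ((euclidStep b s (c, d)).1, c) = euclidStep b s (c, d) := rfl
      rw [this]
      refine indicator_eq_indicator ?_ fun _ => rfl
      rw [Set.mem_preimage, euclidNext_euclidStep b (ne_of_gt hs)]
    change ∫⁻ x : (Fin (m + 1) → ℝ) × (Fin (m + 2) → ℝ), G x.1 x.2 = _
    rw [hL, hRr]
    -- With c innermost, the integrals over c and d recombine into one over pairs.
    rw [lintegral_swap_three volume (volume.restrict (Set.Ioi 0)) volume
      (T := fun b s c => ∫⁻ d : Fin m → ℝ, H b s (c, d)) hT (w := fun s => ENNReal.ofReal (s ^ m))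
      (by fun_prop) (by simp)]
    refine lintegral_congr fun s => ?_
    congr 1
    refine lintegral_congr fun b => ?_
    have h : Measurable fun y : PairCoeffs m => ((b, s, y) : ℝ × ℝ × PairCoeffs m) := by fun_prop
    have hHy : Measurable (H b s) := by
      have := hHm.comp h
      exact this
    rw [Measure.volume_eq_prod, lintegral_prod _ hHy.aemeasurable]

/-! ### From the pair and the perturbation size to the perturbed polynomial -/

/-- The imaginary parts of the coefficients of the perturbed characteristic polynomial. -/
def perturbCoeffs {m : ℕ} (l : ℝ) (y : PairCoeffs m) : Fin (m + 1) → ℝ :=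
  coeffVec (m + 1) (C l * (monicPoly y.1 - X * monicPoly y.2))

/-- The leading terms of p and X c cancel, so m + 1 coefficients suffice; X c has no constant term,
so the lowest one is l p(0). -/
theorem perturbCoeffs_eq {m : ℕ} (l : ℝ) (y : PairCoeffs m) :
    perturbCoeffs l y = Fin.cons (α := fun _ => ℝ) (l * y.1 0) (l • (Fin.tail y.1 - y.2)) := by
  ext i
  refine Fin.cases ?_ (fun i => ?_) i
  · simp [perturbCoeffs, coeffVec, coeff_monicPoly]
  · rw [Fin.cons_succ]
    simp [perturbCoeffs, coeffVec, coeff_monicPoly, Fin.tail, Fin.succ]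

theorem measurable_perturbCoeffs {m : ℕ} :
    Measurable fun q : ℝ × PairCoeffs m => perturbCoeffs q.1 q.2 := by
  simp only [perturbCoeffs_eq]
  refine measurable_fin_cons.comp (Measurable.prodMk (by fun_prop) ?_)
  refine measurable_pi_iff.2 fun i => ?_
  simp only [Pi.smul_apply, Pi.sub_apply, Fin.tail]
  fun_prop

/-- The constant coefficient p(0) l contributes |p(0)| dl; the other m coefficients are l times a
reflected translate of c and contribute l^m. -/
theorem lintegral_perturbCoeffs_left {m : ℕ} (p : Fin (m + 1) → ℝ) (hp : p 0 ≠ 0)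
    {f : (Fin (m + 1) → ℝ) → ℝ≥0∞} (hf : Measurable f) :
    ∫⁻ h in {h : Fin (m + 1) → ℝ | 0 < h 0 / p 0}, f h =
      ∫⁻ l in Set.Ioi (0 : ℝ), ENNReal.ofReal (|p 0| * l ^ m) *
        ∫⁻ c : Fin m → ℝ, f (perturbCoeffs l (p, c)) := by
  have hS : MeasurableSet {h : Fin (m + 1) → ℝ | 0 < h 0 / p 0} :=
    measurableSet_lt measurable_const (by fun_prop)
  rw [← lintegral_indicator hS, lintegral_fin_cons (hf.indicator hS),
    lintegral_mul_left_real _ hp, ← lintegral_const_mul' _ _ (by simp),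
    ← lintegral_indicator measurableSet_Ioi]
  refine lintegral_congr fun l => ?_
  have hmem : ∀ w : Fin m → ℝ, (Fin.cons (α := fun _ => ℝ) (p 0 * l) w : Fin (m + 1) → ℝ) ∈
      {h : Fin (m + 1) → ℝ | 0 < h 0 / p 0} ↔ 0 < l := by
    intro w
    simp only [Set.mem_ofPred_eq, Fin.cons_zero]
    rw [mul_div_cancel_left₀ _ hp]
  by_cases hl : 0 < l
  · rw [Set.indicator_of_mem (Set.mem_Ioi.2 hl), ENNReal.ofReal_mul (abs_nonneg _), mul_assoc]
    congr 1
    simp only [Set.indicator, hmem, hl, if_true]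
    rw [lintegral_smul_fin (fun w => f (Fin.cons (α := fun _ => ℝ) (p 0 * l) w)) hl.ne',
      abs_of_pos hl, ← lintegral_sub_left_eq_self _ (Fin.tail p)]
    congr 1
    refine lintegral_congr fun c => ?_
    rw [perturbCoeffs_eq, mul_comm]
  · rw [Set.indicator_of_notMem (by simpa using hl)]
    simp only [Set.indicator, hmem, hl, if_false]
    simp

/-- The second member of the pair, recovered from the perturbed polynomial. -/
def companionCoeffs {m : ℕ} (q : (Fin (m + 1) → ℝ) × (Fin (m + 1) → ℝ)) : Fin m → ℝ :=
  fun i => q.1 i.succ - q.2 i.succ / (q.2 0 / q.1 0)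

theorem measurable_companionCoeffs {m : ℕ} : Measurable (companionCoeffs (m := m)) := by
  unfold companionCoeffs
  fun_prop

theorem perturbCoeffs_zero_div {m : ℕ} {y : PairCoeffs m} (hp : y.1 0 ≠ 0) (l : ℝ) :
    perturbCoeffs l y 0 / y.1 0 = l := by
  rw [perturbCoeffs_eq, Fin.cons_zero, mul_div_cancel_right₀ _ hp]

theorem companionCoeffs_perturbCoeffs {m : ℕ} {y : PairCoeffs m} (hp : y.1 0 ≠ 0) {l : ℝ}
    (hl : l ≠ 0) : companionCoeffs (y.1, perturbCoeffs l y) = y.2 := by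
  ext i
  simp only [companionCoeffs, perturbCoeffs_zero_div hp]
  simp only [perturbCoeffs_eq, Fin.cons_succ, Pi.smul_apply, Pi.sub_apply, Fin.tail, smul_eq_mul]
  rw [mul_div_cancel_left₀ _ hl, sub_sub_cancel]

/-- Real and imaginary parts of the coefficients of perturbed characteristic polynomials. -/
def perturbedSet (m : ℕ) : Set ((Fin (m + 1) → ℝ) × (Fin (m + 1) → ℝ)) :=
  {q | 0 < q.2 0 / q.1 0 ∧ (q.1, companionCoeffs q) ∈ interlacingSet m}

theorem measurableSet_perturbedSet (m : ℕ) : MeasurableSet (perturbedSet m) := by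
  have h1 : MeasurableSet {q : (Fin (m + 1) → ℝ) × (Fin (m + 1) → ℝ) | 0 < q.2 0 / q.1 0} :=
    measurableSet_lt measurable_const (by fun_prop)
  exact h1.inter (measurableSet_preimage (measurable_fst.prodMk measurable_companionCoeffs)
    (measurableSet_interlacingSet m))

/-- The perturbation size is recovered as h(0) / p(0), so p(0) = 0 has to be discarded. -/
theorem ae_apply_zero_ne_zero (m : ℕ) : ∀ᵐ p : Fin (m + 1) → ℝ, p 0 ≠ 0 := by
  have h : MeasurableSet {p : Fin (m + 1) → ℝ | p 0 ≠ 0}ᶜ :=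
    (measurableSet_eq_fun (measurable_pi_apply 0) measurable_const).compl.compl
  rw [ae_iff]
  change volume {p : Fin (m + 1) → ℝ | ¬ p 0 ≠ 0} = 0
  have h1 : MeasurableSet {p : Fin (m + 1) → ℝ | ¬ p 0 ≠ 0} := h
  rw [← lintegral_indicator_one h1, lintegral_fin_cons (measurable_one.indicator h1),
    lintegral_congr_ae (g := fun _ => 0), lintegral_zero]
  have h0 : ∀ᵐ x : ℝ, x ≠ 0 := by simp [ae_iff]
  filter_upwards [h0] with x hx
  simp [Set.indicator, hx]

theorem lintegral_perturbCoeffs {m : ℕ}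
    {k : (Fin (m + 1) → ℝ) × (Fin (m + 1) → ℝ) → ℝ≥0∞} (hk : Measurable k) :
    ∫⁻ y in interlacingSet m, ∫⁻ l in Set.Ioi (0 : ℝ), ENNReal.ofReal (|y.1 0| * l ^ m) *
      k (y.1, perturbCoeffs l y) = ∫⁻ q in perturbedSet m, k q := by
  have hR := measurableSet_interlacingSet m
  have hm1 : Measurable fun q : PairCoeffs m × ℝ => ENNReal.ofReal (|q.1.1 0| * q.2 ^ m) *
      k (q.1.1, perturbCoeffs q.2 q.1) := by
    have h1 : Measurable fun q : PairCoeffs m × ℝ => ENNReal.ofReal (|q.1.1 0| * q.2 ^ m) := by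
      fun_prop
    have h2 : Measurable fun q : PairCoeffs m × ℝ => perturbCoeffs q.2 q.1 := by
      have := (measurable_perturbCoeffs (m := m)).comp measurable_swap
      exact this
    have h3 : Measurable fun q : PairCoeffs m × ℝ => q.1.1 := by fun_prop
    exact h1.mul (hk.comp (h3.prodMk h2))
  have hm2 : Measurable fun q : PairCoeffs m × ℝ => (interlacingSet m).indicator (fun y =>
      ENNReal.ofReal (|y.1 0| * q.2 ^ m) * k (y.1, perturbCoeffs q.2 y)) q.1 := by
    have : (fun q : PairCoeffs m × ℝ => (interlacingSet m).indicator (fun y =>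
      ENNReal.ofReal (|y.1 0| * q.2 ^ m) * k (y.1, perturbCoeffs q.2 y)) q.1) =
      (Prod.fst ⁻¹' interlacingSet m).indicator fun q : PairCoeffs m × ℝ =>
        ENNReal.ofReal (|q.1.1 0| * q.2 ^ m) * k (q.1.1, perturbCoeffs q.2 q.1) := by
      ext q
      exact indicator_eq_indicator Iff.rfl fun _ => rfl
    rw [this]
    exact hm1.indicator (measurableSet_preimage measurable_fst hR)
  have hL : ∫⁻ y in interlacingSet m, ∫⁻ l in Set.Ioi (0 : ℝ), ENNReal.ofReal (|y.1 0| * l ^ m) *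
      k (y.1, perturbCoeffs l y) = ∫⁻ y, ∫⁻ l in Set.Ioi (0 : ℝ), (interlacingSet m).indicator
        (fun y => ENNReal.ofReal (|y.1 0| * l ^ m) * k (y.1, perturbCoeffs l y)) y := by
    rw [← lintegral_indicator hR]
    refine lintegral_congr fun y => ?_
    by_cases hy : y ∈ interlacingSet m
    · simp [Set.indicator, hy]
    · simp [Set.indicator, hy]
  have hS := measurableSet_perturbedSet m
  rw [hL, Measure.volume_eq_prod, lintegral_prod _ (Measurable.lintegral_prod_right'
      (ν := volume.restrict (Set.Ioi 0)) hm2).aemeasurable, ← lintegral_indicator hS,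
    Measure.volume_eq_prod, lintegral_prod _ (hk.indicator hS).aemeasurable]
  refine lintegral_congr_ae ?_
  filter_upwards [ae_apply_zero_ne_zero m] with p hp
  have hfm : Measurable fun h : Fin (m + 1) → ℝ =>
      ((fun q : (Fin (m + 1) → ℝ) × (Fin (m + 1) → ℝ) => (q.1, companionCoeffs q)) ⁻¹'
        interlacingSet m).indicator k (p, h) :=
    (hk.indicator (measurableSet_preimage (measurable_fst.prodMk measurable_companionCoeffs)
      hR)).comp (by fun_prop)
  have hsplit : ∀ h : Fin (m + 1) → ℝ, (perturbedSet m).indicator k (p, h) =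
      {h : Fin (m + 1) → ℝ | 0 < h 0 / p 0}.indicator (fun h =>
        ((fun q : (Fin (m + 1) → ℝ) × (Fin (m + 1) → ℝ) => (q.1, companionCoeffs q)) ⁻¹'
        interlacingSet m).indicator k (p, h)) h := by
    intro h
    exact indicator_eq_indicator_indicator (k := fun h => (p, h)) Iff.rfl
  have hA : MeasurableSet {h : Fin (m + 1) → ℝ | 0 < h 0 / p 0} :=
    measurableSet_lt measurable_const (by fun_prop)
  simp_rw [hsplit]
  rw [lintegral_indicator hA,
    lintegral_perturbCoeffs_left p hp hfm, lintegral_lintegral_swap]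
  · refine setLIntegral_congr_fun measurableSet_Ioi fun l hl => ?_
    rw [← lintegral_const_mul' _ _ ENNReal.ofReal_ne_top]
    refine lintegral_congr fun c => ?_
    have := companionCoeffs_perturbCoeffs (y := ((p, c) : PairCoeffs m)) hp (ne_of_gt hl)
    by_cases hc : ((p, c) : PairCoeffs m) ∈ interlacingSet m
    · rw [Set.indicator_of_mem hc, Set.indicator_of_mem]
      rw [Set.mem_preimage, this]
      exact hc
    · rw [Set.indicator_of_notMem hc, Set.indicator_of_notMem, mul_zero]
      rw [Set.mem_preimage, this]
      exact hc
  · exact (hm2.comp (by fun_prop : Measurable fun q : (Fin m → ℝ) × ℝ =>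
      (((p, q.1), q.2) : PairCoeffs m × ℝ))).aemeasurable

/-! ### From roots to coefficients -/

/-- The lower coefficients of the monic polynomial with given roots. -/
def rootCoeffs {n : ℕ} (z : Fin n → ℂ) : Fin n → ℂ := coeffVec n (∏ j, (X - C (z j)))

/-- The roots of the monic polynomial with given lower coefficients. -/
def rootConfig {n : ℕ} (c : Fin n → ℂ) : Sym ℂ n :=
  ⟨(monicPoly c).roots, by
    rw [IsAlgClosed.card_roots_eq_natDegree, natDegree_monicPoly]⟩

/-- The square of the absolute value of the Vandermonde determinant. -/
def vandermondeSq {n : ℕ} (z : Fin n → ℂ) : ℝ :=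
  ∏ j, ∏ k ∈ Finset.univ.filter (fun k => j < k), ‖z j - z k‖ ^ 2

/-- Tuples whose real parts are strictly increasing. -/
def sortedTuples (n : ℕ) : Set (Fin n → ℂ) := {z | StrictMono fun i => (z i).re}

theorem monicPoly_rootCoeffs {n : ℕ} (z : Fin n → ℂ) :
    monicPoly (rootCoeffs z) = ∏ j, (X - C (z j)) :=
  monicPoly_coeffVec (monic_prod_X_sub_C _ _) (by
    rw [natDegree_finsetProd_X_sub_C_eq_card, Finset.card_univ, Fintype.card_fin])

theorem roots_prod_X_sub_C_univ {n : ℕ} (z : Fin n → ℂ) :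
    (∏ j, (X - C (z j))).roots = Finset.univ.val.map z := by
  rw [← roots_multiset_prod_X_sub_C (Finset.univ.val.map z), Multiset.map_map]
  rfl

theorem rootConfig_rootCoeffs {n : ℕ} (z : Fin n → ℂ) : rootConfig (rootCoeffs z) = toConfig z := by
  apply Subtype.ext
  change (monicPoly (rootCoeffs z)).roots = Finset.univ.val.map z
  rw [monicPoly_rootCoeffs, roots_prod_X_sub_C_univ]

theorem exists_rootCoeffs_eq {n : ℕ} (c : Fin n → ℂ) : ∃ z, rootCoeffs z = c := by
  obtain ⟨l, hl⟩ := Quot.exists_rep (monicPoly c).roots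
  have hlen : l.length = n := by
    have := IsAlgClosed.card_roots_eq_natDegree (p := monicPoly c)
    rw [natDegree_monicPoly, ← hl] at this
    exact this
  subst hlen
  refine ⟨fun i => l.get i, ?_⟩
  have h1 : ∏ j, (X - C (l.get j)) = monicPoly c := by
    have h2 := (IsAlgClosed.splits (monicPoly c)).eq_prod_roots_of_monic (monic_monicPoly c)
    rw [h2, ← hl, ← List.prod_ofFn]
    change _ = Multiset.prod (Multiset.map _ (l : Multiset ℂ))
    rw [Multiset.map_coe, Multiset.prod_coe]
    congr 1
    conv_rhs => rw [← List.ofFn_get l]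
    rw [List.map_ofFn]
    rfl
  rw [rootCoeffs, h1, coeffVec_monicPoly]

theorem rootConfig_injective {n : ℕ} : Function.Injective (rootConfig (n := n)) := by
  intro c d h
  have h1 : (monicPoly c).roots = (monicPoly d).roots := congrArg Subtype.val h
  rw [← coeffVec_monicPoly c, ← coeffVec_monicPoly d,
    (IsAlgClosed.splits (monicPoly c)).eq_prod_roots_of_monic (monic_monicPoly c), h1,
    ← (IsAlgClosed.splits (monicPoly d)).eq_prod_roots_of_monic (monic_monicPoly d)]

theorem range_eq_of_rootCoeffs_eq {n : ℕ} {z w : Fin n → ℂ} (h : rootCoeffs z = rootCoeffs w) :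
    Set.range z = Set.range w := by
  have h1 : ∏ j, (X - C (z j)) = ∏ j, (X - C (w j)) := by
    rw [← monicPoly_rootCoeffs, ← monicPoly_rootCoeffs, h]
  have key : ∀ {z w : Fin n → ℂ}, ∏ j, (X - C (z j)) = ∏ j, (X - C (w j)) →
      Set.range z ⊆ Set.range w := by
    rintro z w h _ ⟨i, rfl⟩
    have := congrArg (eval (z i)) h
    rw [eval_prod, eval_prod, Finset.prod_eq_zero (Finset.mem_univ i) (by simp)] at this
    obtain ⟨j, -, hj⟩ := Finset.prod_eq_zero_iff.1 this.symm
    refine ⟨j, ?_⟩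
    rw [eval_sub, eval_X, eval_C, sub_eq_zero] at hj
    exact hj.symm
  exact (key h1).antisymm (key h1.symm)

/-- The coefficients determine the set of roots, and increasing real parts determine its
enumeration. -/
theorem injOn_rootCoeffs (n : ℕ) : Set.InjOn (rootCoeffs (n := n)) (sortedTuples n) := by
  intro z hz w hw h
  have hr := range_eq_of_rootCoeffs_eq h
  have hre : (fun i => (z i).re) = fun i => (w i).re := by
    refine (StrictMono.range_inj hz hw).1 ?_
    have h1 : ∀ v : Fin n → ℂ, Set.range (fun i => (v i).re) = Complex.re '' Set.range v :=
      fun v => by rw [← Set.range_comp]; rfl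
    rw [h1, h1, hr]
  ext i
  obtain ⟨k, hk⟩ : z i ∈ Set.range w := hr ▸ ⟨i, rfl⟩
  have h2 : (w k).re = (w i).re := by rw [hk]; exact congrFun hre i
  have h3 : k = i := StrictMono.injective hw h2
  rw [← hk, h3]

theorem rootCoeffs_comp_perm {n : ℕ} (z : Fin n → ℂ) (σ : Equiv.Perm (Fin n)) :
    rootCoeffs (z ∘ σ) = rootCoeffs z := by
  rw [rootCoeffs, rootCoeffs]
  congr 1
  exact Equiv.prod_comp σ fun j => X - C (z j)

/-! ### The Jacobian of the map from roots to coefficients. -/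

theorem differentiable_rootCoeffs (n : ℕ) : Differentiable ℂ (rootCoeffs (n := n)) := by
  have key : ∀ (s : Finset (Fin n)) (k : ℕ),
      Differentiable ℂ fun z : Fin n → ℂ => (∏ j ∈ s, (X - C (z j))).coeff k := by
    intro s
    induction s using Finset.induction_on with
    | empty => intro k; simp
    | insert i s hi ih =>
      intro k
      simp only [Finset.prod_insert hi, coeff_X_sub_C_mul]
      refine Differentiable.sub ?_ (Differentiable.mul (by fun_prop) (ih k))
      split_ifs
      · exact differentiable_const _
      · exact ih _
  exact differentiable_pi.2 fun i => key Finset.univ (i : ℕ)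

/-- Differentiation in z, at fixed x, of x^n + ∑ c_i(z) x^i = ∏ (x - z_j). -/
theorem sum_fderiv_rootCoeffs {n : ℕ} (z h : Fin n → ℂ) (x : ℂ) :
    ∑ i, fderiv ℂ rootCoeffs z h i * x ^ (i : ℕ) =
      -∑ j, h j * ∏ k ∈ Finset.univ.erase j, (x - z k) := by
  have h1 : (fun z : Fin n → ℂ => x ^ n + ∑ i, rootCoeffs z i * x ^ (i : ℕ)) =
      fun z => ∏ j, (x - z j) := by
    funext z
    have := congrArg (eval x) (monicPoly_rootCoeffs z)
    rw [monicPoly, eval_add, eval_finsetSum, eval_prod] at this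
    simpa using this
  have hd : ∀ i, HasFDerivAt (fun z => rootCoeffs z i)
      ((ContinuousLinearMap.proj i).comp (fderiv ℂ rootCoeffs z)) z := fun i =>
    hasFDerivAt_pi'.1 (differentiable_rootCoeffs n z).hasFDerivAt i
  have h2 : HasFDerivAt (fun z : Fin n → ℂ => x ^ n + ∑ i, rootCoeffs z i * x ^ (i : ℕ))
      (∑ i : Fin n, x ^ (i : ℕ) • (ContinuousLinearMap.proj i).comp (fderiv ℂ rootCoeffs z)) z :=
    (HasFDerivAt.fun_sum fun i _ => (hd i).mul_const (x ^ (i : ℕ))).const_add _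
  have h3 : HasFDerivAt (fun z : Fin n → ℂ => ∏ j, (x - z j))
      (∑ j, (∏ k ∈ Finset.univ.erase j, (x - z k)) •
        (-(ContinuousLinearMap.proj j : (Fin n → ℂ) →L[ℂ] ℂ))) z :=
    HasFDerivAt.finsetProd fun j _ =>
      ((ContinuousLinearMap.proj (R := ℂ) (φ := fun _ : Fin n => ℂ) j).hasFDerivAt).const_sub x
  rw [h1] at h2
  have h4 := congrArg (fun f : (Fin n → ℂ) →L[ℂ] ℂ => f h) (h2.unique h3)
  simp only [sum_apply, smul_apply,
    ContinuousLinearMap.comp_apply, ContinuousLinearMap.proj_apply, neg_apply,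
    smul_eq_mul, mul_neg, Finset.sum_neg_distrib] at h4
  rw [Finset.sum_congr rfl fun i _ => mul_comm _ _, h4]
  congr 1
  exact Finset.sum_congr rfl fun i _ => mul_comm _ _

/-- Every unordered pair occurs twice on the left. This form is visibly invariant under
permutations. -/
theorem prod_erase_norm {n : ℕ} (z : Fin n → ℂ) :
    ∏ k, ∏ l ∈ Finset.univ.erase k, ‖z k - z l‖ = vandermondeSq z := by
  have h1 : ∀ k : Fin n, ∏ l ∈ Finset.univ.erase k, ‖z k - z l‖ =
      (∏ l ∈ Finset.univ.filter (fun l => l < k), ‖z k - z l‖) *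
        ∏ l ∈ Finset.univ.filter (fun l => k < l), ‖z k - z l‖ := by
    intro k
    rw [← Finset.prod_union]
    · refine Finset.prod_congr ?_ fun _ _ => rfl
      ext l
      simp only [Finset.mem_erase, Finset.mem_univ, and_true, Finset.mem_union, Finset.mem_filter,
        true_and]
      exact lt_or_lt_iff_ne.symm
    · rw [Finset.disjoint_left]
      intro l hl hl'
      simp only [Finset.mem_filter, Finset.mem_univ, true_and] at hl hl'
      exact lt_asymm hl hl'
  simp_rw [h1]
  rw [Finset.prod_mul_distrib, vandermondeSq]
  have h2 : ∏ k, ∏ l ∈ Finset.univ.filter (fun l => l < k), ‖z k - z l‖ =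
      ∏ k, ∏ l ∈ Finset.univ.filter (fun l => k < l), ‖z k - z l‖ := by
    rw [Finset.prod_comm' (t' := Finset.univ)
      (s' := fun l : Fin n => Finset.univ.filter (fun k => l < k)) (by simp)]
    exact Finset.prod_congr rfl fun k _ => Finset.prod_congr rfl fun l _ => norm_sub_rev _ _
  rw [h2, ← Finset.prod_mul_distrib]
  refine Finset.prod_congr rfl fun k _ => ?_
  rw [← Finset.prod_mul_distrib]
  exact Finset.prod_congr rfl fun l _ => (sq _).symm

/-- Taking x = z_k in the previous identity shows that the Vandermonde matrix times the derivative
is diagonal, with entries -∏_{l ≠ k} (z_k - z_l). In absolute values |V| |det| = |V|², and V ≠ 0 for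
distinct points. -/
theorem normSq_det_fderiv_rootCoeffs {n : ℕ} {z : Fin n → ℂ} (hz : Function.Injective z) :
    Complex.normSq (LinearMap.det (fderiv ℂ rootCoeffs z : (Fin n → ℂ) →ₗ[ℂ] (Fin n → ℂ))) =
      vandermondeSq z := by
  set D : (Fin n → ℂ) →ₗ[ℂ] (Fin n → ℂ) := (fderiv ℂ rootCoeffs z : (Fin n → ℂ) →ₗ[ℂ] (Fin n → ℂ))
  have h1 : Matrix.vandermonde z * LinearMap.toMatrix' D =
      Matrix.diagonal fun k => -∏ l ∈ Finset.univ.erase k, (z k - z l) := by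
    ext k j
    rw [Matrix.mul_apply, Matrix.diagonal_apply]
    have h2 := sum_fderiv_rootCoeffs z (Pi.single j 1) (z k)
    have h3 : ∑ i, Matrix.vandermonde z k i * LinearMap.toMatrix' D i j =
        ∑ i, fderiv ℂ rootCoeffs z (Pi.single j 1) i * z k ^ (i : ℕ) := by
      refine Finset.sum_congr rfl fun i _ => ?_
      rw [Matrix.vandermonde_apply, LinearMap.toMatrix'_apply, mul_comm]
      rfl
    rw [h3, h2, Finset.sum_eq_single j]
    · rw [Pi.single_eq_same, one_mul]
      split_ifs with hkj
      · rw [hkj]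
      · rw [Finset.prod_eq_zero (Finset.mem_erase.2 ⟨hkj, Finset.mem_univ k⟩) (sub_self _), neg_zero]
    · intro i _ hi
      rw [Pi.single_eq_of_ne hi, zero_mul]
    · simp
  have h2 := congrArg (fun M => ‖Matrix.det M‖) h1
  simp only [Matrix.det_mul, Matrix.det_diagonal, norm_mul, norm_prod, norm_neg,
    LinearMap.det_toMatrix'] at h2
  rw [prod_erase_norm, Matrix.det_vandermonde] at h2
  simp only [norm_prod] at h2
  have h3 : ∏ i : Fin n, ∏ j ∈ Finset.Ioi i, ‖z j - z i‖ =
      ∏ i : Fin n, ∏ j ∈ Finset.univ.filter (fun j => i < j), ‖z i - z j‖ := by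
    refine Finset.prod_congr rfl fun i _ => ?_
    rw [show Finset.univ.filter (fun j => i < j) = Finset.Ioi i by ext; simp]
    exact Finset.prod_congr rfl fun j _ => norm_sub_rev _ _
  have h4 : vandermondeSq z =
      (∏ i : Fin n, ∏ j ∈ Finset.univ.filter (fun j => i < j), ‖z i - z j‖) ^ 2 := by
    rw [vandermondeSq, ← Finset.prod_pow]
    exact Finset.prod_congr rfl fun i _ => Finset.prod_pow _ _ _
  have h5 : ∏ i : Fin n, ∏ j ∈ Finset.univ.filter (fun j => i < j), ‖z i - z j‖ ≠ 0 := by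
    refine Finset.prod_ne_zero_iff.2 fun i _ => Finset.prod_ne_zero_iff.2 fun j hj => ?_
    rw [Finset.mem_filter] at hj
    exact norm_ne_zero_iff.2 (sub_ne_zero.2 fun h => hj.2.ne (hz h))
  rw [h3, h4, sq] at h2
  rw [Complex.normSq_eq_norm_sq, mul_left_cancel₀ h5 h2, h4]

theorem measurableSet_sortedTuples (n : ℕ) : MeasurableSet (sortedTuples n) := by
  have : sortedTuples n = ⋂ i, ⋂ j, ⋂ _ : i < j, {z : Fin n → ℂ | (z i).re < (z j).re} := by
    ext z
    simp only [sortedTuples, Set.mem_ofPred_eq, Set.mem_iInter]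
    exact ⟨fun h i j hij => h hij, fun h i j hij => h i j hij⟩
  rw [this]
  exact MeasurableSet.iInter fun i => MeasurableSet.iInter fun j => MeasurableSet.iInter fun _ =>
    measurableSet_lt (by fun_prop) (by fun_prop)

/-- The real determinant of a complex linear map is the squared modulus of its complex determinant.
-/
theorem lintegral_rootCoeffs {n : ℕ} (g : (Fin n → ℂ) → ℝ≥0∞) :
    ∫⁻ c in rootCoeffs '' sortedTuples n, g c =
      ∫⁻ z in sortedTuples n, ENNReal.ofReal (vandermondeSq z) * g (rootCoeffs z) := by
  rw [lintegral_image_eq_lintegral_abs_det_fderiv_mul volume (measurableSet_sortedTuples n)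
    (f' := fun z => (fderiv ℂ rootCoeffs z).restrictScalars ℝ)
    (fun z _ => ((differentiable_rootCoeffs n z).hasFDerivAt.restrictScalars ℝ).hasFDerivWithinAt)
    (injOn_rootCoeffs n)]
  refine setLIntegral_congr_fun (measurableSet_sortedTuples n) fun z hz => ?_
  have hinj : Function.Injective z := fun i j hij => StrictMono.injective hz (by simp [hij])
  have h1 : ((fderiv ℂ rootCoeffs z).restrictScalars ℝ).det = vandermondeSq z := by
    rw [← normSq_det_fderiv_rootCoeffs hinj, ← Algebra.norm_complex_apply,
      ← LinearMap.det_restrictScalars]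
    rfl
  have h2 : 0 ≤ vandermondeSq z :=
    Finset.prod_nonneg fun _ _ => Finset.prod_nonneg fun _ _ => by positivity
  simp only [h1, abs_of_nonneg h2]

/-! ### Sorted tuples as a fundamental domain for permutations. -/

theorem volume_re_eq {n : ℕ} {i j : Fin n} (hij : i ≠ j) :
    volume {z : Fin n → ℂ | (z i).re = (z j).re} = 0 := by
  set f : (Fin n → ℂ) →ₗ[ℝ] ℝ :=
    Complex.reLm ∘ₗ (LinearMap.proj i) - Complex.reLm ∘ₗ (LinearMap.proj j) with hf
  have h1 : {z : Fin n → ℂ | (z i).re = (z j).re} = (LinearMap.ker f : Set (Fin n → ℂ)) := by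
    ext z
    simp [hf, sub_eq_zero]
  rw [h1]
  refine Measure.addHaar_submodule _ _ fun htop => ?_
  have : Pi.single i (1 : ℂ) ∈ LinearMap.ker f := by rw [htop]; trivial
  rw [LinearMap.mem_ker] at this
  simp [hf, Pi.single_eq_of_ne hij.symm] at this

/-- Tuples with distinct real parts. -/
def separatedTuples (n : ℕ) : Set (Fin n → ℂ) := {z | Function.Injective fun i => (z i).re}

theorem volume_compl_separatedTuples (n : ℕ) : volume (separatedTuples n)ᶜ = 0 := by
  have : (separatedTuples n)ᶜ ⊆ ⋃ i, ⋃ j, ⋃ _ : i ≠ j, {z : Fin n → ℂ | (z i).re = (z j).re} := by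
    intro z hz
    simp only [separatedTuples, Set.mem_compl_iff, Set.mem_ofPred_eq, Function.Injective] at hz
    push Not at hz
    obtain ⟨i, j, h1, h2⟩ := hz
    simp only [Set.mem_iUnion]
    exact ⟨i, j, h2, h1⟩
  refine measure_mono_null this ?_
  simp only [measure_iUnion_null_iff]
  exact fun i j hij => volume_re_eq hij

theorem exists_perm_sorted {n : ℕ} {z : Fin n → ℂ} (hz : z ∈ separatedTuples n) :
    ∃ σ : Equiv.Perm (Fin n), z ∘ σ ∈ sortedTuples n :=
  ⟨Tuple.sort fun i => (z i).re, (Tuple.monotone_sort fun i => (z i).re).strictMono_of_injective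
    (Function.Injective.comp hz (Equiv.injective _))⟩

/-- A polynomial missed by the sorted tuples has two roots with equal real part; such tuples form a
null set, and differentiable maps preserve null sets. -/
theorem volume_compl_image_rootCoeffs (n : ℕ) :
    volume (rootCoeffs '' sortedTuples n)ᶜ = 0 := by
  have h : (rootCoeffs '' sortedTuples n)ᶜ ⊆ rootCoeffs '' (separatedTuples n)ᶜ := by
    intro c hc
    obtain ⟨z, rfl⟩ := exists_rootCoeffs_eq c
    refine ⟨z, fun hz => hc ?_, rfl⟩
    obtain ⟨σ, hσ⟩ := exists_perm_sorted hz
    exact ⟨z ∘ σ, hσ, rootCoeffs_comp_perm z σ⟩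
  refine measure_mono_null h ?_
  exact addHaar_image_eq_zero_of_differentiableOn_of_addHaar_eq_zero volume
    ((differentiable_rootCoeffs n).restrictScalars ℝ).differentiableOn
    (volume_compl_separatedTuples n)

theorem restrict_image_rootCoeffs (n : ℕ) :
    (volume : Measure (Fin n → ℂ)).restrict (rootCoeffs '' sortedTuples n) = volume :=
  Measure.restrict_eq_self_of_ae_mem (by
    rw [ae_iff]
    exact volume_compl_image_rootCoeffs n)

theorem measurePreserving_comp_perm {n : ℕ} (σ : Equiv.Perm (Fin n)) :
    MeasurePreserving (fun z : Fin n → ℂ => z ∘ σ) := by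
  have := volume_measurePreserving_piCongrLeft (fun _ : Fin n => ℂ) σ.symm
  have heq : (fun z : Fin n → ℂ => z ∘ σ) =
      ⇑(MeasurableEquiv.piCongrLeft (fun _ : Fin n => ℂ) σ.symm) := by
    funext z i
    have h := Equiv.piCongrLeft_apply_apply (P := fun _ : Fin n => ℂ) σ.symm z (σ i)
    rw [Equiv.symm_apply_apply] at h
    exact h.symm
  rw [heq]
  exact this

/-- Almost every tuple is sorted by exactly one permutation, and permuting coordinates preserves
volume. -/
theorem lintegral_eq_factorial_mul {n : ℕ} {g : (Fin n → ℂ) → ℝ≥0∞} (hg : Measurable g)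
    (hsymm : ∀ (z : Fin n → ℂ) (σ : Equiv.Perm (Fin n)), g (z ∘ σ) = g z) :
    ∫⁻ z, g z = (n.factorial : ℝ≥0∞) * ∫⁻ z in sortedTuples n, g z := by
  have hT := measurableSet_sortedTuples n
  have h1 : ∀ᵐ z : Fin n → ℂ, g z =
      ∑ σ : Equiv.Perm (Fin n), (sortedTuples n).indicator g (z ∘ σ) := by
    have h2 : ∀ᵐ z : Fin n → ℂ, z ∈ separatedTuples n := by
      rw [ae_iff]
      exact volume_compl_separatedTuples n
    filter_upwards [h2] with z hz
    obtain ⟨σ, hσ⟩ := exists_perm_sorted hz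
    rw [Finset.sum_eq_single σ, Set.indicator_of_mem hσ, hsymm]
    · intro τ _ hτ
      refine Set.indicator_of_notMem (fun hτ' => hτ ?_) _
      have h3 := injOn_rootCoeffs n hτ' hσ (by rw [rootCoeffs_comp_perm, rootCoeffs_comp_perm])
      have hinj : Function.Injective z := fun i j hij => hz (by simp [hij])
      ext1 i
      exact hinj (congrFun h3 i)
    · simp
  rw [lintegral_congr_ae h1, lintegral_finsetSum]
  · have h4 : ∀ σ : Equiv.Perm (Fin n), ∫⁻ z, (sortedTuples n).indicator g (z ∘ σ) =
        ∫⁻ z in sortedTuples n, g z := fun σ => by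
      rw [(measurePreserving_comp_perm σ).lintegral_comp (hg.indicator hT), lintegral_indicator hT]
    simp_rw [h4]
    rw [Finset.sum_const, Finset.card_univ, Fintype.card_perm, Fintype.card_fin, nsmul_eq_mul]
  · exact fun σ _ => (hg.indicator hT).comp (measurePreserving_comp_perm σ).measurable

theorem measurable_rootCoeffs (n : ℕ) : Measurable (rootCoeffs (n := n)) :=
  (differentiable_rootCoeffs n).continuous.measurable

/-- On the image of the sorted tuples, the preimage of a set of configurations is the injective
continuous image of a Borel set, hence Borel by the Lusin–Souslin theorem; that image has full
measure. -/
theorem aemeasurable_rootConfig (n : ℕ) :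
    AEMeasurable (rootConfig (n := n)) (volume : Measure (Fin n → ℂ)) := by
  have hmeas : ∀ S : Set (Fin n → ℂ), MeasurableSet S →
      MeasurableSet (rootCoeffs '' (sortedTuples n ∩ S)) := fun S hS =>
    ((measurableSet_sortedTuples n).inter hS).image_of_continuousOn_injOn
      (differentiable_rootCoeffs n).continuous.continuousOn
      ((injOn_rootCoeffs n).mono Set.inter_subset_left)
  have hB : MeasurableSet (rootCoeffs '' sortedTuples n) := by
    simpa using hmeas Set.univ MeasurableSet.univ
  rw [← restrict_image_rootCoeffs n]
  refine aemeasurable_restrict_of_measurable_subtype hB fun A hA => ?_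
  have hA' : MeasurableSet (toConfig (n := n) ⁻¹' A) := hA
  refine ⟨_, hmeas _ hA', ?_⟩
  ext ⟨c, hc⟩
  obtain ⟨z, hz, rfl⟩ := hc
  constructor
  · rintro ⟨w, hw, hwz⟩
    have h1 : toConfig w ∈ A := hw.2
    change rootConfig (rootCoeffs z) ∈ A
    rw [← rootConfig_rootCoeffs] at h1
    have h2 : rootCoeffs w = rootCoeffs z := hwz
    rwa [← h2]
  · intro h
    refine ⟨z, ⟨hz, ?_⟩, rfl⟩
    change toConfig z ∈ A
    rw [← rootConfig_rootCoeffs]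
    exact h

theorem measurable_toConfig (n : ℕ) : Measurable (toConfig (n := n)) := fun _ hA => hA

theorem measurable_vandermondeSq (n : ℕ) : Measurable (vandermondeSq (n := n)) := by
  unfold vandermondeSq
  fun_prop

theorem vandermondeSq_comp_perm {n : ℕ} (z : Fin n → ℂ) (σ : Equiv.Perm (Fin n)) :
    vandermondeSq (z ∘ σ) = vandermondeSq z := by
  rw [← prod_erase_norm, ← prod_erase_norm]
  rw [← Equiv.prod_comp σ fun k => ∏ l ∈ Finset.univ.erase k, ‖z k - z l‖]
  refine Finset.prod_congr rfl fun k _ => ?_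
  refine Finset.prod_equiv σ (fun l => ?_) fun l _ => rfl
  simp

theorem toConfig_comp_perm {n : ℕ} (z : Fin n → ℂ) (σ : Equiv.Perm (Fin n)) :
    toConfig (z ∘ σ) = toConfig z := by
  rw [← rootConfig_rootCoeffs, ← rootConfig_rootCoeffs, rootCoeffs_comp_perm]

/-- The law of the roots of a random polynomial whose coefficients have a density. -/
theorem map_rootConfig_withDensity {n : ℕ} {ρ : (Fin n → ℂ) → ℝ≥0∞} (hρ : Measurable ρ) :
    (volume.withDensity ρ).map rootConfig =
      (volume.withDensity fun z : Fin n → ℂ => (n.factorial : ℝ≥0∞)⁻¹ *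
        (ENNReal.ofReal (vandermondeSq z) * ρ (rootCoeffs z))).map toConfig := by
  have hac : (volume.withDensity ρ) ≪ (volume : Measure (Fin n → ℂ)) :=
    withDensity_absolutelyContinuous _ _
  have hmeas : Measurable fun z : Fin n → ℂ =>
      ENNReal.ofReal (vandermondeSq z) * ρ (rootCoeffs z) :=
    (measurable_vandermondeSq n).ennreal_ofReal.mul (hρ.comp (measurable_rootCoeffs n))
  ext A hA
  have hA' : MeasurableSet (toConfig (n := n) ⁻¹' A) := hA
  have hnull := (aemeasurable_rootConfig n).nullMeasurableSet_preimage hA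
  rw [Measure.map_apply_of_aemeasurable ((aemeasurable_rootConfig n).mono_ac hac) hA,
    Measure.map_apply (measurable_toConfig n) hA, withDensity_apply _ hA',
    withDensity_apply₀ _ hnull, ← lintegral_indicator₀ hnull, ← lintegral_indicator hA',
    ← restrict_image_rootCoeffs n, lintegral_rootCoeffs, restrict_image_rootCoeffs]
  have hind : ∀ z : Fin n → ℂ, (toConfig ⁻¹' A).indicator (fun z => (n.factorial : ℝ≥0∞)⁻¹ *
      (ENNReal.ofReal (vandermondeSq z) * ρ (rootCoeffs z))) z = (n.factorial : ℝ≥0∞)⁻¹ *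
      (toConfig ⁻¹' A).indicator (fun z =>
        ENNReal.ofReal (vandermondeSq z) * ρ (rootCoeffs z)) z := by
    intro z
    by_cases hz : z ∈ toConfig ⁻¹' A
    · rw [Set.indicator_of_mem hz, Set.indicator_of_mem hz]
    · rw [Set.indicator_of_notMem hz, Set.indicator_of_notMem hz, mul_zero]
  simp_rw [hind]
  rw [lintegral_const_mul' _ _ (by simp [Nat.factorial_ne_zero]),
    lintegral_eq_factorial_mul (hmeas.indicator hA')]
  · rw [← mul_assoc, ENNReal.inv_mul_cancel (by simp [Nat.factorial_ne_zero]) (by simp), one_mul]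
    refine lintegral_congr fun z => ?_
    by_cases hz : z ∈ toConfig ⁻¹' A
    · rw [Set.indicator_of_mem hz, Set.indicator_of_mem]
      rwa [Set.mem_preimage, rootConfig_rootCoeffs]
    · rw [Set.indicator_of_notMem hz, Set.indicator_of_notMem, mul_zero]
      rwa [Set.mem_preimage, rootConfig_rootCoeffs]
  · intro z σ
    refine indicator_eq_indicator ?_ fun _ => ?_
    · rw [Set.mem_preimage, toConfig_comp_perm, Set.mem_preimage]
    · rw [vandermondeSq_comp_perm, rootCoeffs_comp_perm]

/-! ### The normalization -/

theorem lintegral_fin_prod {m : ℕ} {f : Fin m → ℝ → ℝ≥0∞} (hf : ∀ j, Measurable (f j)) :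
    ∫⁻ x : Fin m → ℝ, ∏ j, f j (x j) = ∏ j, ∫⁻ t, f j t := by
  induction m with
  | zero => rw [lintegral_fin_zero]; simp
  | succ m ih =>
    have hm : Measurable fun x : Fin (m + 1) → ℝ => ∏ j, f j (x j) :=
      Finset.measurable_fun_prod _ fun j _ => (hf j).comp (measurable_pi_apply j)
    rw [lintegral_fin_cons hm, Fin.prod_univ_succ]
    simp only [Fin.prod_univ_succ, Fin.cons_zero, Fin.cons_succ]
    have hm' : Measurable fun x : Fin m → ℝ => ∏ j : Fin m, f j.succ (x j) :=
      Finset.measurable_fun_prod _ fun j _ => (hf j.succ).comp (measurable_pi_apply j)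
    simp_rw [lintegral_const_mul _ hm', ih fun j => hf j.succ]
    rw [lintegral_mul_const _ (hf 0)]

theorem lintegral_rpow_mul_exp_neg_sq {s : ℝ} (hs : 0 < s) :
    ∫⁻ t, (Set.Ioi (0 : ℝ)).indicator
      (fun t => ENNReal.ofReal (t ^ (s - 1) * Real.exp (-t ^ 2))) t =
      ENNReal.ofReal (1 / 2 * Real.Gamma (s / 2)) := by
  rw [lintegral_indicator measurableSet_Ioi]
  have h1 := integral_rpow_mul_exp_neg_rpow (p := 2) (q := s - 1) (by norm_num) (by linarith)
  have h2 := integrableOn_rpow_mul_exp_neg_rpow (p := 2) (s := s - 1) (by linarith) (by norm_num)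
  rw [sub_add_cancel] at h1
  rw [← h1, ofReal_integral_eq_lintegral_ofReal h2]
  · refine lintegral_congr fun t => ?_
    rw [Real.rpow_two]
  · refine (ae_restrict_mem measurableSet_Ioi).mono fun t ht => ?_
    exact mul_nonneg (Real.rpow_nonneg (le_of_lt ht) _) (Real.exp_nonneg _)

theorem lintegral_exp_neg_half_sq :
    ∫⁻ t : ℝ, ENNReal.ofReal (Real.exp (-(1 / 2) * t ^ 2)) =
      ENNReal.ofReal ((2 * Real.pi) ^ (1 / 2 : ℝ)) := by
  rw [← ofReal_integral_eq_lintegral_ofReal (integrable_exp_neg_mul_sq (by norm_num))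
    (ae_of_all _ fun t => Real.exp_nonneg _), integral_gaussian, ← Real.sqrt_eq_rpow]
  congr 2
  ring

/-- The total mass of `coefficientMeasure`. -/
def totalMass (β : ℝ) (m : ℕ) : ℝ :=
  (∏ j : Fin m, 1 / 2 * Real.Gamma (β * ((j : ℕ) + 1) / 2)) *
    (2 * Real.pi) ^ (((m : ℝ) + 1) / 2)

theorem totalMass_pos {β : ℝ} (hβ : 0 < β) (m : ℕ) : 0 < totalMass β m := by
  refine mul_pos (Finset.prod_pos fun j _ => ?_) (by positivity)
  exact mul_pos (by norm_num) (Real.Gamma_pos_of_pos (by positivity))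

/-- The density is a product of one-variable Gamma and Gaussian densities; the reversal of the index
turns the exponents β (n - j) into β j. -/
theorem coefficientMeasure_univ {β : ℝ} (hβ : 0 < β) (m : ℕ) :
    coefficientMeasure β (m + 1) Set.univ = ENNReal.ofReal (totalMass β m) := by
  have hS : MeasurableSet {x : (Fin m → ℝ) × (Fin (m + 1) → ℝ) | ∀ j, 0 < x.1 j} :=
    measurable_fst (measurableSet_forall_pos m)
  set f : Fin m → ℝ → ℝ≥0∞ := fun j => (Set.Ioi (0 : ℝ)).indicator
    (fun t => ENNReal.ofReal (t ^ (β * ((j.rev : ℕ) + 1) - 1) * Real.exp (-t ^ 2))) with hf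
  set g : Fin (m + 1) → ℝ → ℝ≥0∞ :=
    fun _ t => ENNReal.ofReal (Real.exp (-(1 / 2) * t ^ 2)) with hg
  have hfm : ∀ j, Measurable (f j) := fun j =>
    Measurable.indicator (by fun_prop) measurableSet_Ioi
  have hgm : ∀ j, Measurable (g j) := fun j => by simp only [hg]; fun_prop
  have h1 : ∀ x : (Fin m → ℝ) × (Fin (m + 1) → ℝ),
      {x : (Fin m → ℝ) × (Fin (m + 1) → ℝ) | ∀ j, 0 < x.1 j}.indicator
        (fun x => ENNReal.ofReal (coefficientWeight β (m + 1) x)) x =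
      (∏ j, f j (x.1 j)) * ∏ i, g i (x.2 i) := by
    intro x
    by_cases hx : ∀ j, 0 < x.1 j
    · rw [Set.indicator_of_mem (by exact hx)]
      have h2 : ∀ j, f j (x.1 j) = ENNReal.ofReal
          (x.1 j ^ (β * ((j.rev : ℕ) + 1) - 1) * Real.exp (-x.1 j ^ 2)) := fun j =>
        Set.indicator_of_mem (by exact hx j) _
      simp_rw [h2]
      rw [← ENNReal.ofReal_prod_of_nonneg fun j _ =>
          mul_nonneg (Real.rpow_nonneg (hx j).le _) (Real.exp_nonneg _),
        ← ENNReal.ofReal_prod_of_nonneg fun j _ => Real.exp_nonneg _,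
        ← ENNReal.ofReal_mul (Finset.prod_nonneg fun j _ =>
          mul_nonneg (Real.rpow_nonneg (hx j).le _) (Real.exp_nonneg _)),
        Finset.prod_mul_distrib, mul_assoc, ← Real.exp_sum, ← Real.exp_sum, ← Real.exp_add,
        coefficientWeight]
      congr 2
      · refine Finset.prod_congr rfl fun j _ => ?_
        have hj : ((j.rev : ℕ) : ℝ) = (m : ℝ) - ((j : ℕ) + 1) := by
          rw [Fin.val_rev, Nat.cast_sub j.2]
          push_cast
          ring
        rw [hj]
        congr 2
        push_cast
        ring
      · rw [Finset.sum_neg_distrib, ← Finset.mul_sum]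
        have h : ∀ s t : ℝ, -s - 1 / 2 * t = -s + -(1 / 2) * t := fun s t => by ring
        exact congrArg Real.exp (h _ _)
    · rw [Set.indicator_of_notMem (by exact hx)]
      push Not at hx
      obtain ⟨j, hj⟩ := hx
      rw [Finset.prod_eq_zero (Finset.mem_univ j), zero_mul]
      exact Set.indicator_of_notMem (by simpa using hj) _
  have h3 : coefficientMeasure β (m + 1) Set.univ =
      ∫⁻ x : (Fin m → ℝ) × (Fin (m + 1) → ℝ), (∏ j, f j (x.1 j)) * ∏ i, g i (x.2 i) := by
    rw [coefficientMeasure, withDensity_apply _ MeasurableSet.univ, Measure.restrict_univ]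
    simp_rw [← h1]
    exact (lintegral_indicator hS _).symm
  have hfm' : Measurable fun a : Fin m → ℝ => ∏ j, f j (a j) :=
    Finset.measurable_fun_prod _ fun j _ => (hfm j).comp (measurable_pi_apply j)
  have hgm' : Measurable fun b : Fin (m + 1) → ℝ => ∏ j, g j (b j) :=
    Finset.measurable_fun_prod _ fun j _ => (hgm j).comp (measurable_pi_apply j)
  rw [h3, Measure.volume_eq_prod, lintegral_prod_mul hfm'.aemeasurable hgm'.aemeasurable,
    lintegral_fin_prod hfm, lintegral_fin_prod hgm]
  have h4 : ∀ j : Fin m, ∫⁻ t, f j t =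
      ENNReal.ofReal (1 / 2 * Real.Gamma (β * ((j.rev : ℕ) + 1) / 2)) := fun j =>
    lintegral_rpow_mul_exp_neg_sq (by positivity)
  have h5 : ∀ i, ∫⁻ t, g i t = ENNReal.ofReal ((2 * Real.pi) ^ (1 / 2 : ℝ)) := fun i =>
    lintegral_exp_neg_half_sq
  have h6 : ∀ j : Fin m, 0 ≤ 1 / 2 * Real.Gamma (β * ((j.rev : ℕ) + 1) / 2) := fun j =>
    mul_nonneg (by norm_num) (Real.Gamma_pos_of_pos (by positivity)).le
  simp_rw [h4, h5]
  rw [← ENNReal.ofReal_prod_of_nonneg fun j _ => h6 j,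
    ← ENNReal.ofReal_prod_of_nonneg fun j _ => by positivity,
    ← ENNReal.ofReal_mul (Finset.prod_nonneg fun j _ => h6 j), totalMass]
  congr 2
  · exact Equiv.prod_comp Fin.revPerm fun j : Fin m =>
      1 / 2 * Real.Gamma (β * ((j : ℕ) + 1) / 2)
  · rw [Finset.prod_const, Finset.card_univ, Fintype.card_fin, ← Real.rpow_natCast,
      ← Real.rpow_mul (by positivity)]
    congr 1
    push_cast
    ring

theorem prod_gamma_one_add {x : ℝ} (hx : 0 < x) (n : ℕ) :
    ∏ j ∈ Finset.Icc 1 n, Real.Gamma (1 + x * j) =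
      x ^ n * n.factorial * ∏ j ∈ Finset.Icc 1 n, Real.Gamma (x * j) := by
  induction n with
  | zero => simp
  | succ n ih =>
    rw [Finset.prod_Icc_succ_top (by omega), Finset.prod_Icc_succ_top (by omega), ih, add_comm 1,
      Real.Gamma_add_one (by positivity), Nat.factorial_succ]
    push_cast
    ring

theorem prod_Icc_one_eq {M : Type*} [CommMonoid M] (f : ℕ → M) (n : ℕ) :
    ∏ j ∈ Finset.Icc 1 n, f j = ∏ j : Fin n, f (j + 1) := by
  induction n with
  | zero => simp
  | succ n ih =>
    rw [Finset.prod_Icc_succ_top (by omega), ih, Fin.prod_univ_castSucc]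
    rfl

/-- Explains the constant: n! from forgetting the order, 2^m from the substitutions s = a²,
2^(n(β/2-1)) from the factors 2 l in `prod_norm_sub_conj`, and the mass of the ensemble. From Γ(1 +
x) = x Γ(x), the powers of β/2 and the last Gamma factor cancel against `cConst` and the
denominators. -/
theorem normConst_eq {β : ℝ} (hβ : 0 < β) (m : ℕ) :
    normConst β (m + 1) = (m + 1).factorial * 2 ^ m * 2 ^ (((m : ℝ) + 1) * (β / 2 - 1)) *
      totalMass β m := by
  have hg : 0 < Real.Gamma (β / 2) := Real.Gamma_pos_of_pos (by positivity)
  have h1 := prod_gamma_one_add (half_pos hβ) (m + 1)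
  have h2 : ∏ j ∈ Finset.Icc 1 (m + 1), Real.Gamma (β / 2 * j) =
      (∏ j : Fin m, Real.Gamma (β * ((j : ℕ) + 1) / 2)) *
        Real.Gamma (β * ((m + 1 : ℕ) : ℝ) / 2) := by
    rw [Finset.prod_Icc_succ_top (by omega), prod_Icc_one_eq]
    congr 1
    · refine Finset.prod_congr rfl fun j _ => ?_
      congr 1
      push_cast
      ring
    · congr 1
      ring
  have h3 : 0 < Real.Gamma (β * ((m + 1 : ℕ) : ℝ) / 2) := Real.Gamma_pos_of_pos (by positivity)
  have h4 : ∀ j : ℕ, Real.Gamma (1 + β * (j : ℝ) / 2) = Real.Gamma (1 + β / 2 * j) := fun j => by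
    congr 1; ring
  rw [normConst, gConst, cConst, totalMass, Finset.prod_div_distrib]
  simp_rw [h4]
  rw [h1, h2, Finset.prod_const, Nat.card_Icc, add_comm 1 (β / 2),
    Real.Gamma_add_one (by positivity), Finset.prod_mul_distrib, Finset.prod_const,
    Finset.card_univ, Fintype.card_fin]
  have h5 : (0 : ℝ) < β / 2 := by positivity
  simp only [Nat.add_sub_cancel, mul_pow]
  push_cast
  field_simp
  rw [← mul_pow]
  norm_num

/-! ### Resultants -/

/-- The product of the absolute values of `g` over the roots of `f`. -/
def rootProdNorm (f g : ℂ[X]) : ℝ := (f.roots.map fun x => ‖g.eval x‖).prod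

theorem rootProdNorm_eq {f g : ℂ[X]} (hg : g.Monic) :
    rootProdNorm f g = (f.roots.map fun x => (g.roots.map fun y => ‖x - y‖).prod).prod := by
  rw [rootProdNorm]
  congr 1
  refine Multiset.map_congr rfl fun x _ => ?_
  rw [(IsAlgClosed.splits g).eval_eq_prod_roots_of_monic hg]
  have := map_multiset_prod (normHom : ℂ →*₀ ℝ) (g.roots.map fun y => x - y)
  rw [Multiset.map_map] at this
  exact this

/-- For monic f and g both sides are the product of |x - y| over all pairs of roots, the modulus of
the resultant. -/
theorem rootProdNorm_comm {f g : ℂ[X]} (hf : f.Monic) (hg : g.Monic) :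
    rootProdNorm f g = rootProdNorm g f := by
  rw [rootProdNorm_eq hg, rootProdNorm_eq hf, Multiset.prod_map_prod_map]
  congr 1
  refine Multiset.map_congr rfl fun x _ => ?_
  congr 1
  exact Multiset.map_congr rfl fun y _ => norm_sub_rev _ _

/-- The resultant depends on g only modulo f; this is the rule for reducing it. -/
theorem rootProdNorm_eq_of_eval_eq {f g h : ℂ[X]} (s : ℂ)
    (H : ∀ x, f.eval x = 0 → g.eval x = s * h.eval x) :
    rootProdNorm f g = ‖s‖ ^ f.natDegree * rootProdNorm f h := by
  rw [rootProdNorm, rootProdNorm, ← IsAlgClosed.card_roots_eq_natDegree (p := f),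
    ← Multiset.prod_replicate, ← Multiset.map_const', ← Multiset.prod_map_mul]
  congr 1
  refine Multiset.map_congr rfl fun x hx => ?_
  rw [H x (isRoot_of_mem_roots hx), norm_mul]

/-- Modulo c the polynomial p is -a₁² d, and c has degree m + 1 in the inductive step; symmetry of
the resultant restores the order of the pair. -/
theorem rootProdNorm_jacobiPolys (m : ℕ) (a : Fin m → ℝ) (b : Fin (m + 1) → ℝ) :
    rootProdNorm ((jacobiPolys m a b).2.map (algebraMap ℝ ℂ))
      ((jacobiPolys m a b).1.map (algebraMap ℝ ℂ)) =
      ∏ j, a j ^ (2 * ((j.rev : ℕ) + 1)) := by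
  induction m with
  | zero => simp [rootProdNorm, jacobiPolys]
  | succ m ih =>
    obtain ⟨⟨h1, h2⟩, h3, h4⟩ := monic_jacobiPolys m (Fin.tail a) (Fin.tail b)
    have h5 : rootProdNorm ((jacobiPolys (m + 1) a b).2.map (algebraMap ℝ ℂ))
        ((jacobiPolys (m + 1) a b).1.map (algebraMap ℝ ℂ)) =
        ‖-((a 0 : ℂ) ^ 2)‖ ^ (m + 1) *
          rootProdNorm ((jacobiPolys m (Fin.tail a) (Fin.tail b)).1.map (algebraMap ℝ ℂ))
            ((jacobiPolys m (Fin.tail a) (Fin.tail b)).2.map (algebraMap ℝ ℂ)) := by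
      have h6 := rootProdNorm_eq_of_eval_eq
        (f := (jacobiPolys m (Fin.tail a) (Fin.tail b)).1.map (algebraMap ℝ ℂ))
        (g := (jacobiPolys (m + 1) a b).1.map (algebraMap ℝ ℂ))
        (h := (jacobiPolys m (Fin.tail a) (Fin.tail b)).2.map (algebraMap ℝ ℂ))
        (-((a 0 : ℂ) ^ 2)) ?_
      · rwa [natDegree_map, h2] at h6
      intro x hx
      simp only [jacobiPolys]
      rw [Polynomial.map_sub, Polynomial.map_mul, eval_sub, eval_mul, hx]
      simp
    rw [h5, rootProdNorm_comm (h1.map _) (h3.map _), ih, Fin.prod_univ_succ]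
    congr 1
    · rw [norm_neg, norm_pow, Complex.norm_real, Real.norm_eq_abs, sq_abs, ← pow_mul, Fin.rev_zero,
        Fin.val_last]
    · simp only [Fin.tail, Fin.rev_succ, Fin.val_castSucc]

theorem rootProdNorm_prod_X_sub_C {n : ℕ} (z : Fin n → ℂ) (g : ℂ[X]) :
    rootProdNorm (∏ j, (X - C (z j))) g = ∏ j, ‖g.eval (z j)‖ := by
  rw [rootProdNorm, roots_prod_X_sub_C_univ, Multiset.map_map]
  rfl

/-- The left side is the modulus of the resultant of χ and its conjugate polynomial p - i h. With s
= 1 + i l, at a root of χ the latter equals (2 i l / s) X c. The factor X contributes ∏ |z_j| = |s|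
|p(0)|, and c contributes |s|^m |Res(c, p)|, since χ = s p at the roots of c. All powers of |s|
cancel. -/
theorem prod_norm_sub_conj {m : ℕ} {p c : ℝ[X]} (hc : c.Monic) (hcd : c.natDegree = m)
    {l : ℝ} (hl : 0 < l) {z : Fin (m + 1) → ℂ}
    (hχ : ∏ j, (X - C (z j)) = p.map (algebraMap ℝ ℂ) +
      C Complex.I * (C l * (p - X * c)).map (algebraMap ℝ ℂ)) :
    ∏ j, ∏ k, ‖z j - (starRingEnd ℂ) (z k)‖ = (2 * l) ^ (m + 1) * |p.eval 0| *
      rootProdNorm (c.map (algebraMap ℝ ℂ)) (p.map (algebraMap ℝ ℂ)) := by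
  set s : ℂ := 1 + Complex.I * l with hs
  have hs0 : ‖s‖ ≠ 0 := by
    rw [norm_ne_zero_iff]
    intro h
    have := congrArg Complex.re h
    simp [hs] at this
  set P := p.map (algebraMap ℝ ℂ) with hP
  set Q := c.map (algebraMap ℝ ℂ) with hQ
  set K := ∏ j, (X - C (z j)) with hK
  have hKm : K.Monic := monic_prod_X_sub_C _ _
  have hKd : K.natDegree = m + 1 := by
    rw [hK, natDegree_finsetProd_X_sub_C_eq_card, Finset.card_univ, Fintype.card_fin]
  have hev : ∀ x, K.eval x = s * P.eval x - Complex.I * l * (x * Q.eval x) := fun x => by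
    rw [hχ]
    simp only [Polynomial.map_mul, Polynomial.map_sub, map_C, map_X, eval_add, eval_mul, eval_sub,
      eval_C, eval_X, hs, ← hP, ← hQ, Complex.coe_algebraMap]
    ring
  have hconj : ∏ k, (X - C ((starRingEnd ℂ) (z k))) = P - C Complex.I *
      (C l * (p - X * c)).map (algebraMap ℝ ℂ) := by
    have h1 := congrArg (Polynomial.map (starRingEnd ℂ)) hχ
    have h2 : (starRingEnd ℂ).comp (algebraMap ℝ ℂ) = algebraMap ℝ ℂ := by
      ext x; simp
    rw [hK, Polynomial.map_prod, Polynomial.map_add, Polynomial.map_mul, hP, Polynomial.map_map,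
      Polynomial.map_map, h2, map_C, Complex.conj_I] at h1
    simp only [Polynomial.map_sub, map_X, map_C] at h1
    rw [h1, C_neg]
    ring
  have h1 : ∏ j, ∏ k, ‖z j - (starRingEnd ℂ) (z k)‖ =
      rootProdNorm K (P - C Complex.I * (C l * (p - X * c)).map (algebraMap ℝ ℂ)) := by
    rw [← hconj, hK, rootProdNorm_prod_X_sub_C]
    refine Finset.prod_congr rfl fun j _ => ?_
    rw [eval_prod, norm_prod]
    simp
  -- At a root of K one has p = -i h, so p - i h = 2 p, while s p = i l x c.
  have h2 := rootProdNorm_eq_of_eval_eq (f := K) (h := X * Q) (2 * (Complex.I * l) / s)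
    (g := P - C Complex.I * (C l * (p - X * c)).map (algebraMap ℝ ℂ)) (fun x hx => by
      rw [hev] at hx
      have hs0' : s ≠ 0 := norm_ne_zero_iff.1 hs0
      simp only [Polynomial.map_mul, Polynomial.map_sub, map_C, map_X, eval_mul, eval_sub,
        eval_C, eval_X, ← hP, ← hQ, Complex.coe_algebraMap]
      field_simp
      linear_combination (2 - s) * hx - P.eval x * s * hs + x * Q.eval x * Complex.I * l * hs)
  have h3 : rootProdNorm K (X * Q) = (∏ j, ‖z j‖) * rootProdNorm K Q := by
    rw [hK, rootProdNorm_prod_X_sub_C, rootProdNorm_prod_X_sub_C, ← Finset.prod_mul_distrib]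
    refine Finset.prod_congr rfl fun j _ => ?_
    rw [eval_mul, eval_X, norm_mul]
  have h4 : ∏ j, ‖z j‖ = ‖s‖ * |p.eval 0| := by
    have h := hev 0
    rw [hK, eval_prod] at h
    have h' := congrArg norm h
    rw [norm_prod] at h'
    simp only [eval_sub, eval_X, eval_C, zero_sub, norm_neg, zero_mul, mul_zero, sub_zero,
      norm_mul] at h'
    rw [h', hP, ← Complex.ofReal_zero, eval_map_algebraMap_ofReal, Complex.norm_real,
      Real.norm_eq_abs]
  have h5 : rootProdNorm K Q = ‖s‖ ^ m * rootProdNorm Q P := by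
    rw [rootProdNorm_comm hKm (hc.map _), ← hcd, ← natDegree_map (algebraMap ℝ ℂ)]
    refine rootProdNorm_eq_of_eval_eq _ fun x hx => ?_
    rw [hev, hx]
    ring
  rw [h1, h2, h3, h4, h5, hKd, norm_div, norm_mul, norm_mul, Complex.norm_I, Complex.norm_real,
    Real.norm_of_nonneg hl.le, Complex.norm_ofNat, div_pow]
  field_simp
  ring

/-! ### Real and imaginary parts of the coefficients -/

/-- The real parts of the coefficients. -/
def reVec {n : ℕ} (c : Fin n → ℂ) : Fin n → ℝ := fun i => (c i).re

/-- The imaginary parts of the coefficients. -/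
def imVec {n : ℕ} (c : Fin n → ℂ) : Fin n → ℝ := fun i => (c i).im

/-- The polynomial of degree less than `n` with given coefficients. -/
def lowerPoly {n : ℕ} (v : Fin n → ℝ) : ℝ[X] := ∑ i, C (v i) * X ^ (i : ℕ)

theorem coeff_lowerPoly {n : ℕ} (v : Fin n → ℝ) (k : ℕ) :
    (lowerPoly v).coeff k = if h : k < n then v ⟨k, h⟩ else 0 := by
  rw [lowerPoly, finsetSum_coeff]
  simp only [coeff_C_mul, coeff_X_pow, mul_ite, mul_one, mul_zero]
  split_ifs with h
  · rw [Finset.sum_eq_single ⟨k, h⟩]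
    · simp
    · intro i _ hi
      rw [if_neg]
      rintro rfl
      exact hi rfl
    · simp
  · refine Finset.sum_eq_zero fun i _ => if_neg ?_
    have := i.2
    omega

theorem monicPoly_eq_re_add_im {n : ℕ} (c : Fin n → ℂ) :
    monicPoly c = (monicPoly (reVec c)).map (algebraMap ℝ ℂ) +
      C Complex.I * (lowerPoly (imVec c)).map (algebraMap ℝ ℂ) := by
  ext k
  rw [coeff_add, coeff_C_mul, coeff_map, coeff_map, coeff_monicPoly, coeff_monicPoly,
    coeff_lowerPoly]
  split_ifs with h h'
  · rw [reVec, imVec, mul_comm]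
    exact (Complex.re_add_im _).symm
  · simp
  · simp

theorem natDegree_lowerPoly {m : ℕ} (v : Fin (m + 1) → ℝ) : (lowerPoly v).natDegree < m + 1 := by
  rw [Nat.lt_succ_iff, natDegree_le_iff_coeff_eq_zero]
  intro k hk
  rw [coeff_lowerPoly, dif_neg (by omega)]

theorem coeffVec_lowerPoly {n : ℕ} (v : Fin n → ℝ) : coeffVec n (lowerPoly v) = v := by
  ext i
  rw [coeffVec, coeff_lowerPoly, dif_pos i.2]

theorem lowerPoly_coeffVec {n : ℕ} {p : ℝ[X]} (hp : ∀ k, n ≤ k → p.coeff k = 0) :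
    lowerPoly (coeffVec n p) = p := by
  ext k
  rw [coeff_lowerPoly]
  split_ifs with h
  · rfl
  · exact (hp k (by omega)).symm

theorem coeff_zero_monicPoly {R : Type*} [CommRing R] {m : ℕ} (v : Fin (m + 1) → R) :
    (monicPoly v).eval 0 = v 0 := by
  rw [← coeff_zero_eq_eval_zero, coeff_monicPoly, dif_pos (Nat.succ_pos m)]
  rfl

theorem re_coeff_X_sq_mul {n : ℕ} (z : Fin n → ℂ) (k : ℕ) :
    ((X ^ 2 * ∏ j, (X - C (z j))).coeff k).re =
      (X ^ 2 * monicPoly (reVec (rootCoeffs z))).coeff k := by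
  rw [← monicPoly_rootCoeffs, monicPoly_eq_re_add_im, coeff_X_pow_mul', coeff_X_pow_mul']
  split_ifs
  · simp
  · simp

/-- The coefficients of p are the real parts of ∓e₁ and ±e₂ of the z_j, and ∑_{j ≠ k} z_j z_k = 2
e₂. -/
theorem rootSquareSum_reVec {n : ℕ} (z : Fin n → ℂ) :
    rootSquareSum n (monicPoly (reVec (rootCoeffs z))) = (∑ j, (z j).re) ^ 2 -
      ∑ j, ∑ k ∈ Finset.univ.filter (fun k => k ≠ j), (z j * z k).re := by
  obtain ⟨h1, h2⟩ := coeff_prod_X_sub_C Finset.univ z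
  rw [Finset.card_univ, Fintype.card_fin] at h1 h2
  have h3 : ∑ j, ∑ k ∈ Finset.univ.filter (fun k => k ≠ j), z j * z k =
      2 * (X ^ 2 * ∏ j, (X - C (z j))).coeff n := by
    have h4 : ∀ j, ∑ k ∈ Finset.univ.filter (fun k => k ≠ j), z j * z k =
        z j * ∑ k, z k - z j ^ 2 := fun j => by
      rw [Finset.filter_ne', ← Finset.sum_erase_add _ _ (Finset.mem_univ j), mul_add,
        Finset.mul_sum]
      ring
    simp_rw [h4]
    rw [Finset.sum_sub_distrib, ← Finset.sum_mul, ← h2, rootSquareSum, h1]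
    ring
  have h5 := congrArg Complex.re h3
  have h6 := congrArg Complex.re h1
  rw [Complex.neg_re, Complex.re_sum, re_coeff_X_sq_mul] at h6
  simp only [Complex.re_sum] at h5
  rw [h5, rootSquareSum, h6, neg_sq, ← re_coeff_X_sq_mul]
  simp

/-- The constant coefficient of χ is ± ∏ z_j, with real part p(0). -/
theorem abs_re_prod {m : ℕ} (z : Fin (m + 1) → ℂ) :
    |(∏ j, z j).re| = |reVec (rootCoeffs z) 0| := by
  have h1 := coeff_zero_monicPoly (rootCoeffs z)
  rw [monicPoly_rootCoeffs, eval_prod] at h1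
  simp only [eval_sub, eval_X, eval_C, zero_sub] at h1
  rw [Finset.prod_neg] at h1
  rw [reVec, ← h1]
  rcases neg_one_pow_eq_or ℂ (Finset.univ : Finset (Fin (m + 1))).card with h | h <;> rw [h] <;> simp

/-! ### The density in terms of the coefficients -/

/-- Real and imaginary parts of complex coefficients. -/
def reIm {n : ℕ} (c : Fin n → ℂ) : (Fin n → ℝ) × (Fin n → ℝ) := (reVec c, imVec c)

/-- The density of the real and imaginary parts of the coefficients of the perturbed
characteristic polynomial. -/
def pairDensity (β : ℝ) (m : ℕ) (F : ℝ → ℝ) (q : (Fin (m + 1) → ℝ) × (Fin (m + 1) → ℝ)) : ℝ :=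
  (totalMass β m)⁻¹ * (2 ^ m)⁻¹ *
    pairResultant m (q.1, companionCoeffs q) ^ (β / 2 - 1) *
    Real.exp (-(1 / 2) * rootSquareSum (m + 1) (monicPoly q.1)) * F (q.2 0 / q.1 0) /
    (|q.1 0| * (q.2 0 / q.1 0) ^ m)

theorem lowerPoly_perturbCoeffs {m : ℕ} (l : ℝ) (y : PairCoeffs m) :
    lowerPoly (perturbCoeffs l y) = C l * (monicPoly y.1 - X * monicPoly y.2) := by
  refine lowerPoly_coeffVec fun k hk => ?_
  obtain ⟨k, rfl⟩ : ∃ j, k = j + 1 := ⟨k - 1, by omega⟩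
  rw [coeff_C_mul, coeff_sub, coeff_X_mul, coeff_monicPoly, coeff_monicPoly, dif_neg (by omega),
    dif_neg (by omega)]
  split_ifs <;> first | omega | simp

theorem perturbCoeffs_companionCoeffs {m : ℕ} {q : (Fin (m + 1) → ℝ) × (Fin (m + 1) → ℝ)}
    (hq : 0 < q.2 0 / q.1 0) : perturbCoeffs (q.2 0 / q.1 0) (q.1, companionCoeffs q) = q.2 := by
  have h0 : q.1 0 ≠ 0 := fun h => by simp [h] at hq
  rw [perturbCoeffs_eq]
  ext i
  refine Fin.cases ?_ (fun i => ?_) i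
  · rw [Fin.cons_zero, div_mul_cancel₀ _ h0]
  · rw [Fin.cons_succ]
    simp only [Pi.smul_apply, Pi.sub_apply, Fin.tail, companionCoeffs, smul_eq_mul, sub_sub_cancel]
    rw [mul_div_cancel₀ _ hq.ne']

theorem prod_X_sub_C_of_mem_perturbedSet {m : ℕ} {z : Fin (m + 1) → ℂ}
    {q : (Fin (m + 1) → ℝ) × (Fin (m + 1) → ℝ)} (hq : q = reIm (rootCoeffs z))
    (hmem : q ∈ perturbedSet m) :
    ∏ j, (X - C (z j)) = (monicPoly q.1).map (algebraMap ℝ ℂ) + C Complex.I *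
      (C (q.2 0 / q.1 0) * (monicPoly q.1 - X * monicPoly (companionCoeffs q))).map
        (algebraMap ℝ ℂ) := by
  have h := lowerPoly_perturbCoeffs (q.2 0 / q.1 0) (q.1, companionCoeffs q)
  rw [perturbCoeffs_companionCoeffs hmem.1] at h
  rw [← h, ← monicPoly_rootCoeffs, monicPoly_eq_re_add_im, hq]
  rfl

theorem mem_configurations_of_mem_perturbedSet {m : ℕ} {z : Fin (m + 1) → ℂ}
    {q : (Fin (m + 1) → ℝ) × (Fin (m + 1) → ℝ)} (hq : q = reIm (rootCoeffs z))
    (hmem : q ∈ perturbedSet m) :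
    (∀ j, (z j).im ≠ 0) ∧ argSum z < Real.pi / 2 ∧ Real.tan (argSum z) = q.2 0 / q.1 0 := by
  refine configuration_of_interlaces hmem.2 ?_ hmem.1 (prod_X_sub_C_of_mem_perturbedSet hq hmem)
  rw [coeff_zero_monicPoly]
  intro h
  have h' : q.1 0 = 0 := h
  have := hmem.1
  simp [h'] at this

theorem mem_perturbedSet_of_configuration {m : ℕ} {z : Fin (m + 1) → ℂ}
    {q : (Fin (m + 1) → ℝ) × (Fin (m + 1) → ℝ)} (hq : q = reIm (rootCoeffs z))
    (hz : ∀ j, (z j).im ≠ 0) (hsum : argSum z < Real.pi / 2) : q ∈ perturbedSet m := by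
  obtain ⟨h1, h2, c, h3, h4⟩ := exists_interlaces_of_configuration hz hsum (p := monicPoly q.1)
    (h := lowerPoly q.2) (monic_monicPoly _) (natDegree_monicPoly _) (natDegree_lowerPoly _) (by
      rw [← monicPoly_rootCoeffs, monicPoly_eq_re_add_im, hq]
      rfl)
  rw [coeff_zero_monicPoly] at h2
  have hc := monicPoly_coeffVec h3.monic_right h3.natDegree_right
  have h5 : q.2 = perturbCoeffs (Real.tan (argSum z)) (q.1, coeffVec m c) := by
    rw [← coeffVec_lowerPoly q.2, h4, perturbCoeffs, hc]
  have h6 : q = (q.1, perturbCoeffs (Real.tan (argSum z)) (q.1, coeffVec m c)) := by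
    rw [← h5]
  refine ⟨?_, ?_⟩
  · rw [h5, perturbCoeffs_zero_div (y := (q.1, coeffVec m c)) h2]
    exact h1
  · rw [h6, companionCoeffs_perturbCoeffs (y := (q.1, coeffVec m c)) h2 h1.ne']
    change Interlaces m (monicPoly q.1) (monicPoly (coeffVec m c))
    rwa [hc]

/-- An interlacing pair comes from Jacobi parameters, for which both quantities are the same product
of powers of a. -/
theorem pairResultant_eq {m : ℕ} {y : PairCoeffs m} (hy : y ∈ interlacingSet m) :
    0 < pairResultant m y ∧ pairResultant m y =
      rootProdNorm ((monicPoly y.2).map (algebraMap ℝ ℂ))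
        ((monicPoly y.1).map (algebraMap ℝ ℂ)) := by
  obtain ⟨⟨a, b⟩, ha, rfl⟩ := image_jacobiCoeffs hy
  obtain ⟨h1, h2⟩ := monicPoly_jacobiCoeffs ha
  rw [h1, h2, rootProdNorm_jacobiPolys, pairResultant_jacobiCoeffs _ _ ha]
  exact ⟨Finset.prod_pos fun j _ => pow_pos (ha j) _, rfl⟩

/-- Bookkeeping of exponents once ∏ |z_j - conj z_k| is replaced by (2 t)^n |p(0)| times the
resultant. -/
theorem vandermondeSq_mul_pairDensity {β : ℝ} (hβ : 0 < β) {m : ℕ} (F : ℝ → ℝ)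
    {z : Fin (m + 1) → ℂ} {q : (Fin (m + 1) → ℝ) × (Fin (m + 1) → ℝ)}
    (hq : q = reIm (rootCoeffs z)) (hmem : q ∈ perturbedSet m) :
    ((m + 1).factorial : ℝ)⁻¹ * (vandermondeSq z * pairDensity β m F q) =
      jointDensity β (m + 1) F z := by
  obtain ⟨-, -, htan⟩ := mem_configurations_of_mem_perturbedSet hq hmem
  have hχ := prod_X_sub_C_of_mem_perturbedSet hq hmem
  obtain ⟨ht, hI⟩ := hmem
  obtain ⟨hA, hA'⟩ := pairResultant_eq hI
  have hnorm := prod_norm_sub_conj (monic_monicPoly _) (natDegree_monicPoly _) ht hχ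
  have hexp := rootSquareSum_reVec z
  have habs := abs_re_prod z
  have h0 : q.1 0 ≠ 0 := fun h => by simp [h] at ht
  have hp0 : 0 < |q.1 0| := abs_pos.2 h0
  rw [coeff_zero_monicPoly] at hnorm
  change _ = _ * rootProdNorm ((monicPoly ((q.1, companionCoeffs q) : PairCoeffs m).2).map _)
    ((monicPoly ((q.1, companionCoeffs q) : PairCoeffs m).1).map _) at hnorm
  rw [← hA'] at hnorm
  have hq1 : reVec (rootCoeffs z) = q.1 := by rw [hq]; rfl
  rw [hq1] at hexp habs
  have hprod : ∏ j, ∏ k, ‖z j - (starRingEnd ℂ) (z k)‖ ^ (β / 2 - 1) =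
      (∏ j, ∏ k, ‖z j - (starRingEnd ℂ) (z k)‖) ^ (β / 2 - 1) := by
    rw [← Real.finsetProd_rpow _ _ fun j _ => Finset.prod_nonneg fun k _ => norm_nonneg _]
    exact Finset.prod_congr rfl fun j _ =>
      Real.finsetProd_rpow _ _ (fun k _ => norm_nonneg _) _
  rw [jointDensity, ← hexp, habs, hprod, hnorm, htan, normConst_eq hβ, pairDensity]
  change _ = _ * vandermondeSq z * _
  set t := q.2 0 / q.1 0 with htdef
  set A := pairResultant m (q.1, companionCoeffs q)
  set V := vandermondeSq z
  set E := Real.exp (-(1 / 2) * rootSquareSum (m + 1) (monicPoly q.1))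
  set x := |q.1 0|
  rw [Real.mul_rpow (by positivity) hA.le, Real.mul_rpow (by positivity) hp0.le,
    ← Real.rpow_natCast (2 * t), ← Real.rpow_mul (by positivity),
    Real.mul_rpow (by norm_num) ht.le]
  -- The exponents of t add up to 1 - n = -m, the inverse of the Jacobian factor t^m.
  have e1 : t ^ (((m + 1 : ℕ) : ℝ) * (β / 2 - 1)) * t ^ (1 - β * ((m + 1 : ℕ) : ℝ) / 2) =
      (t ^ m)⁻¹ := by
    rw [← Real.rpow_add ht, ← Real.rpow_natCast t m, ← Real.rpow_neg ht.le]
    congr 1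
    push_cast
    ring
  -- Likewise what remains of |p(0)| is the inverse of its Jacobian factor.
  have e2 : (1 / x ^ (β / 2)) * x ^ (β / 2 - 1) = x⁻¹ := by
    rw [Real.rpow_sub hp0, Real.rpow_one]
    have := (Real.rpow_pos_of_pos hp0 (β / 2)).ne'
    field_simp
  have e3 : (2 : ℝ) ^ (((m : ℝ) + 1) * (β / 2 - 1)) =
      2 ^ (((m + 1 : ℕ) : ℝ) * (β / 2 - 1)) := by push_cast; rfl
  rw [e3]
  set T := (2 : ℝ) ^ (((m + 1 : ℕ) : ℝ) * (β / 2 - 1)) with hT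
  have hT0 : T ≠ 0 := (Real.rpow_pos_of_pos (by norm_num) _).ne'
  have hM := (totalMass_pos hβ m).ne'
  have hfac : ((m + 1).factorial : ℝ) ≠ 0 := by positivity
  calc _ = (((m + 1).factorial : ℝ) * 2 ^ m * totalMass β m)⁻¹ * E * A ^ (β / 2 - 1) * V *
        x⁻¹ * (t ^ m)⁻¹ * F t := by
          field_simp
    _ = (((m + 1).factorial : ℝ) * 2 ^ m * T * totalMass β m)⁻¹ * T * E * A ^ (β / 2 - 1) * V *
        x⁻¹ * (t ^ m)⁻¹ * F t := by
          field_simp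
    _ = _ := by
          rw [← e1, ← e2]
          ring

/-! ### Integration against the ensemble -/

/-- The weight of the Gaussian ensemble in terms of the characteristic polynomials. -/
def interlacingDensity (β : ℝ) (m : ℕ) (y : PairCoeffs m) : ℝ :=
  (totalMass β m)⁻¹ * (2 ^ m)⁻¹ * pairResultant m y ^ (β / 2 - 1) *
    Real.exp (-(1 / 2) * rootSquareSum (m + 1) (monicPoly y.1))

theorem measurable_rootSquareSum_monicPoly {n : ℕ} :
    Measurable fun v : Fin n → ℝ => rootSquareSum n (monicPoly v) := by
  have h : ∀ k, Measurable fun v : Fin n → ℝ => (X ^ 2 * monicPoly v).coeff k := by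
    intro k
    simp only [coeff_X_pow_mul']
    split_ifs
    · exact measurable_coeff_monicPoly _
    · exact measurable_const
  exact ((h _).pow_const 2).sub ((h _).const_mul 2)

theorem measurable_interlacingDensity (β : ℝ) (m : ℕ) : Measurable (interlacingDensity β m) := by
  have h1 : Measurable fun y : PairCoeffs m => rootSquareSum (m + 1) (monicPoly y.1) :=
    measurable_rootSquareSum_monicPoly.comp measurable_fst
  exact (((measurable_pairResultant m).pow_const _).const_mul _).mul
    (Real.measurable_exp.comp (h1.const_mul _))

theorem measurable_coefficientWeight (β : ℝ) (n : ℕ) : Measurable (coefficientWeight β n) := by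
  unfold coefficientWeight
  fun_prop

/-- With r = n - j, j counted from 1, the exponent splits as β r - 1 = (2 r - 1) + 2 r (β/2 - 1):
one part for the Jacobian, one for the resultant. -/
theorem coefficientWeight_eq {β : ℝ} {m : ℕ} {x : (Fin m → ℝ) × (Fin (m + 1) → ℝ)}
    (hx : ∀ j, 0 < x.1 j) :
    coefficientWeight β (m + 1) x = (2 ^ m)⁻¹ * jacobiJacobian x.1 *
      pairResultant m (jacobiCoeffs m x) ^ (β / 2 - 1) *
        Real.exp (-(1 / 2) * rootSquareSum (m + 1) (monicPoly (jacobiCoeffs m x).1)) := by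
  rw [(monicPoly_jacobiCoeffs hx).1, rootSquareSum_jacobiPolys _ _ _ hx,
    pairResultant_jacobiCoeffs _ _ hx, coefficientWeight, jacobiJacobian, Finset.prod_mul_distrib,
    Finset.prod_const, Finset.card_univ, Fintype.card_fin,
    ← Real.finsetProd_rpow _ _ fun j _ => (pow_pos (hx j) _).le, ← mul_assoc,
    inv_mul_cancel₀ (by positivity), one_mul, ← Finset.prod_mul_distrib]
  congr 1
  · refine Finset.prod_congr rfl fun j _ => ?_
    have hj : ((j.rev : ℕ) : ℝ) = (m : ℝ) - ((j : ℕ) + 1) := by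
      rw [Fin.val_rev, Nat.cast_sub j.2]
      push_cast
      ring
    rw [← Real.rpow_natCast, ← Real.rpow_natCast (x.1 j), ← Real.rpow_mul (hx j).le,
      ← Real.rpow_add (hx j)]
    congr 1
    push_cast
    rw [hj]
    ring
  · have h : ∀ s t : ℝ, -s - 1 / 2 * t = -(1 / 2) * (2 * s + t) := fun s t => by ring
    exact congrArg Real.exp (h _ _)

theorem lintegral_coefficientMeasure {β : ℝ} (hβ : 0 < β) (m : ℕ) {g : PairCoeffs m → ℝ≥0∞}
    (hg : Measurable g) :
    ∫⁻ x, g (jacobiCoeffs m x) ∂((coefficientMeasure β (m + 1) Set.univ)⁻¹ •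
      coefficientMeasure β (m + 1)) =
      ∫⁻ y in interlacingSet m, ENNReal.ofReal (interlacingDensity β m y) * g y := by
  have hS : MeasurableSet {x : (Fin m → ℝ) × (Fin (m + 1) → ℝ) | ∀ j, 0 < x.1 j} :=
    measurableSet_preimage measurable_fst (measurableSet_forall_pos m)
  have hM := totalMass_pos hβ m
  have hgj : Measurable fun x => g (jacobiCoeffs m x) := hg.comp (measurable_jacobiCoeffs m)
  have hid : Measurable fun y => ENNReal.ofReal (interlacingDensity β m y) * g y :=
    (measurable_interlacingDensity β m).ennreal_ofReal.mul hg
  rw [← lintegral_jacobiCoeffs m hid,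
    lintegral_smul_measure, coefficientMeasure_univ hβ, coefficientMeasure,
    lintegral_withDensity_eq_lintegral_mul _
      (measurable_coefficientWeight β (m + 1)).ennreal_ofReal hgj, smul_eq_mul,
    ← ENNReal.ofReal_inv_of_pos hM, ← lintegral_const_mul' _ _ ENNReal.ofReal_ne_top]
  refine (lintegral_indicator hS _).symm.trans (lintegral_congr fun x => ?_)
  refine indicator_eq_indicator Iff.rfl fun hx => ?_
  have hx' : ∀ j, 0 < x.1 j := hx
  have hJ : 0 ≤ jacobiJacobian x.1 := Finset.prod_nonneg fun j _ => by
    have := hx' j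
    positivity
  rw [Pi.mul_apply, ← mul_assoc, ← mul_assoc, ← ENNReal.ofReal_mul (inv_nonneg.2 hM.le),
    ← ENNReal.ofReal_mul hJ, coefficientWeight_eq hx']
  congr 2
  rw [interlacingDensity]
  ring

/-- F may be nonzero outside S on a null set, so the restriction to S, later the support of ν, is
inserted explicitly. -/
theorem lintegral_withDensity_eq_of_null {F : ℝ → ℝ} (hF : Measurable F) {ν : Measure ℝ}
    (hν : ν = volume.withDensity fun x => ENNReal.ofReal (F x)) {S : Set ℝ} (hS : MeasurableSet S)
    (hνS : ν Sᶜ = 0) (hν0 : ν (Set.Ioi 0)ᶜ = 0) {f : ℝ → ℝ≥0∞} (hf : Measurable f) :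
    ∫⁻ l, f l ∂ν = ∫⁻ l in Set.Ioi 0, ENNReal.ofReal (F l) * S.indicator f l := by
  have h1 : ∫⁻ l, f l ∂ν = ∫⁻ l, (Set.Ioi 0).indicator (S.indicator f) l ∂ν := by
    refine lintegral_congr_ae ?_
    have h2 : ∀ᵐ l ∂ν, l ∈ S := by rw [ae_iff]; exact hνS
    have h3 : ∀ᵐ l ∂ν, l ∈ Set.Ioi (0 : ℝ) := by rw [ae_iff]; exact hν0
    filter_upwards [h2, h3] with l hl hl'
    rw [Set.indicator_of_mem hl', Set.indicator_of_mem hl]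
  rw [h1, hν, lintegral_withDensity_eq_lintegral_mul _ hF.ennreal_ofReal
    ((hf.indicator hS).indicator measurableSet_Ioi), ← lintegral_indicator measurableSet_Ioi]
  refine lintegral_congr fun l => ?_
  rw [Pi.mul_apply]
  by_cases hl : l ∈ Set.Ioi (0 : ℝ)
  · rw [Set.indicator_of_mem hl, Set.indicator_of_mem hl]
  · rw [Set.indicator_of_notMem hl, Set.indicator_of_notMem hl, mul_zero]

theorem measurable_ratio {m : ℕ} :
    Measurable fun q : (Fin (m + 1) → ℝ) × (Fin (m + 1) → ℝ) => q.2 0 / q.1 0 := by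
  fun_prop

theorem measurable_pairDensity (β : ℝ) (m : ℕ) {F : ℝ → ℝ} (hF : Measurable F) :
    Measurable (pairDensity β m F) := by
  have hyq : Measurable fun q : (Fin (m + 1) → ℝ) × (Fin (m + 1) → ℝ) =>
      (q.1, companionCoeffs q) := measurable_fst.prodMk measurable_companionCoeffs
  have h1 := (measurable_interlacingDensity β m).comp hyq
  have h2 := hF.comp (measurable_ratio (m := m))
  have h3 : Measurable fun q : (Fin (m + 1) → ℝ) × (Fin (m + 1) → ℝ) =>
    |q.1 0| * (q.2 0 / q.1 0) ^ m := by fun_prop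
  exact (h1.mul h2).div h3

/-- The law of the coefficients of the perturbed characteristic polynomial. -/
theorem lintegral_perturbation {β : ℝ} (hβ : 0 < β) (m : ℕ) {F : ℝ → ℝ} (hF : Measurable F)
    {ν : Measure ℝ} (hν : ν = volume.withDensity fun x => ENNReal.ofReal (F x)) [SFinite ν]
    {S : Set ℝ} (hS : MeasurableSet S)
    (hνS : ν Sᶜ = 0) (hν0 : ν (Set.Ioi 0)ᶜ = 0)
    {g : (Fin (m + 1) → ℝ) × (Fin (m + 1) → ℝ) → ℝ≥0∞} (hg : Measurable g) :
    ∫⁻ x, ∫⁻ l, g ((jacobiCoeffs m x).1, perturbCoeffs l (jacobiCoeffs m x)) ∂ν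
      ∂((coefficientMeasure β (m + 1) Set.univ)⁻¹ • coefficientMeasure β (m + 1)) =
      ∫⁻ q in perturbedSet m, {q | q.2 0 / q.1 0 ∈ S}.indicator
        (fun q => ENNReal.ofReal (pairDensity β m F q) * g q) q := by
  have hpc : Measurable fun q : PairCoeffs m × ℝ => (q.1.1, perturbCoeffs q.2 q.1) := by
    have h2 := (measurable_perturbCoeffs (m := m)).comp measurable_swap
    exact Measurable.prodMk (by fun_prop) h2
  have hgm : Measurable fun q : PairCoeffs m × ℝ => g (q.1.1, perturbCoeffs q.2 q.1) := hg.comp hpc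
  have hk : Measurable ({q : (Fin (m + 1) → ℝ) × (Fin (m + 1) → ℝ) |
      q.2 0 / q.1 0 ∈ S}.indicator (fun q => ENNReal.ofReal (pairDensity β m F q) * g q)) :=
    ((measurable_pairDensity β m hF).ennreal_ofReal.mul hg).indicator
      (measurableSet_preimage measurable_ratio hS)
  rw [lintegral_coefficientMeasure hβ m
    (g := fun y => ∫⁻ l, g (y.1, perturbCoeffs l y) ∂ν) hgm.lintegral_prod_right',
    ← lintegral_perturbCoeffs hk]
  -- Needed to cancel the Jacobian |p(0)| l^m against the denominator in `pairDensity`.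
  have hae : ∀ᵐ y : PairCoeffs m ∂volume.restrict (interlacingSet m), y.1 0 ≠ 0 :=
    ae_restrict_of_ae (Measure.quasiMeasurePreserving_fst.ae (ae_apply_zero_ne_zero m))
  refine lintegral_congr_ae ?_
  filter_upwards [hae, ae_restrict_mem (measurableSet_interlacingSet m)] with y hy hyI
  have hfm : Measurable fun l => g (y.1, perturbCoeffs l y) :=
    hgm.comp measurable_prodMk_left
  rw [lintegral_withDensity_eq_of_null hF hν hS hνS hν0 hfm,
    ← lintegral_const_mul' _ _ ENNReal.ofReal_ne_top]
  refine setLIntegral_congr_fun measurableSet_Ioi fun l hl => ?_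
  have hl' : 0 < l := hl
  have hdiv := perturbCoeffs_zero_div hy l
  by_cases hlS : l ∈ S
  · rw [Set.indicator_of_mem hlS, Set.indicator_of_mem (by simpa [hdiv] using hlS)]
    have hA := (pairResultant_eq hyI).1
    have hM := totalMass_pos hβ m
    have hid : 0 ≤ interlacingDensity β m y := by
      unfold interlacingDensity
      positivity
    rw [← mul_assoc, ← mul_assoc, ← ENNReal.ofReal_mul hid, ← ENNReal.ofReal_mul (by positivity)]
    congr 2
    simp only [pairDensity, companionCoeffs_perturbCoeffs hy hl'.ne', hdiv]
    rw [mul_div_cancel₀ _ (mul_ne_zero (abs_ne_zero.2 hy) (pow_ne_zero _ hl'.ne'))]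
    rfl
  · rw [Set.indicator_of_notMem hlS, Set.indicator_of_notMem (by simpa [hdiv] using hlS), mul_zero,
      mul_zero, mul_zero]

/-- The complex vector with given real and imaginary parts. -/
def ofReIm {n : ℕ} (q : (Fin n → ℝ) × (Fin n → ℝ)) : Fin n → ℂ := fun i => ⟨q.1 i, q.2 i⟩

theorem measurable_ofReIm {n : ℕ} : Measurable (ofReIm (n := n)) := by
  refine measurable_pi_iff.2 fun i => ?_
  have h : (fun q : (Fin n → ℝ) × (Fin n → ℝ) => ofReIm q i) =
      fun q => Complex.measurableEquivRealProd.symm (q.1 i, q.2 i) := rfl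
  rw [h]
  fun_prop

theorem measurePreserving_reIm (n : ℕ) :
    MeasurePreserving (reIm (n := n)) volume volume :=
  (volume_measurePreserving_arrowProdEquivProdArrow ℝ ℝ (Fin n)).comp
    (volume_preserving_pi fun _ : Fin n => Complex.volume_preserving_equiv_real_prod)

/-! ### The law of the eigenvalues -/

/-- The parameters of a Jacobi matrix. -/
def jacobiParams {m : ℕ} (M : Matrix (Fin (m + 1)) (Fin (m + 1)) ℝ) :
    (Fin m → ℝ) × (Fin (m + 1) → ℝ) :=
  (fun j => M j.castSucc j.succ, fun i => M i i)

theorem jacobiParams_jacobiMatrix {m : ℕ} (x : (Fin m → ℝ) × (Fin (m + 1) → ℝ)) :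
    jacobiParams (jacobiMatrix (n := m + 1) x.1 x.2) = x := by
  refine Prod.ext (funext fun j => ?_) (funext fun i => ?_)
  · simp [jacobiParams, jacobiMatrix, Fin.ext_iff]
  · simp [jacobiParams, jacobiMatrix]

theorem measurable_jacobiParams {m : ℕ} : Measurable (jacobiParams (m := m)) := by
  have h : ∀ i j, Measurable fun M : Matrix (Fin (m + 1)) (Fin (m + 1)) ℝ => M i j := fun i j =>
    (measurable_pi_apply j).comp (measurable_pi_apply (X := fun _ => Fin (m + 1) → ℝ) i)
  exact (measurable_pi_iff.2 fun j => h _ _).prodMk (measurable_pi_iff.2 fun i => h _ _)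

theorem measurable_jacobiMatrix {n : ℕ} :
    Measurable fun x : (Fin (n - 1) → ℝ) × (Fin n → ℝ) => jacobiMatrix x.1 x.2 := by
  refine measurable_pi_iff.2 fun i => measurable_pi_iff.2 fun j => ?_
  simp only [jacobiMatrix, Matrix.of_apply]
  split_ifs <;> fun_prop

/-- A random matrix with the law of the ensemble is tridiagonal only almost surely; measurability of
this event lets the property pass through the law. -/
theorem measurableSet_jacobiMatrix_jacobiParams (m : ℕ) :
    MeasurableSet {M : Matrix (Fin (m + 1)) (Fin (m + 1)) ℝ |
      jacobiMatrix (n := m + 1) (jacobiParams M).1 (jacobiParams M).2 = M} := by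
  have h : Measurable fun M : Matrix (Fin (m + 1)) (Fin (m + 1)) ℝ =>
      jacobiMatrix (n := m + 1) (jacobiParams M).1 (jacobiParams M).2 :=
    (measurable_jacobiMatrix (n := m + 1)).comp measurable_jacobiParams
  have h' : ∀ i j, Measurable fun M : Matrix (Fin (m + 1)) (Fin (m + 1)) ℝ => M i j := fun i j =>
    (measurable_pi_apply j).comp (measurable_pi_apply (X := fun _ => Fin (m + 1) → ℝ) i)
  have heq : {M : Matrix (Fin (m + 1)) (Fin (m + 1)) ℝ |
      jacobiMatrix (n := m + 1) (jacobiParams M).1 (jacobiParams M).2 = M} =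
      ⋂ i, ⋂ j, {M | jacobiMatrix (n := m + 1) (jacobiParams M).1 (jacobiParams M).2 i j =
        M i j} := by
    ext M
    simp only [Set.mem_ofPred_eq, Set.mem_iInter]
    exact ⟨fun hM i j => congrFun (congrFun hM i) j, fun hM => by ext i j; exact hM i j⟩
  rw [heq]
  exact MeasurableSet.iInter fun i => MeasurableSet.iInter fun j =>
    measurableSet_eq_fun ((h' i j).comp h) (h' i j)

/-- The coefficients of the characteristic polynomial of the perturbed Jacobi matrix. -/
def perturbedCoeffs {m : ℕ} (p : Matrix (Fin (m + 1)) (Fin (m + 1)) ℝ × ℝ) : Fin (m + 1) → ℂ :=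
  ofReIm ((jacobiCoeffs m (jacobiParams p.1)).1,
    perturbCoeffs p.2 (jacobiCoeffs m (jacobiParams p.1)))

theorem measurable_perturbedCoeffs {m : ℕ} : Measurable (perturbedCoeffs (m := m)) := by
  have h1 : Measurable fun p : Matrix (Fin (m + 1)) (Fin (m + 1)) ℝ × ℝ =>
      jacobiCoeffs m (jacobiParams p.1) :=
    (measurable_jacobiCoeffs m).comp (measurable_jacobiParams.comp measurable_fst)
  have h2 : Measurable fun p : Matrix (Fin (m + 1)) (Fin (m + 1)) ℝ × ℝ =>
      perturbCoeffs p.2 (jacobiCoeffs m (jacobiParams p.1)) := by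
    have := measurable_perturbCoeffs.comp (measurable_snd.prodMk h1)
    exact this
  exact measurable_ofReIm.comp ((measurable_fst.comp h1).prodMk h2)

/-- `perturbedCoeffs` is defined on all matrices so as to be measurable; on Jacobi matrices it
yields the true characteristic polynomial. -/
theorem eigenvalues_multPerturbation {m : ℕ} [NeZero (m + 1)]
    {M : Matrix (Fin (m + 1)) (Fin (m + 1)) ℝ}
    (hM : jacobiMatrix (n := m + 1) (jacobiParams M).1 (jacobiParams M).2 = M) (l : ℝ) :
    eigenvalues (multPerturbation M l) = rootConfig (perturbedCoeffs (M, l)) := by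
  apply Subtype.ext
  change (multPerturbation M l).charpoly.roots = (monicPoly (perturbedCoeffs (M, l))).roots
  congr 1
  obtain ⟨h1, h2⟩ := charpoly_jacobiMatrix m (jacobiParams M).1 (jacobiParams M).2
  obtain ⟨⟨h3, h4⟩, h5, h6⟩ := monic_jacobiPolys m (jacobiParams M).1 (jacobiParams M).2
  rw [hM] at h1 h2
  have h7 : reVec (perturbedCoeffs (M, l)) = (jacobiCoeffs m (jacobiParams M)).1 := rfl
  have h8 : imVec (perturbedCoeffs (M, l)) =
    perturbCoeffs l (jacobiCoeffs m (jacobiParams M)) := rfl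
  rw [charpoly_multPerturbation, h1, h2, monicPoly_eq_re_add_im, h7, h8, lowerPoly_perturbCoeffs,
    jacobiCoeffs, monicPoly_coeffVec h3 h4, monicPoly_coeffVec h5 h6]
  simp only [Polynomial.map_mul, Polynomial.map_sub, map_C, map_X, map_add, map_mul, map_one,
    Complex.coe_algebraMap]
  ring

/-- Coefficients of polynomials whose roots form an admissible configuration. -/
def coeffRegion (m : ℕ) (S : Set ℝ) : Set (Fin (m + 1) → ℂ) :=
  {c | reIm c ∈ perturbedSet m ∧ (reIm c).2 0 / (reIm c).1 0 ∈ S}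

theorem measurableSet_coeffRegion (m : ℕ) {S : Set ℝ} (hS : MeasurableSet S) :
    MeasurableSet (coeffRegion m S) :=
  measurableSet_preimage (measurePreserving_reIm (m + 1)).measurable
    ((measurableSet_perturbedSet m).inter (measurableSet_preimage measurable_ratio hS))

/-- The two directions are the two halves of the phase argument, with the tangent equal to h(0) /
p(0). -/
theorem mem_configurations_iff {m : ℕ} {ν : Measure ℝ} {z : Fin (m + 1) → ℂ} :
    z ∈ configurations (m + 1) ν ↔ rootCoeffs z ∈ coeffRegion m ν.support := by
  constructor
  · rintro ⟨h1, h2, h3⟩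
    have h4 := mem_perturbedSet_of_configuration rfl h1 h2
    refine ⟨h4, ?_⟩
    rwa [← (mem_configurations_of_mem_perturbedSet rfl h4).2.2]
  · rintro ⟨h1, h2⟩
    obtain ⟨h3, h4, h5⟩ := mem_configurations_of_mem_perturbedSet rfl h1
    exact ⟨h3, h4, by rwa [h5]⟩

/-- The density of the coefficients of the perturbed characteristic polynomial. -/
def coeffDensity (β : ℝ) (m : ℕ) (F : ℝ → ℝ) (S : Set ℝ) (c : Fin (m + 1) → ℂ) : ℝ≥0∞ :=
  (coeffRegion m S).indicator (fun c => ENNReal.ofReal (pairDensity β m F (reIm c))) c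

theorem measurable_coeffDensity (β : ℝ) (m : ℕ) {F : ℝ → ℝ} (hF : Measurable F) {S : Set ℝ}
    (hS : MeasurableSet S) : Measurable (coeffDensity β m F S) :=
  ((measurable_pairDensity β m hF).comp
    (measurePreserving_reIm (m + 1)).measurable).ennreal_ofReal.indicator
      (measurableSet_coeffRegion m hS)

theorem factorial_inv_mul_coeffDensity {β : ℝ} (hβ : 0 < β) {m : ℕ} (F : ℝ → ℝ) (ν : Measure ℝ)
    (z : Fin (m + 1) → ℂ) :
    ((m + 1).factorial : ℝ≥0∞)⁻¹ *
      (ENNReal.ofReal (vandermondeSq z) * coeffDensity β m F ν.support (rootCoeffs z)) =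
      (configurations (m + 1) ν).indicator
        (fun z => ENNReal.ofReal (jointDensity β (m + 1) F z)) z := by
  by_cases hz : z ∈ configurations (m + 1) ν
  · have hz' := mem_configurations_iff.1 hz
    have hV : 0 ≤ vandermondeSq z :=
      Finset.prod_nonneg fun _ _ => Finset.prod_nonneg fun _ _ => by positivity
    rw [Set.indicator_of_mem hz, coeffDensity, Set.indicator_of_mem hz',
      ← vandermondeSq_mul_pairDensity hβ F rfl hz'.1, ENNReal.ofReal_mul (by positivity),
      ENNReal.ofReal_mul hV, ENNReal.ofReal_inv_of_pos (by positivity), ENNReal.ofReal_natCast]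
  · have hz' : rootCoeffs z ∉ coeffRegion m ν.support := fun h => hz (mem_configurations_iff.2 h)
    rw [Set.indicator_of_notMem hz, coeffDensity, Set.indicator_of_notMem hz', mul_zero, mul_zero]

theorem sFinite_coefficientMeasure (β : ℝ) (n : ℕ) : SFinite (coefficientMeasure β n) := by
  unfold coefficientMeasure
  infer_instance

/-- The integration formula for (p, h), tested on indicators and transported by the
volume-preserving identification of ℂⁿ with ℝⁿ × ℝⁿ. -/
theorem map_perturbedCoeffs {β : ℝ} (hβ : 0 < β) (m : ℕ) {F : ℝ → ℝ} (hF : Measurable F)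
    {ν : Measure ℝ} (hν : ν = volume.withDensity fun x => ENNReal.ofReal (F x)) [SFinite ν]
    {S : Set ℝ} (hS : MeasurableSet S) (hνS : ν Sᶜ = 0) (hν0 : ν (Set.Ioi 0)ᶜ = 0) :
    ((gaussianBetaEnsemble β (m + 1)).prod ν).map perturbedCoeffs =
      volume.withDensity (coeffDensity β m F S) := by
  have := sFinite_coefficientMeasure β (m + 1)
  ext B hB
  have hB1 : Measurable (B.indicator (1 : (Fin (m + 1) → ℂ) → ℝ≥0∞)) := measurable_one.indicator hB
  have hg : Measurable fun q : (Fin (m + 1) → ℝ) × (Fin (m + 1) → ℝ) =>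
      B.indicator (1 : (Fin (m + 1) → ℂ) → ℝ≥0∞) (ofReIm q) := hB1.comp measurable_ofReIm
  have hg2 : Measurable fun p : Matrix (Fin (m + 1)) (Fin (m + 1)) ℝ × ℝ =>
      B.indicator (1 : (Fin (m + 1) → ℂ) → ℝ≥0∞) (perturbedCoeffs p) :=
    hB1.comp measurable_perturbedCoeffs
  have hmain := lintegral_perturbation hβ m hF hν hS hνS hν0 hg
  rw [← lintegral_indicator_one hB, lintegral_map hB1 measurable_perturbedCoeffs,
    lintegral_prod _ hg2.aemeasurable, gaussianBetaEnsemble,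
    lintegral_map hg2.lintegral_prod_right' measurable_jacobiMatrix]
  have h1 : ∀ x : (Fin m → ℝ) × (Fin (m + 1) → ℝ), ∀ l : ℝ,
      perturbedCoeffs (jacobiMatrix (n := m + 1) x.1 x.2, l) =
        ofReIm ((jacobiCoeffs m x).1, perturbCoeffs l (jacobiCoeffs m x)) := fun x l => by
    rw [perturbedCoeffs, jacobiParams_jacobiMatrix]
  have h2 : ∀ x : (Fin (m + 1 - 1) → ℝ) × (Fin (m + 1) → ℝ), ∫⁻ l, B.indicator
      (1 : (Fin (m + 1) → ℂ) → ℝ≥0∞) (perturbedCoeffs (jacobiMatrix (n := m + 1) x.1 x.2, l)) ∂ν =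
      ∫⁻ l, B.indicator (1 : (Fin (m + 1) → ℂ) → ℝ≥0∞)
        (ofReIm ((jacobiCoeffs m x).1, perturbCoeffs l (jacobiCoeffs m x))) ∂ν := fun x =>
    lintegral_congr fun l => by rw [h1 x l]
  rw [lintegral_congr h2]
  refine hmain.trans ?_
  have hk : Measurable ((perturbedSet m).indicator
      ({q : (Fin (m + 1) → ℝ) × (Fin (m + 1) → ℝ) | q.2 0 / q.1 0 ∈ S}.indicator
        (fun q => ENNReal.ofReal (pairDensity β m F q) *
          B.indicator (1 : (Fin (m + 1) → ℂ) → ℝ≥0∞) (ofReIm q)))) :=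
    (((measurable_pairDensity β m hF).ennreal_ofReal.mul hg).indicator
      (measurableSet_preimage measurable_ratio hS)).indicator (measurableSet_perturbedSet m)
  rw [← lintegral_indicator (measurableSet_perturbedSet m),
    ← (measurePreserving_reIm (m + 1)).lintegral_comp hk,
    ← lintegral_indicator_one hB,
    lintegral_withDensity_eq_lintegral_mul _ (measurable_coeffDensity β m hF hS) hB1]
  refine lintegral_congr fun c => ?_
  rw [Pi.mul_apply, coeffDensity]
  by_cases h3 : reIm c ∈ perturbedSet m
  · rw [Set.indicator_of_mem h3]
    by_cases h4 : (reIm c).2 0 / (reIm c).1 0 ∈ S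
    · have h5 : c ∈ coeffRegion m S := ⟨h3, h4⟩
      rw [Set.indicator_of_mem h5]
      exact Set.indicator_of_mem (by exact h4) _
    · have h5 : c ∉ coeffRegion m S := fun h => h4 h.2
      rw [Set.indicator_of_notMem h5, zero_mul]
      exact Set.indicator_of_notMem (by exact h4) _
  · rw [Set.indicator_of_notMem h3, Set.indicator_of_notMem fun h => h3 h.1, zero_mul]

end MultPert

end

/-! ### The law of the eigenvalues. -/

theorem theorem2p1 {Ω : Type*} [MeasurableSpace Ω] (P : Measure Ω) [IsProbabilityMeasure P]
    (n : ℕ) [NeZero n] (β : ℝ) (hβ : 0 < β)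
    (J : Ω → Matrix (Fin n) (Fin n) ℝ) (hJ : HasLaw J (MultPert.gaussianBetaEnsemble β n) P)
    (l : Ω → ℝ) (hl : ∀ᵐ ω ∂P, 0 < l ω)
    (F : ℝ → ℝ) (hF : Measurable F) (hF0 : ∀ x, 0 ≤ F x)
    (ν : Measure ℝ) (hν : ν = volume.withDensity fun x => ENNReal.ofReal (F x))
    (hlν : HasLaw l ν P) (hJl : IndepFun J l P) :
    (∀ᵐ ω ∂P, ∀ z : Fin n → ℂ,
      MultPert.toConfig z = MultPert.eigenvalues (MultPert.multPerturbation (J ω) (l ω)) →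
        z ∈ MultPert.configurations n ν ∧ l ω = Real.tan (MultPert.argSum z)) ∧
    HasLaw (fun ω => MultPert.eigenvalues (MultPert.multPerturbation (J ω) (l ω)))
      (((volume.restrict (MultPert.configurations n ν)).withDensity fun z =>
        ENNReal.ofReal (MultPert.jointDensity β n F z)).map MultPert.toConfig) P := by
  obtain ⟨m, rfl⟩ : ∃ m, n = m + 1 := Nat.exists_eq_succ_of_ne_zero (NeZero.ne n)
  have hprob : IsProbabilityMeasure ν := hlν.map_eq ▸ Measure.isProbabilityMeasure_map
    hlν.aemeasurable
  have hS : MeasurableSet ν.support := Measure.isClosed_support.measurableSet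
  have hνS : ν ν.supportᶜ = 0 := Measure.measure_compl_support
  have hν0 : ν (Set.Ioi 0)ᶜ = 0 := by
    rw [← hlν.map_eq, Measure.map_apply_of_aemeasurable hlν.aemeasurable
      measurableSet_Ioi.compl]
    exact hl
  have hpair : AEMeasurable (fun ω => (J ω, l ω)) P := hJ.aemeasurable.prodMk hlν.aemeasurable
  have hcm : AEMeasurable (fun ω => MultPert.perturbedCoeffs (J ω, l ω)) P :=
    MultPert.measurable_perturbedCoeffs.comp_aemeasurable hpair
  have hlaw : P.map (fun ω => MultPert.perturbedCoeffs (J ω, l ω)) =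
      volume.withDensity (MultPert.coeffDensity β m F ν.support) := by
    rw [← MultPert.map_perturbedCoeffs hβ m hF hν hS hνS hν0, ← hJ.map_eq]
    conv_rhs => rw [← hlν.map_eq]
    rw [← (indepFun_iff_map_prod_eq_prod_map_map hJ.aemeasurable hlν.aemeasurable).1 hJl,
      AEMeasurable.map_map_of_aemeasurable
        MultPert.measurable_perturbedCoeffs.aemeasurable hpair]
    rfl
  have hJae : ∀ᵐ ω ∂P, MultPert.jacobiMatrix (n := m + 1) (MultPert.jacobiParams (J ω)).1
      (MultPert.jacobiParams (J ω)).2 = J ω := by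
    refine (ae_map_iff hJ.aemeasurable
      (MultPert.measurableSet_jacobiMatrix_jacobiParams m)).1 ?_
    rw [hJ.map_eq, MultPert.gaussianBetaEnsemble, ae_map_iff
      MultPert.measurable_jacobiMatrix.aemeasurable
      (MultPert.measurableSet_jacobiMatrix_jacobiParams m)]
    refine ae_of_all _ fun x => ?_
    have h := MultPert.jacobiParams_jacobiMatrix (m := m) x
    rw [h]
  have hev : ∀ᵐ ω ∂P, MultPert.eigenvalues (MultPert.multPerturbation (J ω) (l ω)) =
      MultPert.rootConfig (MultPert.perturbedCoeffs (J ω, l ω)) := by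
    filter_upwards [hJae] with ω hω
    exact MultPert.eigenvalues_multPerturbation hω (l ω)
  -- The law of the coefficients has a density that vanishes off this region.
  have hmem : ∀ᵐ ω ∂P, MultPert.perturbedCoeffs (J ω, l ω) ∈
      MultPert.coeffRegion m ν.support := by
    have hR := MultPert.measurableSet_coeffRegion m hS
    refine (ae_map_iff hcm hR).1 ?_
    rw [hlaw]
    have h : MultPert.coeffDensity β m F ν.support =
        (MultPert.coeffRegion m ν.support).indicator
          fun c => ENNReal.ofReal (MultPert.pairDensity β m F (MultPert.reIm c)) := rfl
    rw [h, withDensity_indicator hR]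
    exact (withDensity_absolutelyContinuous _ _).ae_le (ae_restrict_mem hR)
  have hvol : AEMeasurable (MultPert.rootConfig (n := m + 1))
      (P.map fun ω => MultPert.perturbedCoeffs (J ω, l ω)) := by
    rw [hlaw]
    exact (MultPert.aemeasurable_rootConfig (m + 1)).mono_ac
      (withDensity_absolutelyContinuous _ _)
  refine ⟨?_, ?_, ?_⟩
  · filter_upwards [hev, hmem] with ω hω hωm z hz
    rw [hω, ← MultPert.rootConfig_rootCoeffs] at hz
    have hpoly : MultPert.rootCoeffs z = MultPert.perturbedCoeffs (J ω, l ω) :=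
      MultPert.rootConfig_injective hz
    rw [← hpoly] at hωm
    refine ⟨MultPert.mem_configurations_iff.2 hωm, ?_⟩
    -- The tangent is h(0) / p(0), which is l because p(0) ≠ 0 on this region.
    rw [(MultPert.mem_configurations_of_mem_perturbedSet rfl hωm.1).2.2, hpoly]
    refine (MultPert.perturbCoeffs_zero_div (fun h => ?_) _).symm
    have hpos := hωm.1.1
    rw [hpoly] at hpos
    have h0 : (MultPert.reIm (MultPert.perturbedCoeffs (J ω, l ω))).1 0 = 0 := h
    simp [h0] at hpos
  · exact (hvol.comp_aemeasurable hcm).congr (hev.mono fun ω h => h.symm)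
  · rw [Measure.map_congr hev]
    have h := AEMeasurable.map_map_of_aemeasurable hvol hcm
    refine h.symm.trans ?_
    -- What remains is a pointwise identity of densities on ℂⁿ, the factor 1 / n! being part of the
    -- normalizing constant.
    rw [hlaw, MultPert.map_rootConfig_withDensity (MultPert.measurable_coeffDensity β m hF hS)]
    have hC : MeasurableSet (MultPert.configurations (m + 1) ν) := by
      have : MultPert.configurations (m + 1) ν =
          MultPert.rootCoeffs ⁻¹' MultPert.coeffRegion m ν.support := by
        ext z
        exact MultPert.mem_configurations_iff
      rw [this]
      exact measurableSet_preimage (MultPert.measurable_rootCoeffs _)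
        (MultPert.measurableSet_coeffRegion m hS)
    rw [← withDensity_indicator hC]
    congr 2
    funext z
    exact MultPert.factorial_inv_mul_coeffDensity hβ F ν z
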